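/- Let $X_1, X_2, \dots$ be a strictly stationary sequence of real random variables with mean $\mu$, variance $\sigma^2 > 0$ and autocorrelations $\rho_k = \mathrm{Cov}(X_1, X_{1+k})/\sigma^2$. Let $$\alpha_X(n) = \sup_{k \ge 1}\ \sup\bigl\{ |P(A \cap B) - P(A)P(B)| : A \in \sigma(X_1,\dots,X_k),\ B \in \sigma(X_{k+n}, X_{k+n+1}, \dots) \bigr\}$$ be its $\alpha$-mixing coefficients, and suppose that for some $\delta > 0$ $$E|X_1|^{4+2\delta} < \infty \qquad\text{and}\qquad \sum_{n \ge 1} \alpha_X(n)^{\delta/(2+\delta)} < \infty .$$ Let $\bar X_n = \frac1n\sum_{i=1}^n X_i$, $\hat\sigma_n^2 = \frac1n \sum_{i=1}^n (X_i - \bar X_n)^2$ and, for $k \ge 1$, $$\hat\rho_k = \hat\rho_{k,n} = \frac{1}{\hat\sigma_n^2}\cdot\frac1n\sum_{i=1}^{n-k} (X_i - \bar X_n)(X_{i+k} - \bar X_n).$$ Fix $r$, and put $W_i^{(k)} = (X_i - \mu)(X_{i+k} - \mu)$ for $0 \le k \le r$. Then for all $0 \le j, k \le r$ the series $\sum_{l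 \ge 2} \mathrm{Cov}(W_1^{(j)}, W_l^{(k)})$ converges absolutely; the matrix $\Sigma = (\Sigma_{jk})_{0 \le j,k \le r}$, $$\Sigma_{jk} = \mathrm{Cov}\bigl(W_1^{(j)}, W_1^{(k)}\bigr) + \sum_{l \ge 2} \Bigl[ \mathrm{Cov}\bigl(W_1^{(j)}, W_l^{(k)}\bigr) + \mathrm{Cov}\bigl(W_l^{(j)}, W_1^{(k)}\bigr) \Bigr],$$ is symmetric and positive semidefinite; and, as $n \to \infty$, $$\sqrt n\, \bigl( (\hat\rho_1, \dots, \hat\rho_r) - (\rho_1, \dots, \rho_r) \bigr)^T \xrightarrow{d} N(0, A^T \Sigma A).$$ Here $A$ is the $(r+1) \times r$ matrix of partial derivatives $A_{ij} = \partial h_j / \partial x_i$ ($0 \le i \le r$, $1 \le j \le r$) of the ratio map $h(x_0, \dots, x_r) = (x_1/x_0, \dots, x_r/x_0)$ at the point $\sigma^2 (1, \rho_1, \dots, \rho_r)$; that is, $A_{0j} = -\rho_j/\sigma^2$, $A_{jj} = 1/\sigma^2$, and all other entries are $0$. (The limit may be degenerate.) -/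

import Mathlib

open MeasureTheory ProbabilityTheory Filter

noncomputable section

namespace TimeSeries

/-! A sequence `X : ℕ → Ω → ℝ` is indexed from `0`: `X i` is the `(i+1)`-st observation. -/

variable {Ω : Type*} [MeasurableSpace Ω]

/-- Strict stationarity: every shift of the sequence has the same law (on `ℝ^ℕ`). -/
def StrictlyStationary (μ : Measure Ω) (X : ℕ → Ω → ℝ) : Prop :=
  ∀ m : ℕ, μ.map (fun ω i => X (i + m) ω) = μ.map (fun ω i => X i ω)

/-- The sigma-algebra generated by `X 0, …, X k`. -/
abbrev past (X : ℕ → Ω → ℝ) (k : ℕ) : MeasurableSpace Ω :=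
  ⨆ i ∈ Set.Iic k, MeasurableSpace.comap (X i) inferInstance

/-- The sigma-algebra generated by `X k, X (k + 1), …`. -/
abbrev future (X : ℕ → Ω → ℝ) (k : ℕ) : MeasurableSpace Ω :=
  ⨆ i ∈ Set.Ici k, MeasurableSpace.comap (X i) inferInstance

/-- The strong (Rosenblatt) mixing coefficient `α_X(n)`: the supremum of
`|P(A ∩ B) - P(A) P(B)|` over all `k`, all `A` in the past up to time `k` and all `B` in the
future from time `k + n` on. -/
def alphaCoeff (μ : Measure Ω) (X : ℕ → Ω → ℝ) (n : ℕ) : ℝ :=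
  sSup {x : ℝ | ∃ (k : ℕ) (A B : Set Ω), MeasurableSet[past X k] A ∧
    MeasurableSet[future X (k + n)] B ∧ x = |μ.real (A ∩ B) - μ.real A * μ.real B|}

/-- The autocovariance `Cov(X_1, X_{1+k})`; for `k = 0` it is the variance `σ²`. -/
def autocov (μ : Measure Ω) (X : ℕ → Ω → ℝ) (k : ℕ) : ℝ := cov[X 0, X k; μ]

/-- The autocorrelation `ρ_k = Cov(X_1, X_{1+k}) / Var(X_1)`. -/
def autocorr (μ : Measure Ω) (X : ℕ → Ω → ℝ) (k : ℕ) : ℝ := cov[X 0, X k; μ] / Var[X 0; μ]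

/-- The mean of the first `n` observations. -/
def sampleMean (X : ℕ → Ω → ℝ) (n : ℕ) (ω : Ω) : ℝ :=
  (∑ i ∈ Finset.range n, X i ω) / n

/-- The sample variance with divisor `n`. -/
def sampleVar (X : ℕ → Ω → ℝ) (n : ℕ) (ω : Ω) : ℝ :=
  (∑ i ∈ Finset.range n, (X i ω - sampleMean X n ω) ^ 2) / n

/-- The sample autocorrelation of order `k` of the first `n` observations. -/
def sampleAutocorr (X : ℕ → Ω → ℝ) (k n : ℕ) (ω : Ω) : ℝ :=
  ((∑ i ∈ Finset.range (n - k),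
    (X i ω - sampleMean X n ω) * (X (i + k) ω - sampleMean X n ω)) / n) / sampleVar X n ω

/-- The lag-`k` product of the centred sequence at time `i`. -/
def lagProd (μ : Measure Ω) (X : ℕ → Ω → ℝ) (k i : ℕ) (ω : Ω) : ℝ :=
  (X i ω - ∫ ω', X 0 ω' ∂μ) * (X (i + k) ω - ∫ ω', X 0 ω' ∂μ)

/-- The long-run covariance matrix of the vector of lag products of orders `0, …, r`. -/
def longRunCov (μ : Measure Ω) (X : ℕ → Ω → ℝ) (r : ℕ) : Matrix (Fin (r + 1)) (Fin (r + 1)) ℝ :=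
  Matrix.of fun j k =>
    cov[lagProd μ X j 0, lagProd μ X k 0; μ] +
      ∑' l : ℕ, (cov[lagProd μ X j 0, lagProd μ X k (l + 1); μ] +
        cov[lagProd μ X j (l + 1), lagProd μ X k 0; μ])

/-- The ratio map `(x_0, …, x_r) ↦ (x_1 / x_0, …, x_r / x_0)`. -/
def ratioMap {r : ℕ} (x : Fin (r + 1) → ℝ) : Fin r → ℝ := fun j => x j.succ / x 0

/-- The matrix of partial derivatives of the ratio map at `x`, the row `i` belonging to the
variable `x_i` and the column `j` to the component `x_{j+1} / x_0`. -/
def ratioJacobian {r : ℕ} (x : Fin (r + 1) → ℝ) : Matrix (Fin (r + 1)) (Fin r) ℝ :=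
  Matrix.of fun i j =>
    Fin.cases (-(x j.succ) / x 0 ^ 2) (fun i' : Fin r => if i' = j then 1 / x 0 else 0) i

theorem hasFDerivAt_ratioMap {r : ℕ} (x : Fin (r + 1) → ℝ) (hx : x 0 ≠ 0) :
    HasFDerivAt (ratioMap (r := r))
      (Matrix.toLin' (ratioJacobian x).transpose).toContinuousLinearMap x := by
  rw [hasFDerivAt_pi']
  intro j
  have h1 : HasFDerivAt (fun y : Fin (r + 1) → ℝ => y j.succ)
      (ContinuousLinearMap.proj (R := ℝ) (φ := fun _ : Fin (r + 1) => ℝ) j.succ) x :=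
    (ContinuousLinearMap.proj (R := ℝ) (φ := fun _ : Fin (r + 1) => ℝ) j.succ).hasFDerivAt
  have h0 : HasFDerivAt (fun y : Fin (r + 1) → ℝ => y 0)
      (ContinuousLinearMap.proj (R := ℝ) (φ := fun _ : Fin (r + 1) => ℝ) 0) x :=
    (ContinuousLinearMap.proj (R := ℝ) (φ := fun _ : Fin (r + 1) => ℝ) 0).hasFDerivAt
  have h := h1.mul ((hasDerivAt_inv hx).comp_hasFDerivAt x h0)
  have he : (fun y : Fin (r + 1) → ℝ => ratioMap y j) =
      (fun y => y j.succ) * ((fun t : ℝ => t⁻¹) ∘ fun y => y 0) := by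
    funext y; simp [ratioMap, div_eq_mul_inv]
  rw [he]
  refine h.congr_fderiv ?_
  ext v
  simp [ratioJacobian, Matrix.mulVec, dotProduct, Fin.sum_univ_succ]
  field_simp

end TimeSeries

end

/-! The sample autocorrelations are ratios of sample autocovariances, and up to an error of order
`1/√n` in `L¹` the vector of `√n (γ̂_k - γ_k)` is the normalized sum of the centred lag products. So
the core is a central limit theorem for linear combinations of lag products. Such a combination
depends on `r + 1` consecutive observations. Hence it is again strictly stationary, its mixing
coefficients are those of `X` delayed by `r`, and it has moments of order `2 + δ` because `X` has
moments of order `4 + 2δ`.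

Covariances are controlled by Davydov's inequality (`AlphaBound.abs_covariance_le_rpow`). It gives
the absolute convergence of the covariance series and linear growth of variances of sums, with a
constant that tends to zero with the moment of order `2 + δ`. Truncation therefore reduces the limit
theorem to bounded variables.

For bounded variables, Stein's method is applied to characteristic functions. Let `T = S_n/√n`, with
variance `v` and characteristic function `φ`. If `φ'(x) + x v φ(x)` is small, then `φ` is close to
`exp(-x² v/2)` (`norm_integral_cexp_sub_exp_le`). In `φ'`, each summand `Z_j` is paired with the
part of the sum at distance at most `m` from `j`. What is left consists of a quadratic Taylor error
of order `m/√n`, the deviation of a window sum of products from the variance, of order `m/√n` plus a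
tail of the mixing series, and a decoupling error of order `√n α(m+1)`. With `m` about `ε√n` the
last one vanishes because `α` is antitone and summable, and then `ε → 0`.

The Cramér-Wold device turns the scalar theorem into the joint one, the long-run variance of a
combination with coefficients `c` being `cᵀ Σ c`. The passage to autocorrelations needs no Taylor
expansion: whenever the sample variance is nonzero, `√n (ρ̂ - ρ)` equals `γ₀/σ̂²` times `Aᵀ √n (γ̂ -
γ)` exactly, so consistency of `σ̂²` and Slutsky's lemma suffice. -/

/-! ### Strong mixing of two sigma-algebras and the bounded covariance inequality -/

namespace TimeSeries

open scoped Topology ENNReal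

variable {Ω : Type*}

/-- The strong mixing coefficient of the sigma-algebras `m₁` and `m₂` is at most `a`. -/
def AlphaBound (m₁ m₂ : MeasurableSpace Ω) {mΩ : MeasurableSpace Ω} (μ : Measure Ω) (a : ℝ) :
    Prop :=
  ∀ A B : Set Ω, MeasurableSet[m₁] A → MeasurableSet[m₂] B →
    |μ.real (A ∩ B) - μ.real A * μ.real B| ≤ a

theorem AlphaBound.mono {m₁ m₂ m₁' m₂' _mΩ : MeasurableSpace Ω}
    {μ : Measure Ω} {a : ℝ} (h : AlphaBound m₁ m₂ μ a)
    (h₁ : m₁' ≤ m₁) (h₂ : m₂' ≤ m₂) : AlphaBound m₁' m₂' μ a :=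
  fun A B hA hB => h A B (h₁ A hA) (h₂ B hB)

theorem AlphaBound.mono_right {m₁ m₂ mΩ : MeasurableSpace Ω}
    {μ : Measure Ω} {a b : ℝ} (h : AlphaBound m₁ m₂ μ a)
    (hab : a ≤ b) : AlphaBound m₁ m₂ μ b :=
  fun A B hA hB => (h A B hA hB).trans hab

theorem AlphaBound.nonneg {m₁ m₂ mΩ : MeasurableSpace Ω}
    {μ : Measure Ω} {a : ℝ} (h : AlphaBound m₁ m₂ μ a) :
    0 ≤ a :=
  (abs_nonneg _).trans (h ∅ ∅ (@MeasurableSet.empty _ m₁) (@MeasurableSet.empty _ m₂))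

theorem memLp_of_abs_le {mΩ : MeasurableSpace Ω} {μ : Measure Ω} [IsFiniteMeasure μ] {f : Ω → ℝ} {p : ℝ≥0∞} {C : ℝ} (hf : Measurable f)
    (hC : ∀ ω, |f ω| ≤ C) : MemLp f p μ :=
  MemLp.of_bound hf.aestronglyMeasurable C (ae_of_all _ hC)

/-- With `h = E[g | m] - E g`, the covariance is `E[f h]`, of modulus at most `C E|h|`. As `h` has
mean zero, `E|h|` is twice the integral of `h` over `A = {h ≥ 0}`, which is again a covariance with
`g`. So `f` may be replaced by an indicator at the cost of a factor `2C`. -/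
theorem exists_measurableSet_abs_covariance_le {m mΩ : MeasurableSpace Ω} {μ : Measure Ω}
    [IsProbabilityMeasure μ]
    (hm : m ≤ mΩ) {f g : Ω → ℝ} {C D : ℝ} (hf : Measurable[m] f) (hfC : ∀ ω, |f ω| ≤ C)
    (hg : Measurable g) (hgD : ∀ ω, |g ω| ≤ D) :
    ∃ A, MeasurableSet[m] A ∧
      |cov[f, g; μ]| ≤ 2 * C * |cov[A.indicator (fun _ => (1 : ℝ)), g; μ]| := by
  have hf' : Measurable f := hf.mono hm le_rfl
  have hgi : Integrable g μ := (memLp_of_abs_le (p := 1) hg hgD).integrable le_rfl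
  set h : Ω → ℝ := fun ω => (μ[g|m]) ω - ∫ x, g x ∂μ with hh
  have hhm : Measurable[m] h := (stronglyMeasurable_condExp.measurable).sub_const _
  have hhi : Integrable h μ := integrable_condExp.sub (integrable_const _)
  have hh0 : ∫ ω, h ω ∂μ = 0 := by
    rw [hh, integral_sub integrable_condExp (integrable_const _), integral_condExp hm]
    simp
  have key : ∀ (u : Ω → ℝ) (E : ℝ), Measurable[m] u → (∀ ω, |u ω| ≤ E) →
      cov[u, g; μ] = ∫ ω, u ω * h ω ∂μ := by
    intro u E hu huE
    have hu' : Measurable u := hu.mono hm le_rfl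
    have hui : Integrable u μ := (memLp_of_abs_le (p := 1) hu' huE).integrable le_rfl
    have hug : Integrable (u * g) μ :=
      hgi.bdd_mul hu'.aestronglyMeasurable (ae_of_all _ huE)
    have huc : Integrable (fun ω => u ω * (μ[g|m]) ω) μ :=
      integrable_condExp.bdd_mul hu'.aestronglyMeasurable (ae_of_all _ huE)
    rw [covariance_eq_sub (memLp_of_abs_le hu' huE) (memLp_of_abs_le hg hgD)]
    have h1 : ∫ ω, (u * g) ω ∂μ = ∫ ω, u ω * (μ[g|m]) ω ∂μ := by
      rw [← integral_condExp hm]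
      exact integral_congr_ae (condExp_mul_of_stronglyMeasurable_left hu.stronglyMeasurable hug hgi)
    rw [h1, hh]
    simp only [mul_sub]
    rw [integral_sub huc (hui.mul_const _), integral_mul_const]
  refine ⟨{ω | 0 ≤ h ω}, measurableSet_le measurable_const hhm, ?_⟩
  set A : Set Ω := {ω | 0 ≤ h ω} with hA
  have hAm : MeasurableSet[m] A := measurableSet_le measurable_const hhm
  have hind : Measurable[m] (A.indicator (fun _ => (1 : ℝ))) :=
    (@measurable_const _ _ _ m _).indicator hAm
  have hindb : ∀ ω, |A.indicator (fun _ => (1 : ℝ)) ω| ≤ 1 := by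
    intro ω; by_cases hω : ω ∈ A <;> simp [hω]
  have hindi : Integrable (fun ω => A.indicator (fun _ => (1 : ℝ)) ω * h ω) μ :=
    hhi.bdd_mul (hind.mono hm le_rfl).aestronglyMeasurable (ae_of_all _ hindb)
  rw [key f C hf hfC, key _ 1 hind hindb]
  have habs : ∀ ω, |h ω| = 2 * (A.indicator (fun _ => (1 : ℝ)) ω * h ω) - h ω := by
    intro ω
    by_cases hω : 0 ≤ h ω
    · simp [hA, hω, abs_of_nonneg hω]; ring
    · simp [hA, hω, abs_of_neg (not_le.mp hω)]
  have hC0 : 0 ≤ C := by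
    obtain ⟨ω⟩ := nonempty_of_isProbabilityMeasure μ
    exact (abs_nonneg _).trans (hfC ω)
  calc |∫ ω, f ω * h ω ∂μ| ≤ ∫ ω, |f ω * h ω| ∂μ := abs_integral_le_integral_abs
    _ ≤ ∫ ω, C * |h ω| ∂μ := by
        refine integral_mono_of_nonneg (ae_of_all _ fun ω => abs_nonneg _) (hhi.abs.const_mul _)
          (ae_of_all _ fun ω => ?_)
        simp only [abs_mul]
        exact mul_le_mul_of_nonneg_right (hfC ω) (abs_nonneg _)
    _ = C * (2 * ∫ ω, A.indicator (fun _ => (1 : ℝ)) ω * h ω ∂μ) := by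
        rw [integral_const_mul]
        simp only [habs]
        rw [integral_sub (hindi.const_mul _) hhi, hh0, integral_const_mul, sub_zero]
    _ ≤ 2 * C * |∫ ω, A.indicator (fun _ => (1 : ℝ)) ω * h ω ∂μ| := by
        nlinarith [le_abs_self (∫ ω, A.indicator (fun _ => (1 : ℝ)) ω * h ω ∂μ)]

/-- Ibragimov's covariance inequality for bounded variables. -/
theorem AlphaBound.abs_covariance_le {m₁ m₂ mΩ : MeasurableSpace Ω}
    {μ : Measure Ω} [IsProbabilityMeasure μ] {a : ℝ}
    (h : AlphaBound m₁ m₂ μ a) (hm₁ : m₁ ≤ mΩ) (hm₂ : m₂ ≤ mΩ) {f g : Ω → ℝ} {C D : ℝ}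
    (hf : Measurable[m₁] f) (hfC : ∀ ω, |f ω| ≤ C) (hg : Measurable[m₂] g)
    (hgD : ∀ ω, |g ω| ≤ D) : |cov[f, g; μ]| ≤ 4 * a * C * D := by
  obtain ⟨ω⟩ := nonempty_of_isProbabilityMeasure μ
  have hC : 0 ≤ C := (abs_nonneg _).trans (hfC ω)
  have hD : 0 ≤ D := (abs_nonneg _).trans (hgD ω)
  obtain ⟨A, hA, h1⟩ := exists_measurableSet_abs_covariance_le (μ := μ) hm₁ hf hfC
    (hg.mono hm₂ le_rfl) hgD
  have hindb : ∀ (A : Set Ω) ω, |A.indicator (fun _ => (1 : ℝ)) ω| ≤ 1 := by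
    intro A ω; by_cases hω : ω ∈ A <;> simp [hω]
  have hindm : ∀ {A : Set Ω}, MeasurableSet A → Measurable (A.indicator (fun _ => (1 : ℝ))) :=
    fun hA => measurable_const.indicator hA
  -- The same replacement on the other side, with the indicator of `A` now in the role of the fixed
  -- variable. The two factors 2 give the constant 4.
  obtain ⟨B, hB, h2⟩ := exists_measurableSet_abs_covariance_le (μ := μ) hm₂ hg hgD
    (hindm (hm₁ A hA)) (hindb A)
  rw [covariance_comm g, covariance_comm (B.indicator _)] at h2
  have h3 : cov[A.indicator (fun _ => (1 : ℝ)), B.indicator (fun _ => (1 : ℝ)); μ] =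
      μ.real (A ∩ B) - μ.real A * μ.real B := by
    rw [covariance_eq_sub (memLp_of_abs_le (hindm (hm₁ A hA)) (hindb A))
      (memLp_of_abs_le (hindm (hm₂ B hB)) (hindb B))]
    have : (A.indicator (fun _ => (1 : ℝ)) * B.indicator (fun _ => (1 : ℝ))) =
        (A ∩ B).indicator (fun _ => (1 : ℝ)) := by
      ext ω; by_cases h1 : ω ∈ A <;> by_cases h2 : ω ∈ B <;> simp [h1, h2]
    rw [this, integral_indicator_const _ ((hm₁ A hA).inter (hm₂ B hB)),
      integral_indicator_const _ (hm₁ A hA), integral_indicator_const _ (hm₂ B hB)]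
    simp
  rw [h3] at h2
  have h4 := h A B hA hB
  calc |cov[f, g; μ]| ≤ 2 * C * (2 * D * a) := by
        refine h1.trans (mul_le_mul_of_nonneg_left (h2.trans ?_) (by positivity))
        exact mul_le_mul_of_nonneg_left h4 (by positivity)
    _ = 4 * a * C * D := by ring

/-- Truncation of a real number to `0` outside `[-K, K]`. -/
noncomputable def truncate (K x : ℝ) : ℝ := if |x| ≤ K then x else 0

theorem measurable_truncate (K : ℝ) : Measurable (truncate K) :=
  Measurable.ite (measurableSet_le (by fun_prop) measurable_const) measurable_id measurable_const

theorem abs_truncate_le {K : ℝ} (hK : 0 ≤ K) (x : ℝ) : |truncate K x| ≤ K := by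
  unfold truncate; split_ifs with h <;> simp [*]

theorem abs_truncate_le_abs (K x : ℝ) : |truncate K x| ≤ |x| := by
  unfold truncate; split_ifs with h <;> simp

/-- If both arguments are at most `K` in modulus, nothing changes. Otherwise the product of the
truncations is zero, since truncation sends large values to `0` instead of clipping them. The larger
modulus `v` then exceeds `K`, so `|x y| ≤ v² ≤ v² (v/K)^δ`. -/
theorem abs_mul_sub_truncate_mul_le {K δ : ℝ} (hK : 0 < K) (hδ : 0 < δ) (x y : ℝ) :
    |x * y - truncate K x * truncate K y| ≤ K ^ (-δ) * (|x| ^ (2 + δ) + |y| ^ (2 + δ)) := by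
  have main : ∀ u v : ℝ, 0 ≤ u → u ≤ v → K < v →
      u * v ≤ K ^ (-δ) * (u ^ (2 + δ) + v ^ (2 + δ)) := by
    intro u v hu huv hv
    have hv0 : 0 < v := hK.trans hv
    have h1 : 1 ≤ K ^ (-δ) * v ^ δ := by
      rw [Real.rpow_neg hK.le, ← div_eq_inv_mul, le_div_iff₀ (by positivity), one_mul]
      exact Real.rpow_le_rpow hK.le hv.le hδ.le
    have h2 : v ^ (2 + δ) = v ^ 2 * v ^ δ := by
      rw [Real.rpow_add hv0]; norm_num
    calc u * v ≤ v ^ 2 * 1 := by nlinarith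
      _ ≤ v ^ 2 * (K ^ (-δ) * v ^ δ) := by gcongr
      _ = K ^ (-δ) * v ^ (2 + δ) := by rw [h2]; ring
      _ ≤ _ := by
        have : 0 ≤ u ^ (2 + δ) := by positivity
        gcongr; linarith
  by_cases h : |x| ≤ K ∧ |y| ≤ K
  · simp only [truncate, h.1, h.2, if_true, sub_self, abs_zero]; positivity
  · have h0 : truncate K x * truncate K y = 0 := by
      unfold truncate
      by_cases h1 : |x| ≤ K
      · have : ¬ |y| ≤ K := fun h2 => h ⟨h1, h2⟩
        simp [this]
      · simp [h1]
    rw [h0, sub_zero, abs_mul]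
    rcases le_total |x| |y| with hxy | hxy
    · refine main _ _ (abs_nonneg _) hxy ?_
      by_contra h3
      exact h ⟨hxy.trans (not_lt.mp h3), not_lt.mp h3⟩
    · rw [mul_comm, add_comm]
      refine main _ _ (abs_nonneg _) hxy ?_
      by_contra h3
      exact h ⟨not_lt.mp h3, hxy.trans (not_lt.mp h3)⟩

end TimeSeries

/-! ### Davydov's inequality, mixing coefficients and stationarity -/

namespace TimeSeries

open scoped Topology ENNReal

variable {Ω : Type*}

theorem integrable_abs_rpow {_mΩ : MeasurableSpace Ω} {μ : Measure Ω} {f : Ω → ℝ} {p : ℝ}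
    (hp : 0 < p) (hf : MemLp f (ENNReal.ofReal p) μ) : Integrable (fun ω => |f ω| ^ p) μ := by
  have := hf.integrable_norm_rpow (by simpa using hp) (by simp)
  simpa [ENNReal.toReal_ofReal hp.le] using this

theorem memLp_two_of_memLp {_mΩ : MeasurableSpace Ω} {μ : Measure Ω} [IsFiniteMeasure μ]
    {f : Ω → ℝ} {δ : ℝ} (hδ : 0 < δ) (hf : MemLp f (ENNReal.ofReal (2 + δ)) μ) : MemLp f 2 μ := by
  refine hf.mono_exponent ?_
  rw [show (2 : ℝ≥0∞) = ENNReal.ofReal 2 by simp]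
  exact ENNReal.ofReal_le_ofReal (by linarith)

theorem AlphaBound.abs_covariance_le_truncate {m₁ m₂ mΩ : MeasurableSpace Ω} {μ : Measure Ω}
    [IsProbabilityMeasure μ] {a δ N K : ℝ} (h : AlphaBound m₁ m₂ μ a) (hm₁ : m₁ ≤ mΩ)
    (hm₂ : m₂ ≤ mΩ) {f g : Ω → ℝ} (hf : Measurable[m₁] f) (hg : Measurable[m₂] g) (hδ : 0 < δ)
    (hfp : MemLp f (ENNReal.ofReal (2 + δ)) μ) (hgp : MemLp g (ENNReal.ofReal (2 + δ)) μ)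
    (hfN : ∫ ω, |f ω| ^ (2 + δ) ∂μ ≤ N) (hgN : ∫ ω, |g ω| ^ (2 + δ) ∂μ ≤ N) (hK : 0 < K) :
    |cov[f, g; μ]| ≤ 4 * a * K ^ 2 + 4 * N * K ^ (-δ) := by
  have hf' : Measurable f := hf.mono hm₁ le_rfl
  have hg' : Measurable g := hg.mono hm₂ le_rfl
  have hf2 := memLp_two_of_memLp hδ hfp
  have hg2 := memLp_two_of_memLp hδ hgp
  have hfpi := integrable_abs_rpow (by linarith) hfp
  have hgpi := integrable_abs_rpow (by linarith) hgp
  set u : Ω → ℝ := fun ω => truncate K (f ω) with hu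
  set v : Ω → ℝ := fun ω => truncate K (g ω) with hv
  have hum : Measurable[m₁] u := (measurable_truncate K).comp hf
  have hvm : Measurable[m₂] v := (measurable_truncate K).comp hg
  have hub : ∀ ω, |u ω| ≤ K := fun ω => abs_truncate_le hK.le _
  have hvb : ∀ ω, |v ω| ≤ K := fun ω => abs_truncate_le hK.le _
  have hu2 : MemLp u 2 μ := memLp_of_abs_le (hum.mono hm₁ le_rfl) hub
  have hv2 : MemLp v 2 μ := memLp_of_abs_le (hvm.mono hm₂ le_rfl) hvb
  have h1 := h.abs_covariance_le hm₁ hm₂ hum hub hvm hvb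
  -- Stated for an arbitrary measure because it serves twice: on `μ` for `E[f g]`, and on `μ.prod μ`
  -- for `E f · E g`, the integral of `f z.1 * g z.2`. Each use costs `2 N K ^ (-δ)`.
  have hsum : ∀ {A : Type _} {_ : MeasurableSpace A} (ν : Measure A) (F G U V : A → ℝ),
      Integrable (fun ω => F ω * G ω) ν → Integrable (fun ω => U ω * V ω) ν →
      Integrable (fun ω => |F ω| ^ (2 + δ)) ν → Integrable (fun ω => |G ω| ^ (2 + δ)) ν →
      (∀ ω, U ω = truncate K (F ω)) → (∀ ω, V ω = truncate K (G ω)) →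
      ∫ ω, |F ω| ^ (2 + δ) ∂ν ≤ N → ∫ ω, |G ω| ^ (2 + δ) ∂ν ≤ N →
      |∫ ω, F ω * G ω ∂ν - ∫ ω, U ω * V ω ∂ν| ≤ 2 * N * K ^ (-δ) := by
    intro A _ ν F G U V hFG hUV hF hG hU hV hFN hGN
    rw [← integral_sub hFG hUV]
    refine abs_integral_le_integral_abs.trans ?_
    calc ∫ ω, |F ω * G ω - U ω * V ω| ∂ν
        ≤ ∫ ω, K ^ (-δ) * (|F ω| ^ (2 + δ) + |G ω| ^ (2 + δ)) ∂ν := by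
          refine integral_mono_of_nonneg (ae_of_all _ fun ω => abs_nonneg _)
            ((hF.add hG).const_mul _) (ae_of_all _ fun ω => ?_)
          simp only [hU, hV]
          exact abs_mul_sub_truncate_mul_le hK hδ _ _
      _ = K ^ (-δ) * (∫ ω, |F ω| ^ (2 + δ) ∂ν + ∫ ω, |G ω| ^ (2 + δ) ∂ν) := by
          rw [integral_const_mul, integral_add hF hG]
      _ ≤ K ^ (-δ) * (N + N) := by gcongr
      _ = _ := by ring
  have h2 := hsum μ f g u v (hf2.integrable_mul hg2) (hu2.integrable_mul hv2) hfpi hgpi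
    (fun _ => rfl) (fun _ => rfl) hfN hgN
  have h3 := hsum (μ.prod μ) (fun z => f z.1) (fun z => g z.2) (fun z => u z.1) (fun z => v z.2)
    ((hf2.integrable (by norm_num)).mul_prod (hg2.integrable (by norm_num)))
    ((hu2.integrable (by norm_num)).mul_prod (hv2.integrable (by norm_num)))
    (hfpi.comp_fst μ) (hgpi.comp_snd μ) (fun _ => rfl) (fun _ => rfl)
    (by rw [integral_fun_fst (fun x => |f x| ^ (2 + δ))]; simpa using hfN)
    (by rw [integral_fun_snd (fun x => |g x| ^ (2 + δ))]; simpa using hgN)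
  rw [integral_prod_mul f g, integral_prod_mul u v] at h3
  rw [covariance_eq_sub hu2 hv2] at h1
  rw [covariance_eq_sub hf2 hg2]
  simp only [Pi.mul_apply] at h1 ⊢
  rw [abs_le] at h1 h2 h3 ⊢
  constructor <;> nlinarith [h1.1, h1.2, h2.1, h2.2, h3.1, h3.2]

/-- Davydov's covariance inequality. -/
theorem AlphaBound.abs_covariance_le_rpow {m₁ m₂ mΩ : MeasurableSpace Ω} {μ : Measure Ω}
    [IsProbabilityMeasure μ] {a δ N : ℝ} (h : AlphaBound m₁ m₂ μ a) (hm₁ : m₁ ≤ mΩ)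
    (hm₂ : m₂ ≤ mΩ) {f g : Ω → ℝ} (hf : Measurable[m₁] f) (hg : Measurable[m₂] g) (hδ : 0 < δ)
    (hfp : MemLp f (ENNReal.ofReal (2 + δ)) μ) (hgp : MemLp g (ENNReal.ofReal (2 + δ)) μ)
    (hfN : ∫ ω, |f ω| ^ (2 + δ) ∂μ ≤ N) (hgN : ∫ ω, |g ω| ^ (2 + δ) ∂μ ≤ N) :
    |cov[f, g; μ]| ≤ 8 * (a ^ (δ / (2 + δ)) * N ^ (2 / (2 + δ))) := by
  have hN : 0 ≤ N := le_trans (integral_nonneg fun ω => by positivity) hfN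
  -- Both `a` and `N` may vanish, so that the optimal level is undefined. They are enlarged by `ε`,
  -- and `ε → 0` at the end by continuity.
  have key : ∀ ε : ℝ, 0 < ε → |cov[f, g; μ]| ≤
      8 * ((a + ε) ^ (δ / (2 + δ)) * (N + ε) ^ (2 / (2 + δ))) := by
    intro ε hε
    have ha : 0 < a + ε := by linarith [h.nonneg]
    have hN' : 0 < N + ε := by linarith
    -- This level makes `a K²` and `N K ^ (-δ)` equal; the two terms, each with the factor 4, add up
    -- to the constant 8.
    have hK : 0 < ((N + ε) / (a + ε)) ^ (1 / (2 + δ)) := by positivity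
    have h1 := (h.mono_right (b := a + ε) (by linarith)).abs_covariance_le_truncate hm₁ hm₂ hf hg hδ
      hfp hgp (N := N + ε) (by linarith) (by linarith) hK
    refine h1.trans (le_of_eq ?_)
    have e1 : (((N + ε) / (a + ε)) ^ (1 / (2 + δ))) ^ 2 =
        (N + ε) ^ (2 / (2 + δ)) * (a + ε) ^ (-(2 / (2 + δ))) := by
      rw [← Real.rpow_natCast, ← Real.rpow_mul (by positivity), Real.div_rpow hN'.le ha.le,
        Real.rpow_neg ha.le, div_eq_mul_inv]
      norm_num [div_eq_inv_mul, mul_comm]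
    have e2 : (((N + ε) / (a + ε)) ^ (1 / (2 + δ))) ^ (-δ) =
        (N + ε) ^ (-(δ / (2 + δ))) * (a + ε) ^ (δ / (2 + δ)) := by
      rw [← Real.rpow_mul (by positivity), Real.div_rpow hN'.le ha.le,
        show 1 / (2 + δ) * -δ = -(δ / (2 + δ)) by ring, Real.rpow_neg ha.le, div_inv_eq_mul]
    have e3 : (a + ε) * (a + ε) ^ (-(2 / (2 + δ))) = (a + ε) ^ (δ / (2 + δ)) := by
      nth_rewrite 1 [← Real.rpow_one (a + ε)]
      rw [← Real.rpow_add ha]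
      congr 1; field_simp; ring
    have e4 : (N + ε) * (N + ε) ^ (-(δ / (2 + δ))) = (N + ε) ^ (2 / (2 + δ)) := by
      nth_rewrite 1 [← Real.rpow_one (N + ε)]
      rw [← Real.rpow_add hN']
      congr 1; field_simp; ring
    rw [e1, e2]
    calc _ = 4 * (((a + ε) * (a + ε) ^ (-(2 / (2 + δ)))) * (N + ε) ^ (2 / (2 + δ))) +
          4 * (((N + ε) * (N + ε) ^ (-(δ / (2 + δ)))) * (a + ε) ^ (δ / (2 + δ))) := by ring
      _ = _ := by rw [e3, e4]; ring
  have hcont : ContinuousAt (fun ε : ℝ =>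
      8 * ((a + ε) ^ (δ / (2 + δ)) * (N + ε) ^ (2 / (2 + δ)))) 0 := by
    refine ContinuousAt.mul continuousAt_const (ContinuousAt.mul ?_ ?_)
    · exact (continuousAt_const.add continuousAt_id).rpow_const (Or.inr (by positivity))
    · exact (continuousAt_const.add continuousAt_id).rpow_const (Or.inr (by positivity))
  have hlim : Tendsto (fun ε : ℝ => 8 * ((a + ε) ^ (δ / (2 + δ)) * (N + ε) ^ (2 / (2 + δ))))
      (𝓝[>] 0) (𝓝 (8 * ((a + 0) ^ (δ / (2 + δ)) * (N + 0) ^ (2 / (2 + δ))))) :=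
    hcont.tendsto.mono_left nhdsWithin_le_nhds
  simp only [add_zero] at hlim
  exact ge_of_tendsto hlim (eventually_nhdsWithin_of_forall fun ε hε => key ε hε)

/-! ### Past and future sigma-algebras -/

section PastFuture

variable {X : ℕ → Ω → ℝ}

theorem measurable_past {i k : ℕ} (h : i ≤ k) : Measurable[past X k] (X i) :=
  measurable_iff_comap_le.mpr
    (le_iSup₂_of_le (f := fun i (_ : i ∈ Set.Iic k) => MeasurableSpace.comap (X i) inferInstance)
      i h le_rfl)

theorem measurable_future {i k : ℕ} (h : k ≤ i) : Measurable[future X k] (X i) :=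
  measurable_iff_comap_le.mpr
    (le_iSup₂_of_le (f := fun i (_ : i ∈ Set.Ici k) => MeasurableSpace.comap (X i) inferInstance)
      i h le_rfl)

theorem past_le_of_measurable {m : MeasurableSpace Ω} {k : ℕ}
    (h : ∀ i ≤ k, Measurable[m] (X i)) : past X k ≤ m :=
  iSup₂_le fun i hi => (h i hi).comap_le

theorem future_le_of_measurable {m : MeasurableSpace Ω} {k : ℕ}
    (h : ∀ i, k ≤ i → Measurable[m] (X i)) : future X k ≤ m :=
  iSup₂_le fun i hi => (h i hi).comap_le

theorem future_anti {k l : ℕ} (h : k ≤ l) : future X l ≤ future X k :=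
  future_le_of_measurable fun _ hi => measurable_future (h.trans hi)

end PastFuture

/-! ### Elementary properties of the mixing coefficients -/

section MixingCoefficients

variable [mΩ : MeasurableSpace Ω] {μ : Measure Ω} {X : ℕ → Ω → ℝ}

theorem past_le (hX : ∀ i, Measurable (X i)) (k : ℕ) : past X k ≤ mΩ :=
  iSup₂_le fun i _ => (hX i).comap_le

theorem future_le (hX : ∀ i, Measurable (X i)) (k : ℕ) : future X k ≤ mΩ :=
  iSup₂_le fun i _ => (hX i).comap_le

theorem alphaCoeff_le {n : ℕ} {a : ℝ}
    (h : ∀ k, AlphaBound (past X k) (future X (k + n)) μ a) : alphaCoeff μ X n ≤ a := by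
  refine csSup_le ⟨_, 0, ∅, ∅, @MeasurableSet.empty _ (past X 0),
    @MeasurableSet.empty _ (future X (0 + n)), rfl⟩ ?_
  rintro x ⟨k, A, B, hA, hB, rfl⟩
  exact h k A B hA hB

variable [IsProbabilityMeasure μ]

theorem abs_measureReal_inter_sub_le_one (A B : Set Ω) :
    |μ.real (A ∩ B) - μ.real A * μ.real B| ≤ 1 := by
  have h1 : μ.real (A ∩ B) ≤ 1 := measureReal_le_one
  have h2 : 0 ≤ μ.real (A ∩ B) := measureReal_nonneg
  have h3 : μ.real A ≤ 1 := measureReal_le_one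
  have h4 : 0 ≤ μ.real A := measureReal_nonneg
  have h5 : μ.real B ≤ 1 := measureReal_le_one
  have h6 : 0 ≤ μ.real B := measureReal_nonneg
  rw [abs_le]; constructor <;> nlinarith

theorem alphaBound_alphaCoeff (k n : ℕ) :
    AlphaBound (past X k) (future X (k + n)) μ (alphaCoeff μ X n) := by
  intro A B hA hB
  refine le_csSup ⟨1, ?_⟩ ⟨k, A, B, hA, hB, rfl⟩
  rintro x ⟨_, A, B, _, _, rfl⟩
  exact abs_measureReal_inter_sub_le_one A B

theorem alphaCoeff_nonneg (n : ℕ) : 0 ≤ alphaCoeff μ X n :=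
  (alphaBound_alphaCoeff (μ := μ) (X := X) 0 n).nonneg

theorem alphaCoeff_le_one (n : ℕ) : alphaCoeff μ X n ≤ 1 :=
  alphaCoeff_le fun _ A B _ _ => abs_measureReal_inter_sub_le_one A B

theorem alphaCoeff_antitone : Antitone (alphaCoeff μ X) := fun m n h =>
  alphaCoeff_le fun k => (alphaBound_alphaCoeff k m).mono le_rfl (future_anti (by omega))

theorem alphaBound_of_le {k l n : ℕ} (h : k + n ≤ l) :
    AlphaBound (past X k) (future X l) μ (alphaCoeff μ X n) :=
  (alphaBound_alphaCoeff k n).mono le_rfl (future_anti h)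

/-- A sequence of functions of `r + 1` consecutive observations mixes with the delay `r`. -/
theorem alphaCoeff_add_le {Z : ℕ → Ω → ℝ} {r : ℕ}
    (h : ∀ (m : MeasurableSpace Ω) (i : ℕ), (∀ j ≤ r, Measurable[m] (X (i + j))) →
      Measurable[m] (Z i)) (n : ℕ) : alphaCoeff μ Z (n + r) ≤ alphaCoeff μ X n := by
  refine alphaCoeff_le fun k => ?_
  refine (alphaBound_of_le (X := X) (k := k + r) (l := k + (n + r)) (n := n) (by omega)).mono ?_ ?_
  · exact past_le_of_measurable fun i hi => h _ _ fun j hj => measurable_past (by omega)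
  · exact future_le_of_measurable fun i hi => h _ _ fun j hj => measurable_future (by omega)

theorem summable_alphaCoeff_rpow_of_window {Z : ℕ → Ω → ℝ} {r : ℕ}
    (h : ∀ (m : MeasurableSpace Ω) (i : ℕ), (∀ j ≤ r, Measurable[m] (X (i + j))) →
      Measurable[m] (Z i)) {θ : ℝ} (hθ : 0 ≤ θ) (hs : Summable fun n => alphaCoeff μ X n ^ θ) :
    Summable fun n => alphaCoeff μ Z n ^ θ := by
  rw [← summable_nat_add_iff r]
  exact hs.of_nonneg_of_le (fun n => Real.rpow_nonneg (alphaCoeff_nonneg _) _) fun n =>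
    Real.rpow_le_rpow (alphaCoeff_nonneg _) (alphaCoeff_add_le h n) hθ

/-- The coefficients lie in `[0, 1]`, so raising them to a power `θ ≤ 1` does not decrease them.
This is all the mixing that the bounded case needs. -/
theorem summable_alphaCoeff {θ : ℝ} (hθ₁ : θ ≤ 1)
    (hs : Summable fun n => alphaCoeff μ X n ^ θ) (hθ : 0 < θ) : Summable (alphaCoeff μ X) := by
  refine hs.of_nonneg_of_le alphaCoeff_nonneg fun n => ?_
  rcases (alphaCoeff_nonneg (μ := μ) (X := X) n).eq_or_lt with h0 | h0
  · rw [← h0, Real.zero_rpow hθ.ne']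
  · nth_rewrite 1 [← Real.rpow_one (alphaCoeff μ X n)]
    exact Real.rpow_le_rpow_of_exponent_ge h0 (alphaCoeff_le_one n) hθ₁

end MixingCoefficients

/-! ### Consequences of strict stationarity -/

section Stationarity

variable [MeasurableSpace Ω] {μ : Measure Ω} {X : ℕ → Ω → ℝ}

theorem StrictlyStationary.integral_comp (h : StrictlyStationary μ X)
    (hX : ∀ i, Measurable (X i)) (m : ℕ) {G : (ℕ → ℝ) → ℝ} (hG : Measurable G) :
    ∫ ω, G (fun i => X (i + m) ω) ∂μ = ∫ ω, G (fun i => X i ω) ∂μ := by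
  have h1 : Measurable fun ω i => X (i + m) ω := measurable_pi_iff.mpr fun i => hX _
  have h2 : Measurable fun ω i => X i ω := measurable_pi_iff.mpr fun i => hX _
  rw [← integral_map h1.aemeasurable hG.aestronglyMeasurable, h m,
    integral_map h2.aemeasurable hG.aestronglyMeasurable]

theorem StrictlyStationary.integral_comp_eq (h : StrictlyStationary μ X)
    (hX : ∀ i, Measurable (X i)) (m : ℕ) {G : ℝ → ℝ} (hG : Measurable G) :
    ∫ ω, G (X m ω) ∂μ = ∫ ω, G (X 0 ω) ∂μ := by
  simpa using h.integral_comp hX m (G := fun x => G (x 0)) (hG.comp (measurable_pi_apply 0))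

theorem StrictlyStationary.identDistrib (h : StrictlyStationary μ X)
    (hX : ∀ i, Measurable (X i)) (m : ℕ) : IdentDistrib (X m) (X 0) μ μ := by
  refine ⟨(hX m).aemeasurable, (hX 0).aemeasurable, ?_⟩
  have h1 : Measurable fun ω i => X (i + m) ω := measurable_pi_iff.mpr fun i => hX _
  have h2 : Measurable fun ω i => X i ω := measurable_pi_iff.mpr fun i => hX _
  have := congrArg (Measure.map (fun x : ℕ → ℝ => x 0)) (h m)
  rw [Measure.map_map (measurable_pi_apply 0) h1, Measure.map_map (measurable_pi_apply 0) h2] at this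
  simpa [Function.comp_def] using this

theorem StrictlyStationary.memLp (h : StrictlyStationary μ X) (hX : ∀ i, Measurable (X i))
    {p : ℝ≥0∞} (hp : MemLp (X 0) p μ) (m : ℕ) : MemLp (X m) p μ :=
  (h.identDistrib hX m).symm.memLp_snd hp

theorem StrictlyStationary.integral_eq (h : StrictlyStationary μ X) (hX : ∀ i, Measurable (X i))
    (m : ℕ) : ∫ ω, X m ω ∂μ = ∫ ω, X 0 ω ∂μ :=
  h.integral_comp_eq hX m measurable_id

theorem StrictlyStationary.covariance_eq (h : StrictlyStationary μ X)
    (hX : ∀ i, Measurable (X i)) (i d : ℕ) : cov[X i, X (i + d); μ] = cov[X 0, X d; μ] := by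
  unfold covariance
  rw [h.integral_eq hX i, h.integral_eq hX (i + d), h.integral_eq hX d]
  have := h.integral_comp hX i
    (G := fun x => (x 0 - ∫ ω, X 0 ω ∂μ) * (x d - ∫ ω, X 0 ω ∂μ)) (by fun_prop)
  simpa [add_comm] using this

/-- A sequence obtained by applying one measurable function to all shifts of a strictly stationary
sequence is strictly stationary. -/
theorem StrictlyStationary.comp (h : StrictlyStationary μ X) (hX : ∀ i, Measurable (X i))
    {F : (ℕ → ℝ) → ℝ} (hF : Measurable F) :
    StrictlyStationary μ fun i ω => F fun j => X (i + j) ω := by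
  intro m
  have h1 : Measurable fun ω i => X (i + m) ω := measurable_pi_iff.mpr fun i => hX _
  have h2 : Measurable fun ω i => X i ω := measurable_pi_iff.mpr fun i => hX _
  have hG : Measurable fun (x : ℕ → ℝ) (i : ℕ) => F fun j => x (i + j) :=
    measurable_pi_iff.mpr fun i => hF.comp (measurable_pi_iff.mpr fun j => measurable_pi_apply _)
  have := congrArg (Measure.map fun (x : ℕ → ℝ) (i : ℕ) => F fun j => x (i + j)) (h m)
  rw [Measure.map_map hG h1, Measure.map_map hG h2] at this
  simpa [Function.comp_def, add_right_comm] using this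

end Stationarity

end TimeSeries

/-! ### Double sums and variances of sums -/

namespace TimeSeries

open scoped Topology ENNReal

section DoubleSums

/-- Each row is split at the diagonal. On either side the distance to the diagonal is injective in
the column index, so each half is a partial sum of `b`. -/
theorem sum_sum_le_card_mul_tsum {b : ℕ → ℝ} (hb0 : ∀ d, 0 ≤ b d) (hb : Summable b)
    {c : ℕ → ℕ → ℝ} (h₁ : ∀ i d, c i (i + d) ≤ b d) (h₂ : ∀ i d, c (i + d) i ≤ b d)
    (I : Finset ℕ) : ∑ i ∈ I, ∑ j ∈ I, c i j ≤ I.card * (2 * ∑' d, b d) := by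
  rw [← nsmul_eq_mul]
  refine Finset.sum_le_card_nsmul _ _ _ fun i _ => ?_
  rw [← Finset.sum_filter_add_sum_filter_not I (fun j => i ≤ j), two_mul]
  have key : ∀ (J : Finset ℕ) (f : ℕ → ℕ), Set.InjOn f J →
      (∀ j ∈ J, c i j ≤ b (f j)) → ∑ j ∈ J, c i j ≤ ∑' d, b d := by
    intro J f hf hJ
    calc ∑ j ∈ J, c i j ≤ ∑ j ∈ J, b (f j) := Finset.sum_le_sum hJ
      _ = ∑ d ∈ J.image f, b d := (Finset.sum_image hf).symm
      _ ≤ ∑' d, b d := hb.sum_le_tsum _ fun d _ => hb0 d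
  refine add_le_add (key _ (fun j => j - i) ?_ ?_) (key _ (fun j => i - j) ?_ ?_)
  · intro j hj k hk hjk
    simp only [Finset.coe_filter, Set.mem_ofPred_eq] at hj hk hjk
    omega
  · intro j hj
    have := h₁ i (j - i)
    rwa [Nat.add_sub_cancel' (Finset.mem_filter.mp hj).2] at this
  · intro j hj k hk hjk
    simp only [Finset.coe_filter, Set.mem_ofPred_eq] at hj hk hjk
    omega
  · intro j hj
    have := h₂ j (i - j)
    rwa [Nat.add_sub_cancel' (by have := (Finset.mem_filter.mp hj).2; omega)] at this

theorem sum_sum_eq_of_symm {g : ℕ → ℕ → ℝ} (hg : ∀ i j, g i j = g j i) (n : ℕ) :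
    ∑ i ∈ Finset.range n, ∑ j ∈ Finset.range n, g i j =
      ∑ i ∈ Finset.range n, g i i +
        2 * ∑ d ∈ Finset.range n, ∑ i ∈ Finset.range (n - (d + 1)), g i (i + (d + 1)) := by
  induction n with
  | zero => simp
  | succ n ih =>
    have h1 : ∑ i ∈ Finset.range (n + 1), ∑ j ∈ Finset.range (n + 1), g i j =
        ∑ i ∈ Finset.range n, ∑ j ∈ Finset.range n, g i j + 2 * ∑ i ∈ Finset.range n, g i n +
          g n n := by
      simp only [Finset.sum_range_succ, Finset.sum_add_distrib, hg n]
      ring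
    have h2 : ∑ d ∈ Finset.range (n + 1),
          ∑ i ∈ Finset.range (n + 1 - (d + 1)), g i (i + (d + 1)) =
        ∑ d ∈ Finset.range n, ∑ i ∈ Finset.range (n - (d + 1)), g i (i + (d + 1)) +
          ∑ i ∈ Finset.range n, g i n := by
      rw [Finset.sum_range_succ, Nat.sub_self, Finset.range_zero, Finset.sum_empty, add_zero,
        ← Finset.sum_range_reflect (fun i => g i n), ← Finset.sum_add_distrib]
      refine Finset.sum_congr rfl fun d hd => ?_
      have hd' := Finset.mem_range.mp hd
      rw [show n + 1 - (d + 1) = (n - (d + 1)) + 1 by omega, Finset.sum_range_succ]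
      congr 2 <;> omega
    rw [h1, h2, ih, Finset.sum_range_succ]
    ring

/-- Regroups a band of width `m` by diagonals; each off-diagonal occurs twice by symmetry. It turns
the window sum of products into `m + 1` sums of lag products, whose variances can be estimated one
by one. -/
theorem sum_sum_window_eq {g : ℕ → ℕ → ℝ} (hg : ∀ i j, g i j = g j i) (n m : ℕ) :
    ∑ i ∈ Finset.range n, ∑ j ∈ Finset.range n, (if i ≤ j + m ∧ j ≤ i + m then g i j else 0) =
      ∑ d ∈ Finset.range (m + 1), (if d = 0 then 1 else 2) *
        ∑ i ∈ Finset.range (n - d), g i (i + d) := by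
  rw [sum_sum_eq_of_symm (g := fun i j => if i ≤ j + m ∧ j ≤ i + m then g i j else 0)
    (fun i j => by simp only [hg i j, and_comm]), Finset.sum_range_succ', add_comm]
  congr 1
  · rw [Finset.mul_sum]
    -- The terms vanish for `d ≥ m` by the condition and for `d ≥ n` because the inner range is
    -- empty. The ranges `n` and `m` are compared through a common larger one.
    have h1 : ∀ N, n ≤ N → m ≤ N → ∀ K, (K = n ∨ K = m) → ∑ d ∈ Finset.range K,
        (if d < m then 2 * ∑ i ∈ Finset.range (n - (d + 1)), g i (i + (d + 1)) else 0) =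
        ∑ d ∈ Finset.range N,
        (if d < m then 2 * ∑ i ∈ Finset.range (n - (d + 1)), g i (i + (d + 1)) else 0) := by
      intro N hn hm K hK
      refine Finset.sum_subset (Finset.range_subset_range.mpr (by omega)) fun d _ hd => ?_
      have hd' : K ≤ d := by simpa using hd
      split_ifs with h
      · rw [show n - (d + 1) = 0 by omega]; simp
      · rfl
    have h2 := h1 (max n m) (le_max_left _ _) (le_max_right _ _) n (Or.inl rfl)
    have h3 := h1 (max n m) (le_max_left _ _) (le_max_right _ _) m (Or.inr rfl)
    rw [← h3] at h2
    calc _ = ∑ d ∈ Finset.range n,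
        (if d < m then 2 * ∑ i ∈ Finset.range (n - (d + 1)), g i (i + (d + 1)) else 0) := by
          refine Finset.sum_congr rfl fun d _ => ?_
          by_cases h : d < m
          · rw [if_pos h]
            congr 1
            refine Finset.sum_congr rfl fun i _ => if_pos ⟨by omega, by omega⟩
          · rw [if_neg h, Finset.sum_eq_zero, mul_zero]
            exact fun i _ => if_neg (by omega)
      _ = _ := by
          rw [h2]
          refine Finset.sum_congr rfl fun d hd => ?_
          rw [if_pos (Finset.mem_range.mp hd), if_neg (by omega)]
  · simp

/-- The weights are at most one and tend to one for each fixed `d`, so dominated convergence for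
series applies. The index `d` stands for the lag `d + 1`. -/
theorem tendsto_sum_weighted {γ : ℕ → ℝ} (hγ : Summable γ) :
    Tendsto (fun n : ℕ => ∑ d ∈ Finset.range n, ((n - (d + 1) : ℕ) : ℝ) / n * γ d) atTop
      (𝓝 (∑' d, γ d)) := by
  have h1 : ∀ n : ℕ, ∑ d ∈ Finset.range n, ((n - (d + 1) : ℕ) : ℝ) / n * γ d =
      ∑' d, ((n - (d + 1) : ℕ) : ℝ) / n * γ d := by
    intro n
    refine (tsum_eq_sum fun d hd => ?_).symm
    have : n - (d + 1) = 0 := by have := Finset.mem_range.not.mp hd; omega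
    simp [this]
  simp only [h1]
  refine tendsto_tsum_of_dominated_convergence hγ.abs (fun d => ?_)
    (Eventually.of_forall fun n d => ?_)
  · have h2 : Tendsto (fun n : ℕ => 1 - ((d : ℝ) + 1) / n) atTop (𝓝 (1 - 0)) :=
      tendsto_const_nhds.sub (tendsto_const_div_atTop_nhds_zero_nat _)
    have h3 : Tendsto (fun n : ℕ => ((n - (d + 1) : ℕ) : ℝ) / n) atTop (𝓝 1) := by
      rw [sub_zero] at h2
      refine h2.congr' ?_
      filter_upwards [eventually_ge_atTop (d + 1)] with n hn
      have : (0 : ℝ) < n := by exact_mod_cast (by omega : 0 < n)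
      rw [Nat.cast_sub hn]
      push_cast
      field_simp
    simpa using h3.mul_const (γ d)
  · rw [norm_mul, Real.norm_eq_abs, Real.norm_eq_abs]
    refine mul_le_of_le_one_left (abs_nonneg _) ?_
    rw [abs_of_nonneg (by positivity)]
    exact div_le_one_of_le₀ (by exact_mod_cast Nat.sub_le _ _) (by positivity)

end DoubleSums

section Variance

variable {Ω : Type*} [MeasurableSpace Ω] {μ : Measure Ω} {Z : ℕ → Ω → ℝ}

theorem variance_sum_le_card_mul_tsum [IsFiniteMeasure μ] (hZ : ∀ i, MemLp (Z i) 2 μ)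
    {b : ℕ → ℝ} (hb : Summable b) (hcov : ∀ i d, |cov[Z i, Z (i + d); μ]| ≤ b d)
    (I : Finset ℕ) : Var[fun ω => ∑ i ∈ I, Z i ω; μ] ≤ I.card * (2 * ∑' d, b d) := by
  rw [variance_fun_sum' fun i _ => hZ i]
  exact sum_sum_le_card_mul_tsum (fun d => (abs_nonneg _).trans (hcov 0 d)) hb
    (fun i d => (le_abs_self _).trans (hcov i d))
    (fun i d => (le_abs_self _).trans (by rw [covariance_comm]; exact hcov i d)) I

theorem tendsto_variance_sum_div [IsFiniteMeasure μ] (hZ : ∀ i, MemLp (Z i) 2 μ)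
    {γ : ℕ → ℝ} (hγ : Summable γ) (hcov : ∀ i d, cov[Z i, Z (i + d); μ] = γ d) :
    Tendsto (fun n : ℕ => Var[fun ω => ∑ i ∈ Finset.range n, Z i ω; μ] / n) atTop
      (𝓝 (γ 0 + 2 * ∑' d, γ (d + 1))) := by
  have h1 := (tendsto_sum_weighted ((summable_nat_add_iff 1).mpr hγ)).const_mul 2 |>.const_add (γ 0)
  refine h1.congr' ?_
  filter_upwards [eventually_gt_atTop 0] with n hn
  have hn' : (n : ℝ) ≠ 0 := by exact_mod_cast hn.ne'
  rw [variance_fun_sum' fun i _ => hZ i, sum_sum_eq_of_symm fun i j => covariance_comm _ _]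
  simp only [hcov]
  have h2 : ∀ i, cov[Z i, Z i; μ] = γ 0 := fun i => hcov i 0
  simp only [h2, Finset.sum_const, Finset.card_range, nsmul_eq_mul]
  rw [add_div, mul_div_cancel_left₀ _ hn', mul_div_assoc, Finset.sum_div]
  congr 2
  refine Finset.sum_congr rfl fun d _ => ?_
  ring

theorem variance_sum_le_card_mul_sum [IsProbabilityMeasure μ] {ι : Type*} {T : ι → Ω → ℝ}
    (D : Finset ι) (hT : ∀ d ∈ D, MemLp (T d) 2 μ) :
    Var[fun ω => ∑ d ∈ D, T d ω; μ] ≤ D.card * ∑ d ∈ D, Var[T d; μ] := by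
  have hi : ∀ d ∈ D, Integrable (T d) μ := fun d hd => (hT d hd).integrable (by norm_num)
  have hc : ∀ d ∈ D, MemLp (fun ω => T d ω - ∫ ω', T d ω' ∂μ) 2 μ :=
    fun d hd => (hT d hd).sub (memLp_const _)
  have hsum : MemLp (fun ω => ∑ d ∈ D, T d ω) 2 μ := memLp_finsetSum _ hT
  rw [variance_eq_integral hsum.aemeasurable, integral_finsetSum _ hi]
  calc ∫ ω, (∑ d ∈ D, T d ω - ∑ d ∈ D, ∫ ω', T d ω' ∂μ) ^ 2 ∂μ
      ≤ ∫ ω, D.card * ∑ d ∈ D, (T d ω - ∫ ω', T d ω' ∂μ) ^ 2 ∂μ := by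
        refine integral_mono_of_nonneg (ae_of_all _ fun ω => by positivity)
          ((integrable_finsetSum _ fun d hd => (hc d hd).integrable_sq).const_mul _)
          (ae_of_all _ fun ω => ?_)
        simp only [← Finset.sum_sub_distrib]
        exact sq_sum_le_card_mul_sum_sq
    _ = _ := by
        rw [integral_const_mul, integral_finsetSum _ fun d hd => (hc d hd).integrable_sq]
        congr 1
        exact Finset.sum_congr rfl fun d hd =>
          (variance_eq_integral (hT d hd).aemeasurable).symm

end Variance

end TimeSeries

/-! ### Variance bounds for bounded strongly mixing sequences -/

namespace TimeSeries

open scoped Topology ENNReal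

theorem abs_mul_le_mul {a b A B : ℝ} (ha : |a| ≤ A) (hb : |b| ≤ B) : |a * b| ≤ A * B := by
  rw [abs_mul]
  exact mul_le_mul ha hb (abs_nonneg _) ((abs_nonneg _).trans ha)

/-- The sum of the products of all pairs of variables with indices at distance at most `m`. -/
noncomputable def windowSum {Ω : Type*} (Z : ℕ → Ω → ℝ) (n m : ℕ) (ω : Ω) : ℝ :=
  ∑ i ∈ Finset.range n, ∑ j ∈ Finset.range n,
    if i ≤ j + m ∧ j ≤ i + m then Z i ω * Z j ω else 0

theorem abs_windowSum_le {Ω : Type*} {Z : ℕ → Ω → ℝ} {C : ℝ} (hC : ∀ i ω, |Z i ω| ≤ C) (n m : ℕ) (ω : Ω) :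
    |windowSum Z n m ω| ≤ n * (n * (C * C)) := by
  have hC0 : 0 ≤ C := (abs_nonneg _).trans (hC 0 ω)
  unfold windowSum
  refine (Finset.abs_sum_le_sum_abs _ _).trans ?_
  calc _ ≤ ∑ i ∈ Finset.range n, ∑ j ∈ Finset.range n, C * C := by
        refine Finset.sum_le_sum fun i _ => (Finset.abs_sum_le_sum_abs _ _).trans ?_
        refine Finset.sum_le_sum fun j _ => ?_
        split_ifs
        · exact abs_mul_le_mul (hC i ω) (hC j ω)
        · simpa using mul_nonneg hC0 hC0
    _ = _ := by simp

section Bounded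

variable {Ω : Type*} [mΩ : MeasurableSpace Ω] {μ : Measure Ω} [IsProbabilityMeasure μ]
  {Z : ℕ → Ω → ℝ} {C : ℝ}

theorem abs_covariance_le_alphaCoeff (hZ : ∀ i, Measurable (Z i)) {k l n : ℕ} (hkl : k + n ≤ l)
    {f g : Ω → ℝ} {F G : ℝ} (hf : Measurable[past Z k] f) (hfF : ∀ ω, |f ω| ≤ F)
    (hg : Measurable[future Z l] g) (hgG : ∀ ω, |g ω| ≤ G) :
    |cov[f, g; μ]| ≤ 4 * alphaCoeff μ Z n * F * G :=
  (alphaBound_of_le hkl).abs_covariance_le (past_le hZ k) (future_le hZ l) hf hfF hg hgG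

theorem covariance_eq_integral_mul {f g : Ω → ℝ} (hf : MemLp f 2 μ) (hg : MemLp g 2 μ)
    (h0 : ∫ ω, f ω ∂μ = 0) : cov[f, g; μ] = ∫ ω, f ω * g ω ∂μ := by
  rw [covariance_eq_sub hf hg, h0]
  simp

theorem abs_integral_le_of_abs_le {f : Ω → ℝ} (h : ∀ ω, |f ω| ≤ C) : |∫ ω, f ω ∂μ| ≤ C := by
  have := norm_integral_le_of_norm_le_const (μ := μ) (f := f) (ae_of_all _ h)
  simpa using this

theorem abs_covariance_le_alphaCoeff_sq (hZ : ∀ i, Measurable (Z i)) (hC : ∀ i ω, |Z i ω| ≤ C)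
    (i d : ℕ) : |cov[Z i, Z (i + d); μ]| ≤ 4 * C ^ 2 * alphaCoeff μ Z d := by
  refine (abs_covariance_le_alphaCoeff hZ le_rfl (measurable_past le_rfl) (hC i)
    (measurable_future le_rfl) (hC (i + d))).trans (le_of_eq (by ring))

theorem variance_sum_le_of_bounded (hZ : ∀ i, Measurable (Z i)) (hC : ∀ i ω, |Z i ω| ≤ C)
    (hα : Summable (alphaCoeff μ Z)) (I : Finset ℕ) :
    Var[fun ω => ∑ i ∈ I, Z i ω; μ] ≤ I.card * (2 * ∑' d, 4 * C ^ 2 * alphaCoeff μ Z d) :=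
  variance_sum_le_card_mul_tsum (fun i => memLp_of_abs_le (hZ i) (hC i)) (hα.mul_left _)
    (abs_covariance_le_alphaCoeff_sq hZ hC) I

/-- When `e < d` the two pairs overlap in time. In `E[Z_j Z_{j+d} Z_{j+e} Z_{j+e+d}]` the centred
factor `Z_j` is separated from all others by the gap `e`, and the subtracted product of means is
controlled by `α(d) ≤ α(e)`. When `e ≥ d` the pairs are disjoint blocks (touching if `e = d`) with
gap `e - d`. -/
theorem abs_covariance_lag_le (hZ : ∀ i, Measurable (Z i)) (hC : ∀ i ω, |Z i ω| ≤ C)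
    (h0 : ∀ i, ∫ ω, Z i ω ∂μ = 0) (d j e : ℕ) :
    |cov[fun ω => Z j ω * Z (j + d) ω, fun ω => Z (j + e) ω * Z (j + e + d) ω; μ]| ≤
      8 * C ^ 4 * (alphaCoeff μ Z e + if d ≤ e then alphaCoeff μ Z (e - d) else 0) := by
  have hα := alphaCoeff_nonneg (μ := μ) (X := Z)
  have hb : ∀ i k ω, |Z i ω * Z k ω| ≤ C * C := fun i k ω => abs_mul_le_mul (hC i ω) (hC k ω)
  rcases lt_or_ge e d with hed | hed
  · rw [if_neg (by omega), add_zero, covariance_eq_sub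
      (X := fun ω => Z j ω * Z (j + d) ω) (Y := fun ω => Z (j + e) ω * Z (j + e + d) ω)
      (memLp_of_abs_le ((hZ _).mul (hZ _)) (hb j (j + d)))
      (memLp_of_abs_le ((hZ _).mul (hZ _)) (hb (j + e) (j + e + d)))]
    simp only [Pi.mul_apply]
    have hb3 : ∀ ω, |Z (j + d) ω * (Z (j + e) ω * Z (j + e + d) ω)| ≤ C * (C * C) :=
      fun ω => abs_mul_le_mul (hC _ ω) (hb _ _ ω)
    have hm3 : Measurable[future Z (j + e)] fun ω =>
        Z (j + d) ω * (Z (j + e) ω * Z (j + e + d) ω) :=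
      (measurable_future (by omega)).mul ((measurable_future le_rfl).mul
        (measurable_future (by omega)))
    have h1 := abs_covariance_le_alphaCoeff (μ := μ) hZ (le_refl (j + e))
      (measurable_past (le_refl j)) (hC j) hm3 hb3
    rw [covariance_eq_integral_mul (memLp_of_abs_le (hZ j) (hC j))
      (memLp_of_abs_le (hm3.mono (future_le hZ _) le_rfl) hb3) (h0 j)] at h1
    have h2 := abs_covariance_le_alphaCoeff_sq (μ := μ) hZ hC j d
    rw [covariance_eq_integral_mul (memLp_of_abs_le (hZ j) (hC j))
      (memLp_of_abs_le (hZ _) (hC _)) (h0 j)] at h2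
    have h3 := abs_integral_le_of_abs_le (μ := μ) (hb (j + e) (j + e + d))
    have h4 := abs_mul_le_mul h2 h3
    have h5 : alphaCoeff μ Z d ≤ alphaCoeff μ Z e := alphaCoeff_antitone hed.le
    have h6 : 4 * C ^ 2 * alphaCoeff μ Z d * (C * C) ≤ 4 * C ^ 4 * alphaCoeff μ Z e := by
      have : 0 ≤ 4 * C ^ 4 := by positivity
      nlinarith
    refine (abs_sub _ _).trans ?_
    calc _ ≤ 4 * alphaCoeff μ Z e * C * (C * (C * C)) + 4 * C ^ 4 * alphaCoeff μ Z e := by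
          refine add_le_add (le_trans (le_of_eq ?_) h1) (h4.trans h6)
          congr 2; ext ω; ring
      _ = _ := by ring
  · rw [if_pos hed]
    have h1 := abs_covariance_le_alphaCoeff (μ := μ) hZ
      (show (j + d) + (e - d) ≤ j + e by omega)
      (f := fun ω => Z j ω * Z (j + d) ω) (g := fun ω => Z (j + e) ω * Z (j + e + d) ω)
      ((measurable_past (by omega)).mul (measurable_past le_rfl)) (hb j (j + d))
      ((measurable_future le_rfl).mul (measurable_future (by omega))) (hb (j + e) (j + e + d))
    refine h1.trans ?_
    have h2 : 0 ≤ C ^ 4 * alphaCoeff μ Z e := mul_nonneg (by positivity) (hα e)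
    have h3 : 0 ≤ C ^ 4 * alphaCoeff μ Z (e - d) := mul_nonneg (by positivity) (hα _)
    nlinarith

/-- The point is uniformity in the lag `d`: summed over `e`, the two terms of
`abs_covariance_lag_le` contribute the same series, because a shift by `d` does not change the sum
of the second. Hence windows as wide as a multiple of `√n` are allowed later. -/
theorem variance_lag_sum_le (hZ : ∀ i, Measurable (Z i)) (hC : ∀ i ω, |Z i ω| ≤ C)
    (h0 : ∀ i, ∫ ω, Z i ω ∂μ = 0) (hα : Summable (alphaCoeff μ Z)) (d : ℕ) (I : Finset ℕ) :
    Var[fun ω => ∑ i ∈ I, Z i ω * Z (i + d) ω; μ] ≤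
      I.card * (32 * C ^ 4 * ∑' e, alphaCoeff μ Z e) := by
  have hs : Summable fun e => if d ≤ e then alphaCoeff μ Z (e - d) else 0 := by
    rw [← summable_nat_add_iff d]
    simpa using hα
  have ht : ∑' e, (if d ≤ e then alphaCoeff μ Z (e - d) else 0) = ∑' e, alphaCoeff μ Z e := by
    rw [← hs.sum_add_tsum_nat_add d, Finset.sum_eq_zero, zero_add]
    · simp
    · intro e he
      have := Finset.mem_range.mp he
      rw [if_neg (by omega)]
  refine (variance_sum_le_card_mul_tsum (Z := fun i ω => Z i ω * Z (i + d) ω)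
    (fun i => memLp_of_abs_le ((hZ _).mul (hZ _))
      fun ω => abs_mul_le_mul (hC i ω) (hC (i + d) ω))
    ((hα.add hs).mul_left (8 * C ^ 4)) (fun j e => abs_covariance_lag_le hZ hC h0 d j e)
    I).trans (le_of_eq ?_)
  rw [tsum_mul_left, hα.tsum_add hs, ht]
  ring

theorem measurable_windowSum (hZ : ∀ i, Measurable (Z i)) (n m : ℕ) :
    Measurable (windowSum Z n m) := by
  refine Finset.measurable_fun_sum _ fun i _ => Finset.measurable_fun_sum _ fun j _ => ?_
  split_ifs
  · exact (hZ i).mul (hZ j)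
  · exact measurable_const

/-- Cauchy-Schwarz over the `m + 1` diagonals gives one factor `m + 1`, their number gives the
other, and the 4 is the square of the weight 2 of an off-diagonal. After division by `n` the
standard deviation is of order `m/√n`. -/
theorem variance_windowSum_le (hZ : ∀ i, Measurable (Z i)) (hC : ∀ i ω, |Z i ω| ≤ C)
    (h0 : ∀ i, ∫ ω, Z i ω ∂μ = 0) (hα : Summable (alphaCoeff μ Z)) (n m : ℕ) :
    Var[windowSum Z n m; μ] ≤
      4 * (m + 1) ^ 2 * (n * (32 * C ^ 4 * ∑' e, alphaCoeff μ Z e)) := by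
  set K := 32 * C ^ 4 * ∑' e, alphaCoeff μ Z e with hK
  have hK0 : 0 ≤ K := mul_nonneg (by positivity) (tsum_nonneg alphaCoeff_nonneg)
  have h1 : windowSum Z n m = fun ω => ∑ d ∈ Finset.range (m + 1), (if d = 0 then 1 else 2) *
      ∑ i ∈ Finset.range (n - d), Z i ω * Z (i + d) ω := by
    ext ω
    exact sum_sum_window_eq (g := fun i j => Z i ω * Z j ω) (fun i j => mul_comm _ _) n m
  have hm : ∀ d, MemLp (fun ω => ∑ i ∈ Finset.range (n - d), Z i ω * Z (i + d) ω) 2 μ :=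
    fun d => memLp_finsetSum _ fun i _ => memLp_of_abs_le ((hZ _).mul (hZ _))
      fun ω => abs_mul_le_mul (hC i ω) (hC (i + d) ω)
  rw [h1]
  refine (variance_sum_le_card_mul_sum _ fun d _ => (hm d).const_mul _).trans ?_
  have h2 : ∀ d ∈ Finset.range (m + 1), Var[fun ω => (if d = 0 then 1 else 2) *
      ∑ i ∈ Finset.range (n - d), Z i ω * Z (i + d) ω; μ] ≤ 4 * (n * K) := by
    intro d _
    rw [variance_const_mul]
    have h3 := variance_lag_sum_le (μ := μ) hZ hC h0 hα d (Finset.range (n - d))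
    have h4 : ((Finset.range (n - d)).card : ℝ) * K ≤ n * K := by
      rw [Finset.card_range]
      gcongr
      exact Nat.sub_le _ _
    refine mul_le_mul ?_ (h3.trans h4) (variance_nonneg _ _) (by norm_num)
    split_ifs <;> norm_num
  have h3 := Finset.sum_le_card_nsmul _ _ _ h2
  rw [nsmul_eq_mul] at h3
  rw [Finset.card_range] at h3 ⊢
  push_cast at h3 ⊢
  calc _ ≤ ((m : ℝ) + 1) * (((m : ℝ) + 1) * (4 * (n * K))) := by gcongr
    _ = _ := by ring

/-- Inside the window the expectations are exactly the covariances in the variance of the sum. Only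
lags above `m` are lost, and these are bounded by the tail of the mixing series. -/
theorem abs_integral_windowSum_sub_le (hZ : ∀ i, Measurable (Z i)) (hC : ∀ i ω, |Z i ω| ≤ C)
    (h0 : ∀ i, ∫ ω, Z i ω ∂μ = 0) (hα : Summable (alphaCoeff μ Z)) (n m : ℕ) :
    |∫ ω, windowSum Z n m ω ∂μ - Var[fun ω => ∑ i ∈ Finset.range n, Z i ω; μ]| ≤
      n * (2 * ∑' d, 4 * C ^ 2 * alphaCoeff μ Z (d + (m + 1))) := by
  have hm : ∀ i, MemLp (Z i) 2 μ := fun i => memLp_of_abs_le (hZ i) (hC i)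
  have hi : ∀ i j, Integrable (fun ω => if i ≤ j + m ∧ j ≤ i + m then Z i ω * Z j ω else 0) μ := by
    intro i j
    split_ifs
    · exact (hm i).integrable_mul (hm j)
    · exact integrable_const _
  set b : ℕ → ℝ := fun d => if d ≤ m then 0 else 4 * C ^ 2 * alphaCoeff μ Z d with hb
  have hbs : Summable b := by
    rw [← summable_nat_add_iff (m + 1)]
    refine (((summable_nat_add_iff (m + 1)).mpr hα).mul_left (4 * C ^ 2)).congr fun d => ?_
    simp only [hb]; rw [if_neg (by omega)]
  have hbt : ∑' d, b d = ∑' d, 4 * C ^ 2 * alphaCoeff μ Z (d + (m + 1)) := by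
    rw [← hbs.sum_add_tsum_nat_add (m + 1), Finset.sum_eq_zero, zero_add]
    · refine tsum_congr fun d => ?_
      simp only [hb]; rw [if_neg (by omega)]
    · intro d hd
      have := Finset.mem_range.mp hd
      simp only [hb]; rw [if_pos (by omega)]
  have hcov : ∀ i j, cov[Z i, Z j; μ] = ∫ ω, Z i ω * Z j ω ∂μ := fun i j =>
    covariance_eq_integral_mul (hm i) (hm j) (h0 i)
  unfold windowSum
  rw [variance_fun_sum' fun i _ => hm i,
    integral_finsetSum _ fun i _ => integrable_finsetSum _ fun j _ => hi i j,
    ← Finset.sum_sub_distrib]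
  refine (Finset.abs_sum_le_sum_abs _ _).trans ?_
  calc _ ≤ ∑ i ∈ Finset.range n, ∑ j ∈ Finset.range n,
        (if i ≤ j + m ∧ j ≤ i + m then 0 else |cov[Z i, Z j; μ]|) := by
        refine Finset.sum_le_sum fun i _ => ?_
        rw [integral_finsetSum _ fun j _ => hi i j, ← Finset.sum_sub_distrib]
        refine (Finset.abs_sum_le_sum_abs _ _).trans (Finset.sum_le_sum fun j _ => ?_)
        split_ifs
        · rw [hcov, sub_self, abs_zero]
        · simp
    _ ≤ (Finset.range n).card * (2 * ∑' d, b d) := by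
        have hle : ∀ i d, (if i ≤ (i + d) + m ∧ i + d ≤ i + m then 0
            else |cov[Z i, Z (i + d); μ]|) ≤ b d := by
          intro i d
          simp only [hb]
          by_cases hd : d ≤ m
          · rw [if_pos hd, if_pos ⟨by omega, by omega⟩]
          · rw [if_neg hd, if_neg (by omega)]
            exact abs_covariance_le_alphaCoeff_sq hZ hC i d
        refine sum_sum_le_card_mul_tsum (fun d => ?_) hbs hle (fun i d => ?_) _
        · exact le_trans (by split_ifs <;> positivity) (hle 0 d)
        · rw [covariance_comm]
          refine le_trans (le_of_eq ?_) (hle i d)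
          exact if_congr and_comm rfl rfl
    _ = _ := by rw [hbt, Finset.card_range]

end Bounded

end TimeSeries

/-! ### Windows and almost Gaussian characteristic functions -/

namespace TimeSeries

open scoped Topology ENNReal

/-- Taylor's formula for `|u| ≤ 1` and the crude bound `2 + |u|` beyond. A quadratic bound for all
`u` avoids any truncation of the near sum. -/
theorem norm_one_sub_cexp_sub_le (u : ℝ) :
    ‖1 - Complex.exp (-(Complex.I * u)) - Complex.I * u‖ ≤ 3 * u ^ 2 := by
  have hn : ‖-(Complex.I * (u : ℂ))‖ = |u| := by simp
  have h1 : ‖1 - Complex.exp (-(Complex.I * u)) - Complex.I * u‖ =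
      ‖Complex.exp (-(Complex.I * u)) - 1 - -(Complex.I * u)‖ := by
    rw [← norm_neg]; congr 1; ring
  rcases le_or_gt |u| 1 with hu | hu
  · rw [h1]
    refine (Complex.norm_exp_sub_one_sub_id_le (by rwa [hn])).trans ?_
    rw [hn, sq_abs]
    nlinarith [sq_nonneg u]
  · have h2 : ‖Complex.exp (-(Complex.I * u))‖ = 1 := by
      rw [show -(Complex.I * (u : ℂ)) = Complex.I * ((-u : ℝ) : ℂ) by push_cast; ring]
      exact Complex.norm_exp_I_mul_ofReal _
    calc _ ≤ ‖(1 : ℂ)‖ + ‖Complex.exp (-(Complex.I * u))‖ + ‖Complex.I * (u : ℂ)‖ :=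
          (norm_sub_le _ _).trans (add_le_add_left (norm_sub_le _ _) _)
      _ = 2 + |u| := by rw [h2]; simp; norm_num
      _ ≤ 3 * u ^ 2 := by rw [← sq_abs]; nlinarith

section Windows

variable {Ω : Type*} {Z : ℕ → Ω → ℝ}

/-- The part of the sum of the first `n` variables that lies more than `m` before `j`. -/
noncomputable def pastSum (Z : ℕ → Ω → ℝ) (n m j : ℕ) (ω : Ω) : ℝ :=
  ∑ i ∈ (Finset.range n).filter (fun i => i + m < j), Z i ω

/-- The part of the sum of the first `n` variables that lies more than `m` after `j`. -/
noncomputable def futureSum (Z : ℕ → Ω → ℝ) (n m j : ℕ) (ω : Ω) : ℝ :=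
  ∑ i ∈ (Finset.range n).filter (fun i => j + m < i), Z i ω

/-- The part of the sum of the first `n` variables that lies at distance at most `m` of `j`. -/
noncomputable def nearSum (Z : ℕ → Ω → ℝ) (n m j : ℕ) (ω : Ω) : ℝ :=
  ∑ i ∈ (Finset.range n).filter (fun i => j ≤ i + m ∧ i ≤ j + m), Z i ω

theorem nearSum_add_pastSum_add_futureSum (n m j : ℕ) (ω : Ω) :
    nearSum Z n m j ω + (pastSum Z n m j ω + futureSum Z n m j ω) =
      ∑ i ∈ Finset.range n, Z i ω := by
  unfold nearSum pastSum futureSum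
  rw [Finset.sum_filter, Finset.sum_filter, Finset.sum_filter, ← Finset.sum_add_distrib,
    ← Finset.sum_add_distrib]
  refine Finset.sum_congr rfl fun i _ => ?_
  rcases lt_or_ge (i + m) j with h | h
  · rw [if_neg (by omega), if_pos h, if_neg (by omega)]; ring
  · rcases lt_or_ge (j + m) i with h' | h'
    · rw [if_neg (by omega), if_neg (by omega), if_pos h']; ring
    · rw [if_pos ⟨h, h'⟩, if_neg (by omega), if_neg (by omega)]; ring

theorem sum_mul_nearSum (n m : ℕ) (ω : Ω) :
    ∑ j ∈ Finset.range n, Z j ω * nearSum Z n m j ω = windowSum Z n m ω := by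
  unfold nearSum windowSum
  refine Finset.sum_congr rfl fun j _ => ?_
  rw [Finset.sum_filter, Finset.mul_sum]
  refine Finset.sum_congr rfl fun i _ => ?_
  rw [mul_ite, mul_zero]

theorem card_filter_near_le (n m j : ℕ) :
    ((Finset.range n).filter (fun i => j ≤ i + m ∧ i ≤ j + m)).card ≤ 2 * m + 1 := by
  calc _ ≤ (Finset.Icc (j - m) (j + m)).card := by
        refine Finset.card_le_card fun i hi => ?_
        have := (Finset.mem_filter.mp hi).2
        exact Finset.mem_Icc.mpr ⟨by omega, by omega⟩
    _ ≤ 2 * m + 1 := by rw [Nat.card_Icc]; omega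

end Windows

/-! ### The differential equation of the characteristic function and decoupling -/

section Stein

variable {Ω : Type*} [mΩ : MeasurableSpace Ω] {μ : Measure Ω} [IsProbabilityMeasure μ]

theorem norm_cexp_I_mul_mul (x y : ℝ) : ‖Complex.exp (Complex.I * (x * y))‖ = 1 := by
  rw [← Complex.ofReal_mul]; exact Complex.norm_exp_I_mul_ofReal _

theorem hasDerivAt_integral_cexp {T : Ω → ℝ} (hT : Measurable T) {B : ℝ} (hB : ∀ ω, |T ω| ≤ B)
    (x : ℝ) : HasDerivAt (fun y : ℝ => ∫ ω, Complex.exp (Complex.I * (y * T ω)) ∂μ)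
      (∫ ω, Complex.I * T ω * Complex.exp (Complex.I * (x * T ω)) ∂μ) x := by
  refine (hasDerivAt_integral_of_dominated_loc_of_deriv_le (s := Set.univ) (bound := fun _ => B)
    (F := fun (y : ℝ) ω => Complex.exp (Complex.I * (y * T ω)))
    (F' := fun (y : ℝ) ω => Complex.I * T ω * Complex.exp (Complex.I * (y * T ω)))
    Filter.univ_mem (Eventually.of_forall fun y => ?_) ?_ ?_
    (ae_of_all _ fun ω y _ => ?_) (integrable_const _) (ae_of_all _ fun ω y _ => ?_)).2
  · exact (by fun_prop : Measurable _).aestronglyMeasurable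
  · exact Integrable.of_bound (by fun_prop : Measurable _).aestronglyMeasurable 1
      (ae_of_all _ fun ω => (norm_cexp_I_mul_mul _ _).le)
  · exact (by fun_prop : Measurable _).aestronglyMeasurable
  · rw [norm_mul, norm_cexp_I_mul_mul]
    simpa using hB ω
  · have h1 : HasDerivAt (fun z : ℝ => Complex.I * ((z : ℂ) * T ω)) (Complex.I * (1 * T ω)) y :=
      ((Complex.ofRealCLM.hasDerivAt (x := y)).mul_const _).const_mul _
    have := h1.cexp
    simpa [mul_comm] using this

/-- A bounded variable whose characteristic function almost satisfies the differential equation of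
a Gaussian characteristic function is almost Gaussian. -/
theorem norm_integral_cexp_sub_exp_le {T : Ω → ℝ} (hT : Measurable T) {B : ℝ}
    (hB : ∀ ω, |T ω| ≤ B) {v t E : ℝ} (hv : 0 ≤ v)
    (hE : ∀ x : ℝ, |x| ≤ |t| →
      ‖∫ ω, Complex.I * T ω * Complex.exp (Complex.I * (x * T ω)) ∂μ +
        x * v * ∫ ω, Complex.exp (Complex.I * (x * T ω)) ∂μ‖ ≤ E) :
    ‖∫ ω, Complex.exp (Complex.I * (t * T ω)) ∂μ - Real.exp (-(t ^ 2 * v / 2))‖ ≤ |t| * E := by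
  set φ : ℝ → ℂ := fun y => ∫ ω, Complex.exp (Complex.I * (y * T ω)) ∂μ with hφ
  set φ' : ℝ → ℂ := fun x => ∫ ω, Complex.I * T ω * Complex.exp (Complex.I * (x * T ω)) ∂μ with hφ'
  have hE0 : 0 ≤ E := (norm_nonneg _).trans (hE 0 (by simp))
  -- The integrating factor: `ψ` would be constant if `φ` solved the Gaussian equation `φ' = -x v
  -- φ`. The mean value inequality on `[0, 1]` bounds `ψ 1 - ψ 0`, and dividing by `exp (t² v / 2)`
  -- cancels that factor in the bound.
  set ψ : ℝ → ℂ := fun u => φ (t * u) * Complex.exp (((t * u) ^ 2 * v / 2 : ℝ)) with hψ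
  have hd : ∀ u, HasDerivAt ψ (t * Complex.exp (((t * u) ^ 2 * v / 2 : ℝ)) *
      (φ' (t * u) + ((t * u : ℝ) : ℂ) * v * φ (t * u))) u := by
    intro u
    have hl : HasDerivAt (fun u : ℝ => t * u) t u := by simpa using (hasDerivAt_id u).const_mul t
    have h1 : HasDerivAt (fun u => φ (t * u)) (t • φ' (t * u)) u :=
      (hasDerivAt_integral_cexp hT hB (t * u)).scomp u hl
    have h2 : HasDerivAt (fun u : ℝ => (t * u) ^ 2 * v / 2) (t * (t * u) * v) u := by
      have := ((hl.pow 2).mul_const v).div_const 2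
      refine this.congr_deriv ?_
      push_cast; ring
    have h3 := h1.mul (h2.ofReal_comp.cexp)
    refine h3.congr_deriv ?_
    rw [Complex.real_smul]
    push_cast
    ring
  have hmv := norm_image_sub_le_of_norm_deriv_le_segment_01' (f := ψ)
    (C := |t| * Real.exp (t ^ 2 * v / 2) * E) (fun u _ => (hd u).hasDerivWithinAt) fun u hu => by
      have hu1 : |t * u| ≤ |t| := by
        rw [abs_mul, abs_of_nonneg hu.1]
        exact mul_le_of_le_one_right (abs_nonneg _) hu.2.le
      rw [norm_mul, norm_mul, Complex.norm_real, Real.norm_eq_abs, ← Complex.ofReal_exp,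
        Complex.norm_real, Real.norm_eq_abs, Real.abs_exp]
      have := hE (t * u) hu1
      have h3 : Real.exp ((t * u) ^ 2 * v / 2) ≤ Real.exp (t ^ 2 * v / 2) :=
        Real.exp_le_exp.mpr (by gcongr ?_ * v / 2; exact sq_le_sq.mpr hu1)
      exact mul_le_mul (mul_le_mul_of_nonneg_left h3 (abs_nonneg _)) this (norm_nonneg _)
        (by positivity)
  have h0 : ψ 0 = 1 := by simp [hψ, hφ]
  have h1 : ψ 1 = φ t * (Real.exp (t ^ 2 * v / 2) : ℂ) := by simp [hψ]
  rw [h0, h1] at hmv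
  have h2 : φ t - Real.exp (-(t ^ 2 * v / 2)) =
      (φ t * (Real.exp (t ^ 2 * v / 2) : ℂ) - 1) * (Real.exp (-(t ^ 2 * v / 2)) : ℂ) := by
    rw [sub_mul, mul_assoc, ← Complex.ofReal_mul, ← Real.exp_add]
    simp
  rw [h2, norm_mul, Complex.norm_real, Real.norm_eq_abs, Real.abs_exp]
  calc _ ≤ |t| * Real.exp (t ^ 2 * v / 2) * E * Real.exp (-(t ^ 2 * v / 2)) := by gcongr
    _ = |t| * E * (Real.exp (t ^ 2 * v / 2) * Real.exp (-(t ^ 2 * v / 2))) := by ring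
    _ = |t| * E := by rw [← Real.exp_add]; simp

variable {Z : ℕ → Ω → ℝ} {C : ℝ}

/-- The variable `f` is decoupled from `Z_j p` at a cost of `4 C α(m)`. The product of expectations
that remains contains `E[Z_j p]`, which is small by `hpZ`. -/
theorem abs_integral_mul_mul_le (hZ : ∀ i, Measurable (Z i)) (hC : ∀ i ω, |Z i ω| ≤ C) {j m : ℕ}
    {p f : Ω → ℝ} (hp : Measurable[past Z j] p) (hp1 : ∀ ω, |p ω| ≤ 1)
    (hf : Measurable[future Z (j + m)] f) (hf1 : ∀ ω, |f ω| ≤ 1)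
    (hpZ : |∫ ω, Z j ω * p ω ∂μ| ≤ 4 * C * alphaCoeff μ Z m) :
    |∫ ω, Z j ω * (p ω * f ω) ∂μ| ≤ 8 * C * alphaCoeff μ Z m := by
  have hb : ∀ ω, |Z j ω * p ω| ≤ C * 1 := fun ω => abs_mul_le_mul (hC j ω) (hp1 ω)
  have hm : Measurable[past Z j] fun ω => Z j ω * p ω := (measurable_past le_rfl).mul hp
  have h1 := abs_covariance_le_alphaCoeff (μ := μ) hZ (le_refl (j + m)) hm hb hf hf1
  rw [covariance_eq_sub (memLp_of_abs_le (hm.mono (past_le hZ _) le_rfl) hb)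
    (memLp_of_abs_le (hf.mono (future_le hZ _) le_rfl) hf1)] at h1
  have h2 := abs_mul_le_mul hpZ (abs_integral_le_of_abs_le (μ := μ) hf1)
  simp only [Pi.mul_apply, mul_assoc] at h1
  rw [abs_le] at h1 h2 ⊢
  constructor <;> linarith [h1.1, h1.2, h2.1, h2.2]

theorem abs_integral_mul_pastSum_le (hZ : ∀ i, Measurable (Z i)) (hC : ∀ i ω, |Z i ω| ≤ C)
    (h0 : ∀ i, ∫ ω, Z i ω ∂μ = 0) {q : ℝ → ℝ} (hq : Measurable q) (hq1 : ∀ x, |q x| ≤ 1)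
    (n m j : ℕ) :
    |∫ ω, Z j ω * q (pastSum Z n m j ω) ∂μ| ≤ 4 * C * alphaCoeff μ Z (m + 1) := by
  have hC0 : 0 ≤ C := by
    obtain ⟨ω⟩ := nonempty_of_isProbabilityMeasure μ
    exact (abs_nonneg _).trans (hC 0 ω)
  -- Near the start the past sum is empty and the integral is a multiple of `E Z_j = 0`. The case is
  -- separate because `j - (m + 1)` would be a truncated subtraction.
  rcases Nat.lt_or_ge j (m + 1) with hj | hj
  · have : ∀ ω, pastSum Z n m j ω = 0 := by
      intro ω
      unfold pastSum
      rw [Finset.filter_false_of_mem fun i _ => by omega, Finset.sum_empty]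
    simp only [this]
    rw [integral_mul_const, h0, zero_mul, abs_zero]
    have := alphaCoeff_nonneg (μ := μ) (X := Z) (m + 1)
    positivity
  · have hm : Measurable[past Z (j - (m + 1))] (pastSum Z n m j) := by
      refine Finset.measurable_fun_sum _ fun i hi => measurable_past ?_
      have := (Finset.mem_filter.mp hi).2
      omega
    have h1 := abs_covariance_le_alphaCoeff (μ := μ) hZ
      (show j - (m + 1) + (m + 1) ≤ j by omega) (hq.comp hm) (fun ω => hq1 _)
      (measurable_future (le_refl j)) (hC j)
    rw [covariance_comm, covariance_eq_integral_mul (memLp_of_abs_le (hZ j) (hC j))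
      (memLp_of_abs_le (hq.comp (hm.mono (past_le hZ _) le_rfl)) fun ω => hq1 _) (h0 j)] at h1
    refine h1.trans (le_of_eq (by ring))

theorem abs_integral_mul_pastSum_mul_futureSum_le (hZ : ∀ i, Measurable (Z i))
    (hC : ∀ i ω, |Z i ω| ≤ C) (h0 : ∀ i, ∫ ω, Z i ω ∂μ = 0) {q₁ q₂ : ℝ → ℝ}
    (hq₁ : Measurable q₁) (hq₁1 : ∀ x, |q₁ x| ≤ 1) (hq₂ : Measurable q₂) (hq₂1 : ∀ x, |q₂ x| ≤ 1)
    (n m j : ℕ) :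
    |∫ ω, Z j ω * (q₁ (pastSum Z n m j ω) * q₂ (futureSum Z n m j ω)) ∂μ| ≤
      8 * C * alphaCoeff μ Z (m + 1) := by
  refine abs_integral_mul_mul_le hZ hC (hq₁.comp ?_) (fun ω => hq₁1 _) (hq₂.comp ?_)
    (fun ω => hq₂1 _) (abs_integral_mul_pastSum_le hZ hC h0 hq₁ hq₁1 n m j)
  · refine Finset.measurable_fun_sum _ fun i hi => measurable_past ?_
    have := (Finset.mem_filter.mp hi).2
    omega
  · refine Finset.measurable_fun_sum _ fun i hi => measurable_future ?_
    have := (Finset.mem_filter.mp hi).2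
    omega

theorem measurable_pastSum (hZ : ∀ i, Measurable (Z i)) (n m j : ℕ) :
    Measurable (pastSum Z n m j) := Finset.measurable_fun_sum _ fun i _ => hZ i

theorem measurable_futureSum (hZ : ∀ i, Measurable (Z i)) (n m j : ℕ) :
    Measurable (futureSum Z n m j) := Finset.measurable_fun_sum _ fun i _ => hZ i

theorem measurable_nearSum (hZ : ∀ i, Measurable (Z i)) (n m j : ℕ) :
    Measurable (nearSum Z n m j) := Finset.measurable_fun_sum _ fun i _ => hZ i

/-- The addition formulas write the exponential of the sum as four real products of a function of
the past and a function of the future. Each contributes `8 C α(m+1)`. -/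
theorem norm_integral_mul_cexp_le (hZ : ∀ i, Measurable (Z i))
    (hC : ∀ i ω, |Z i ω| ≤ C) (h0 : ∀ i, ∫ ω, Z i ω ∂μ = 0) (c : ℝ) (n m j : ℕ) :
    ‖∫ ω, (Z j ω : ℂ) * Complex.exp (Complex.I *
      (c * (pastSum Z n m j ω + futureSum Z n m j ω) : ℝ)) ∂μ‖ ≤
      32 * C * alphaCoeff μ Z (m + 1) := by
  set P := pastSum Z n m j with hP
  set F := futureSum Z n m j with hF
  have hPm : Measurable P := measurable_pastSum hZ n m j
  have hFm : Measurable F := measurable_futureSum hZ n m j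
  have hc : Measurable fun x => Real.cos (c * x) := by fun_prop
  have hs : Measurable fun x => Real.sin (c * x) := by fun_prop
  have hc1 : ∀ x, |Real.cos (c * x)| ≤ 1 := fun x => Real.abs_cos_le_one _
  have hs1 : ∀ x, |Real.sin (c * x)| ≤ 1 := fun x => Real.abs_sin_le_one _
  have hi : ∀ {q₁ q₂ : ℝ → ℝ}, Measurable q₁ → (∀ x, |q₁ x| ≤ 1) → Measurable q₂ →
      (∀ x, |q₂ x| ≤ 1) → Integrable (fun ω => Z j ω * (q₁ (P ω) * q₂ (F ω))) μ := by
    intro q₁ q₂ h1 h2 h3 h4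
    refine (memLp_of_abs_le (p := 1) (C := C * (1 * 1)) ?_ fun ω => ?_).integrable le_rfl
    · exact (hZ j).mul ((h1.comp hPm).mul (h3.comp hFm))
    · exact abs_mul_le_mul (hC j ω) (abs_mul_le_mul (h2 _) (h4 _))
  have e : ∀ ω, (Z j ω : ℂ) * Complex.exp (Complex.I * (c * (P ω + F ω) : ℝ)) =
      ((Z j ω * (Real.cos (c * P ω) * Real.cos (c * F ω)) -
        Z j ω * (Real.sin (c * P ω) * Real.sin (c * F ω)) : ℝ) : ℂ) +
      Complex.I * ((Z j ω * (Real.sin (c * P ω) * Real.cos (c * F ω)) +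
        Z j ω * (Real.cos (c * P ω) * Real.sin (c * F ω)) : ℝ) : ℂ) := by
    intro ω
    rw [mul_comm Complex.I, Complex.exp_mul_I, ← Complex.ofReal_cos, ← Complex.ofReal_sin, mul_add c,
      Real.cos_add, Real.sin_add]
    push_cast
    ring
  have i1 := hi hc hc1 hc hc1
  have i2 := hi hs hs1 hs hs1
  have i3 := hi hs hs1 hc hc1
  have i4 := hi hc hc1 hs hs1
  simp only [e]
  rw [integral_add (i1.sub i2).ofReal ((i3.add i4).ofReal.const_mul _), integral_const_mul,
    integral_complex_ofReal, integral_complex_ofReal, integral_sub i1 i2, integral_add i3 i4]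
  have b1 := abs_integral_mul_pastSum_mul_futureSum_le (μ := μ) hZ hC h0 hc hc1 hc hc1 n m j
  have b2 := abs_integral_mul_pastSum_mul_futureSum_le (μ := μ) hZ hC h0 hs hs1 hs hs1 n m j
  have b3 := abs_integral_mul_pastSum_mul_futureSum_le (μ := μ) hZ hC h0 hs hs1 hc hc1 n m j
  have b4 := abs_integral_mul_pastSum_mul_futureSum_le (μ := μ) hZ hC h0 hc hc1 hs hs1 n m j
  refine (norm_add_le _ _).trans ?_
  rw [norm_mul, Complex.norm_I, one_mul, Complex.norm_real, Complex.norm_real]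
  refine (add_le_add (abs_sub _ _) (abs_add_le _ _)).trans ?_
  linarith

end Stein

end TimeSeries

/-! ### The error in the differential equation of the characteristic function -/

namespace TimeSeries

open scoped Topology ENNReal

/-- With `u_j = x · near_j/√n`, removing the near sum multiplies `e = exp(ixT)` by `exp(-i u_j)`.
Hence `e` splits into `e (1 - exp(-i u_j) - i u_j)`, the linear term `i u_j e`, and an exponential
of past and future alone. Multiplied by `i Z_j/√n` and summed over `j`, the linear terms become `-x
e` times the window sum over `n`, which is compared with `x v e`. -/
theorem stein_identity {Ω : Type*} (Z : ℕ → Ω → ℝ) {n : ℕ} (hn : 0 < n) (m : ℕ) (x v : ℝ) (ω : Ω) :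
    Complex.I * ((∑ i ∈ Finset.range n, Z i ω) / √n : ℝ) *
        Complex.exp (Complex.I * (x * ((∑ i ∈ Finset.range n, Z i ω) / √n : ℝ))) +
      x * v * Complex.exp (Complex.I * (x * ((∑ i ∈ Finset.range n, Z i ω) / √n : ℝ))) =
    ∑ j ∈ Finset.range n, Complex.I * (Z j ω / √n : ℝ) *
        Complex.exp (Complex.I * (x * ((∑ i ∈ Finset.range n, Z i ω) / √n : ℝ))) *
        (1 - Complex.exp (-(Complex.I * (x * (nearSum Z n m j ω / √n) : ℝ))) -
          Complex.I * (x * (nearSum Z n m j ω / √n) : ℝ)) +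
      x * (Complex.exp (Complex.I * (x * ((∑ i ∈ Finset.range n, Z i ω) / √n : ℝ))) *
        (v - windowSum Z n m ω / n : ℝ)) +
      ∑ j ∈ Finset.range n, Complex.I / √n * (Z j ω * Complex.exp (Complex.I *
        (x / √n * (pastSum Z n m j ω + futureSum Z n m j ω) : ℝ))) := by
  have hn' : (0 : ℝ) < n := by exact_mod_cast hn
  have hs : ((√(n : ℝ) : ℝ) : ℂ) ≠ 0 := by exact_mod_cast (Real.sqrt_pos.mpr hn').ne'
  have hs2 : ((√(n : ℝ) : ℝ) : ℂ) * (√(n : ℝ) : ℝ) = n := by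
    rw [← Complex.ofReal_mul, Real.mul_self_sqrt hn'.le]; simp
  set e := Complex.exp (Complex.I * (x * ((∑ i ∈ Finset.range n, Z i ω) / √n : ℝ))) with he
  have h1 : ∀ j ∈ Finset.range n, Complex.I * (Z j ω / √n : ℝ) * e *
        (1 - Complex.exp (-(Complex.I * (x * (nearSum Z n m j ω / √n) : ℝ))) -
          Complex.I * (x * (nearSum Z n m j ω / √n) : ℝ)) +
      Complex.I / √n * (Z j ω * Complex.exp (Complex.I *
        (x / √n * (pastSum Z n m j ω + futureSum Z n m j ω) : ℝ))) =
      Complex.I / √n * e * (Z j ω : ℝ) + x * e / n * (Z j ω * nearSum Z n m j ω : ℝ) := by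
    intro j _
    have h2 : Complex.exp (Complex.I *
        (x / √n * (pastSum Z n m j ω + futureSum Z n m j ω) : ℝ)) =
        e * Complex.exp (-(Complex.I * (x * (nearSum Z n m j ω / √n) : ℝ))) := by
      rw [he, ← Complex.exp_add, ← nearSum_add_pastSum_add_futureSum n m j ω]
      congr 1
      push_cast
      ring
    rw [h2, ← hs2]
    push_cast
    field_simp
    linear_combination (-(x : ℂ)) * Z j ω * nearSum Z n m j ω * e * Complex.I_sq
  rw [add_right_comm, ← Finset.sum_add_distrib, Finset.sum_congr rfl h1, Finset.sum_add_distrib,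
    ← Finset.mul_sum, ← Finset.mul_sum, ← Complex.ofReal_sum, ← Complex.ofReal_sum,
    sum_mul_nearSum]
  push_cast
  ring

section SteinBound

variable {Ω : Type*} [mΩ : MeasurableSpace Ω] {μ : Measure Ω} [IsProbabilityMeasure μ]
  {Z : ℕ → Ω → ℝ} {C : ℝ}

theorem integral_abs_le_sqrt {f : Ω → ℝ} (hf : MemLp f 2 μ) :
    ∫ ω, |f ω| ∂μ ≤ √(∫ ω, f ω ^ 2 ∂μ) := by
  refine Real.le_sqrt_of_sq_le ?_
  have h := variance_eq_sub (μ := μ) (X := fun ω => |f ω|) hf.abs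
  have h1 := variance_nonneg (fun ω => |f ω|) μ
  simp only [Pi.pow_apply, sq_abs] at h
  linarith

theorem integral_nearSum_sq_le (hZ : ∀ i, Measurable (Z i)) (hC : ∀ i ω, |Z i ω| ≤ C)
    (h0 : ∀ i, ∫ ω, Z i ω ∂μ = 0) (hα : Summable (alphaCoeff μ Z)) (n m j : ℕ) :
    ∫ ω, nearSum Z n m j ω ^ 2 ∂μ ≤
      (2 * m + 1) * (2 * ∑' d, 4 * C ^ 2 * alphaCoeff μ Z d) := by
  have h1 : ∫ ω, nearSum Z n m j ω ∂μ = 0 := by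
    unfold nearSum
    rw [integral_finsetSum _ fun i _ =>
      (memLp_of_abs_le (p := 1) (hZ i) (hC i)).integrable le_rfl]
    simp [h0]
  rw [← variance_of_integral_eq_zero (measurable_nearSum hZ n m j).aemeasurable h1]
  refine (variance_sum_le_of_bounded hZ hC hα _).trans ?_
  have h2 : 0 ≤ ∑' d, 4 * C ^ 2 * alphaCoeff μ Z d := tsum_nonneg fun d =>
    mul_nonneg (by positivity) (alphaCoeff_nonneg d)
  gcongr
  exact_mod_cast card_filter_near_le n m j

/-- Fluctuation plus bias: the `L¹` distance to the mean is at most the standard deviation, and the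
mean differs from the variance by the tail. -/
theorem integral_abs_windowSum_div_sub_le (hZ : ∀ i, Measurable (Z i)) (hC : ∀ i ω, |Z i ω| ≤ C)
    (h0 : ∀ i, ∫ ω, Z i ω ∂μ = 0) (hα : Summable (alphaCoeff μ Z)) {n : ℕ} (hn : 0 < n) (m : ℕ) :
    ∫ ω, |Var[fun ω => ∑ i ∈ Finset.range n, Z i ω; μ] / n - windowSum Z n m ω / n| ∂μ ≤
      2 * (m + 1) * √(32 * C ^ 4 * ∑' e, alphaCoeff μ Z e) / √n +
        2 * ∑' d, 4 * C ^ 2 * alphaCoeff μ Z (d + (m + 1)) := by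
  have hn' : (0 : ℝ) < n := by exact_mod_cast hn
  set V := Var[fun ω => ∑ i ∈ Finset.range n, Z i ω; μ]
  set M := ∫ ω, windowSum Z n m ω ∂μ
  set K := 32 * C ^ 4 * ∑' e, alphaCoeff μ Z e
  have hw : MemLp (windowSum Z n m) 2 μ :=
    memLp_of_abs_le (measurable_windowSum hZ n m) (abs_windowSum_le hC n m)
  have hwc : MemLp (fun ω => windowSum Z n m ω - M) 2 μ := hw.sub (memLp_const _)
  have hi : Integrable (fun ω => |windowSum Z n m ω - M|) μ :=
    (hwc.integrable (by norm_num)).abs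
  have h1 := integral_abs_le_sqrt hwc
  rw [← variance_eq_integral hw.aemeasurable] at h1
  have h2 := h1.trans (Real.sqrt_le_sqrt (variance_windowSum_le hZ hC h0 hα n m))
  have h3 : √(4 * ((m : ℝ) + 1) ^ 2 * (n * K)) = 2 * (m + 1) * (√n * √K) := by
    rw [show 4 * ((m : ℝ) + 1) ^ 2 = (2 * (m + 1)) ^ 2 by ring, Real.sqrt_mul (by positivity),
      Real.sqrt_sq (by positivity), Real.sqrt_mul hn'.le]
  rw [h3] at h2
  have h4 := abs_integral_windowSum_sub_le (μ := μ) hZ hC h0 hα n m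
  calc ∫ ω, |V / n - windowSum Z n m ω / n| ∂μ
      ≤ ∫ ω, (|windowSum Z n m ω - M| / n + |M - V| / n) ∂μ := by
        refine integral_mono_of_nonneg (ae_of_all _ fun ω => abs_nonneg _)
          ((hi.div_const _).add (integrable_const _)) (ae_of_all _ fun ω => ?_)
        simp only
        rw [← sub_div, abs_div, abs_of_pos hn', ← add_div, abs_sub_comm V]
        gcongr
        exact abs_sub_le _ _ _
    _ = (∫ ω, |windowSum Z n m ω - M| ∂μ) / n + |M - V| / n := by
        rw [integral_add (hi.div_const _) (integrable_const _), integral_div]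
        simp
    _ ≤ (2 * (m + 1) * (√n * √K)) / n +
        (n * (2 * ∑' d, 4 * C ^ 2 * alphaCoeff μ Z (d + (m + 1)))) / n := by gcongr
    _ = _ := by
        rw [mul_div_cancel_left₀ _ hn'.ne']
        congr 1
        have : √(n : ℝ) ≠ 0 := (Real.sqrt_pos.mpr hn').ne'
        rw [div_eq_div_iff hn'.ne' this]
        nth_rewrite 3 [← Real.mul_self_sqrt hn'.le]
        ring

theorem norm_integral_stein_le (hZ : ∀ i, Measurable (Z i)) (hC : ∀ i ω, |Z i ω| ≤ C)
    (h0 : ∀ i, ∫ ω, Z i ω ∂μ = 0) (hα : Summable (alphaCoeff μ Z)) {n : ℕ} (hn : 0 < n) (m : ℕ)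
    (x : ℝ) :
    ‖∫ ω, Complex.I * ((∑ i ∈ Finset.range n, Z i ω) / √n : ℝ) *
        Complex.exp (Complex.I * (x * ((∑ i ∈ Finset.range n, Z i ω) / √n : ℝ))) ∂μ +
      x * (Var[fun ω => ∑ i ∈ Finset.range n, Z i ω; μ] / n : ℝ) *
        ∫ ω, Complex.exp (Complex.I * (x * ((∑ i ∈ Finset.range n, Z i ω) / √n : ℝ))) ∂μ‖ ≤
    3 * C * x ^ 2 * (2 * ∑' d, 4 * C ^ 2 * alphaCoeff μ Z d) * ((2 * m + 1) / √n) +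
      |x| * (2 * (m + 1) * √(32 * C ^ 4 * ∑' e, alphaCoeff μ Z e) / √n +
        2 * ∑' d, 4 * C ^ 2 * alphaCoeff μ Z (d + (m + 1))) +
      32 * C * (√n * alphaCoeff μ Z (m + 1)) := by
  have hn' : (0 : ℝ) < n := by exact_mod_cast hn
  have hs : 0 < √(n : ℝ) := Real.sqrt_pos.mpr hn'
  have hC0 : 0 ≤ C := by
    obtain ⟨ω⟩ := nonempty_of_isProbabilityMeasure μ
    exact (abs_nonneg _).trans (hC 0 ω)
  set v : ℝ := Var[fun ω => ∑ i ∈ Finset.range n, Z i ω; μ] / n with hv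
  set T : Ω → ℝ := fun ω => (∑ i ∈ Finset.range n, Z i ω) / √n with hT
  have hTm : Measurable T := (Finset.measurable_fun_sum _ fun i _ => hZ i).div_const _
  set e : Ω → ℂ := fun ω => Complex.exp (Complex.I * (x * (T ω : ℝ))) with he
  have hem : Measurable e := by fun_prop
  have he1 : ∀ ω, ‖e ω‖ = 1 := fun ω => norm_cexp_I_mul_mul _ _
  have hnm := measurable_nearSum hZ n m
  have hnear2 : ∀ j, MemLp (nearSum Z n m j) 2 μ := fun j =>
    memLp_finsetSum _ fun i _ => memLp_of_abs_le (hZ i) (hC i)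
  set A : ℕ → Ω → ℂ := fun j ω => Complex.I * (Z j ω / √n : ℝ) * e ω *
    (1 - Complex.exp (-(Complex.I * (x * (nearSum Z n m j ω / √n) : ℝ))) -
      Complex.I * (x * (nearSum Z n m j ω / √n) : ℝ)) with hA
  set Q : Ω → ℂ := fun ω => e ω * (v - windowSum Z n m ω / n : ℝ) with hQ
  set D : ℕ → Ω → ℂ := fun j ω => Z j ω * Complex.exp (Complex.I *
    (x / √n * (pastSum Z n m j ω + futureSum Z n m j ω) : ℝ)) with hD
  have hAb : ∀ j ω, ‖A j ω‖ ≤ 3 * C * x ^ 2 / √n / n * nearSum Z n m j ω ^ 2 := by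
    intro j ω
    simp only [hA]
    rw [norm_mul, norm_mul, norm_mul, he1, Complex.norm_I, Complex.norm_real, Real.norm_eq_abs,
      abs_div, abs_of_pos hs, one_mul, mul_one]
    calc _ ≤ C / √n * (3 * (x * (nearSum Z n m j ω / √n)) ^ 2) := by
          gcongr
          · exact hC j ω
          · exact norm_one_sub_cexp_sub_le _
      _ = _ := by
          rw [mul_pow, div_pow, Real.sq_sqrt hn'.le]; ring
  have hAm : ∀ j, Measurable (A j) := by
    intro j
    have := hZ j
    have := hnm j
    fun_prop
  have hAi : ∀ j, Integrable (A j) μ := fun j =>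
    ((hnear2 j).integrable_sq.const_mul _).mono' (hAm j).aestronglyMeasurable
      (ae_of_all _ (hAb j))
  have hwi : Integrable (fun ω => v - windowSum Z n m ω / n) μ :=
    (integrable_const _).sub (((memLp_of_abs_le (p := 1) (measurable_windowSum hZ n m)
      (abs_windowSum_le hC n m)).integrable le_rfl).div_const _)
  have hQi : Integrable Q μ :=
    hwi.ofReal.bdd_mul hem.aestronglyMeasurable (ae_of_all _ fun ω => (he1 ω).le)
  have hDi : ∀ j, Integrable (D j) μ := by
    intro j
    have h1 := hZ j
    have h2 := measurable_pastSum hZ n m j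
    have h3 := measurable_futureSum hZ n m j
    refine Integrable.of_bound (by fun_prop : Measurable (D j)).aestronglyMeasurable C
      (ae_of_all _ fun ω => ?_)
    simp only [hD]
    rw [norm_mul, Complex.norm_exp_I_mul_ofReal, mul_one, Complex.norm_real]
    exact hC j ω
  have hei : Integrable e μ :=
    Integrable.of_bound hem.aestronglyMeasurable 1 (ae_of_all _ fun ω => (he1 ω).le)
  have hTi : Integrable (fun ω => Complex.I * (T ω : ℝ) * e ω) μ := by
    have : MemLp T 1 μ := by
      have h1 : MemLp (fun ω => ∑ i ∈ Finset.range n, Z i ω) 1 μ :=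
        memLp_finsetSum _ fun i _ => memLp_of_abs_le (hZ i) (hC i)
      simpa [hT, div_eq_mul_inv] using h1.mul_const (√n)⁻¹
    have h2 := ((this.integrable le_rfl).ofReal (𝕜 := ℂ)).const_mul Complex.I
    exact h2.mul_bdd hem.aestronglyMeasurable (ae_of_all _ fun ω => (he1 ω).le)
  have key : ∫ ω, Complex.I * (T ω : ℝ) * e ω ∂μ + x * v * ∫ ω, e ω ∂μ =
      ∑ j ∈ Finset.range n, ∫ ω, A j ω ∂μ + x * ∫ ω, Q ω ∂μ +
        ∑ j ∈ Finset.range n, Complex.I / √n * ∫ ω, D j ω ∂μ := by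
    have hAQ : Integrable (fun ω => ∑ j ∈ Finset.range n, A j ω + x * Q ω) μ :=
      (integrable_finsetSum _ fun j _ => hAi j).add (hQi.const_mul _)
    rw [← integral_const_mul, ← integral_add hTi (hei.const_mul _)]
    simp only [← integral_const_mul]
    rw [← integral_finsetSum _ fun j _ => hAi j,
      ← integral_finsetSum _ fun j _ => (hDi j).const_mul _,
      ← integral_add (integrable_finsetSum _ fun j _ => hAi j) (hQi.const_mul _),
      ← integral_add hAQ (integrable_finsetSum _ fun j _ => (hDi j).const_mul _)]
    exact integral_congr_ae (ae_of_all _ fun ω => stein_identity Z hn m x v ω)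
  rw [key]
  refine (norm_add₃_le).trans (add_le_add (add_le_add ?_ ?_) ?_)
  · refine (norm_sum_le _ _).trans ?_
    have h1 : ∀ j ∈ Finset.range n, ‖∫ ω, A j ω ∂μ‖ ≤ 3 * C * x ^ 2 / √n / n *
        ((2 * m + 1) * (2 * ∑' d, 4 * C ^ 2 * alphaCoeff μ Z d)) := by
      intro j _
      refine (norm_integral_le_of_norm_le ((hnear2 j).integrable_sq.const_mul _)
        (ae_of_all _ (hAb j))).trans ?_
      rw [integral_const_mul]
      exact mul_le_mul_of_nonneg_left (integral_nearSum_sq_le hZ hC h0 hα n m j) (by positivity)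
    refine (Finset.sum_le_card_nsmul _ _ _ h1).trans (le_of_eq ?_)
    rw [Finset.card_range, nsmul_eq_mul]
    field_simp
  · rw [norm_mul, Complex.norm_real, Real.norm_eq_abs]
    refine mul_le_mul_of_nonneg_left ?_ (abs_nonneg _)
    refine le_trans ?_ (integral_abs_windowSum_div_sub_le hZ hC h0 hα hn m)
    refine (norm_integral_le_integral_norm _).trans (le_of_eq ?_)
    refine integral_congr_ae (ae_of_all _ fun ω => ?_)
    simp only [hQ]
    rw [norm_mul, he1, one_mul, Complex.norm_real, Real.norm_eq_abs]
  · refine (norm_sum_le _ _).trans ?_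
    have h1 : ∀ j ∈ Finset.range n, ‖Complex.I / √n * ∫ ω, D j ω ∂μ‖ ≤
        1 / √n * (32 * C * alphaCoeff μ Z (m + 1)) := by
      intro j _
      rw [norm_mul, norm_div, Complex.norm_I, Complex.norm_real, Real.norm_eq_abs, abs_of_pos hs]
      exact mul_le_mul_of_nonneg_left (norm_integral_mul_cexp_le hZ hC h0 (x / √n) n m j)
        (by positivity)
    refine (Finset.sum_le_card_nsmul _ _ _ h1).trans (le_of_eq ?_)
    rw [Finset.card_range, nsmul_eq_mul]
    nth_rewrite 1 [← Real.mul_self_sqrt hn'.le]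
    field_simp

end SteinBound

end TimeSeries

/-! ### The central limit theorem for bounded strongly mixing sequences -/

namespace TimeSeries

open scoped Topology ENNReal

/-- At least half of the first `n` indices are at least `n/2`, and there the terms are at least `a
n`. So `n a_n` is at most twice a tail of the series. -/
theorem tendsto_nat_mul_of_antitone {a : ℕ → ℝ} (ha : Antitone a) (h0 : ∀ n, 0 ≤ a n)
    (hs : Summable a) : Tendsto (fun n : ℕ => (n : ℝ) * a n) atTop (𝓝 0) := by
  have h1 : ∀ n : ℕ, (n : ℝ) * a n ≤ 2 * ∑' k, a (k + n / 2) := by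
    intro n
    have h2 : ((n - n / 2 : ℕ) : ℝ) * a n ≤ ∑' k, a (k + n / 2) := by
      have h3 : ∑ _k ∈ Finset.range (n - n / 2), a n ≤
          ∑ k ∈ Finset.range (n - n / 2), a (k + n / 2) :=
        Finset.sum_le_sum fun k hk => ha (by have := Finset.mem_range.mp hk; omega)
      rw [Finset.sum_const, Finset.card_range, nsmul_eq_mul] at h3
      exact h3.trans (((summable_nat_add_iff _).mpr hs).sum_le_tsum _ fun k _ => h0 _)
    have h4 : (n : ℝ) ≤ 2 * ((n - n / 2 : ℕ) : ℝ) := by exact_mod_cast (by omega)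
    nlinarith [h0 n]
  have h2 : Tendsto (fun n : ℕ => 2 * ∑' k, a (k + n / 2)) atTop (𝓝 (2 * 0)) :=
    ((tendsto_sum_nat_add a).comp (Nat.tendsto_div_const_atTop (by norm_num))).const_mul 2
  rw [mul_zero] at h2
  exact squeeze_zero (fun n => mul_nonneg (by positivity) (h0 n)) h1 h2

theorem tendsto_zero_of_eventually_norm_le {E : Type*} [SeminormedAddCommGroup E] {f : ℕ → E}
    (g : ℕ → ℕ → ℝ) (L : ℕ → ℝ) (h : ∀ M, ∀ᶠ n in atTop, ‖f n‖ ≤ g M n)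
    (hg : ∀ M, Tendsto (g M) atTop (𝓝 (L M))) (hL : Tendsto L atTop (𝓝 0)) :
    Tendsto f atTop (𝓝 0) := by
  rw [tendsto_zero_iff_norm_tendsto_zero, Metric.tendsto_nhds]
  intro ε hε
  obtain ⟨M, hM⟩ := (hL.eventually_lt_const hε).exists
  filter_upwards [h M, (hg M).eventually_lt_const hM] with n h1 h2
  simpa using h1.trans_lt h2

section BoundedLimit

variable {Ω : Type*} [mΩ : MeasurableSpace Ω] {μ : Measure Ω} [IsProbabilityMeasure μ]
  {Z : ℕ → Ω → ℝ} {C : ℝ}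

/-- The central limit theorem for bounded strongly mixing sequences. -/
theorem tendsto_integral_cexp_sub_of_bounded (hZ : ∀ i, Measurable (Z i))
    (hC : ∀ i ω, |Z i ω| ≤ C) (h0 : ∀ i, ∫ ω, Z i ω ∂μ = 0) (hα : Summable (alphaCoeff μ Z))
    (t : ℝ) :
    Tendsto (fun n : ℕ =>
      ∫ ω, Complex.exp (Complex.I * (t * ((∑ i ∈ Finset.range n, Z i ω) / √n : ℝ))) ∂μ -
        Real.exp (-(t ^ 2 * (Var[fun ω => ∑ i ∈ Finset.range n, Z i ω; μ] / n) / 2)))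
      atTop (𝓝 0) := by
  have hC0 : 0 ≤ C := by
    obtain ⟨ω⟩ := nonempty_of_isProbabilityMeasure μ
    exact (abs_nonneg _).trans (hC 0 ω)
  have hα0 := alphaCoeff_nonneg (μ := μ) (X := Z)
  set K₁ := 2 * ∑' d, 4 * C ^ 2 * alphaCoeff μ Z d with hK₁
  have hK₁0 : 0 ≤ K₁ := mul_nonneg (by norm_num) (tsum_nonneg fun d =>
    mul_nonneg (by positivity) (hα0 d))
  set K₂ := √(32 * C ^ 4 * ∑' e, alphaCoeff μ Z e) with hK₂
  -- The window is about `ε√n` with `ε = 1/(M + 1)`. Then `m/√n → ε`, while `√n α(m+1) ≤ (M + 1)(m +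
  -- 1) α(m + 1) → 0` for fixed `M`. Sending `M → ∞` last removes the terms in `ε`.
  set m : ℕ → ℕ → ℕ := fun M n => ⌈1 / ((M : ℝ) + 1) * √n⌉₊ with hm
  set tail : ℕ → ℝ := fun m => 2 * ∑' d, 4 * C ^ 2 * alphaCoeff μ Z (d + (m + 1)) with htail
  have hsq : Tendsto (fun n : ℕ => √(n : ℝ)) atTop atTop :=
    Real.tendsto_sqrt_atTop.comp tendsto_natCast_atTop_atTop
  have hm_top : ∀ M, Tendsto (m M) atTop atTop := fun M =>
    tendsto_nat_ceil_atTop.comp (hsq.const_mul_atTop (by positivity))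
  have hm_div : ∀ M, Tendsto (fun n => (m M n : ℝ) / √n) atTop (𝓝 (1 / ((M : ℝ) + 1))) := by
    intro M
    exact (tendsto_nat_ceil_mul_div_atTop (R := ℝ) (by positivity)).comp hsq
  have hinv : Tendsto (fun n : ℕ => 1 / √(n : ℝ)) atTop (𝓝 0) := by
    simpa [Function.comp_def] using tendsto_inv_atTop_zero.comp hsq
  have htail0 : Tendsto tail atTop (𝓝 0) := by
    have h1 := (tendsto_sum_nat_add fun d => 4 * C ^ 2 * alphaCoeff μ Z d).comp
      (tendsto_add_atTop_nat 1)
    simpa using h1.const_mul 2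
  have hmα := (tendsto_nat_mul_of_antitone (alphaCoeff_antitone (μ := μ) (X := Z)) hα0 hα).comp
      (tendsto_add_atTop_nat 1)
  set g : ℕ → ℕ → ℝ := fun M n => |t| * (3 * C * t ^ 2 * K₁ * (2 * (m M n / √n) + 1 / √n) +
    |t| * (2 * K₂ * (m M n / √n + 1 / √n) + tail (m M n)) +
    32 * C * (((M : ℝ) + 1) * (((m M n + 1 : ℕ) : ℝ) * alphaCoeff μ Z (m M n + 1)))) with hg
  refine tendsto_zero_of_eventually_norm_le g (fun M => |t| *
    (3 * C * t ^ 2 * K₁ * (2 * (1 / ((M : ℝ) + 1)) + 0) +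
      |t| * (2 * K₂ * (1 / ((M : ℝ) + 1) + 0) + 0) + 32 * C * (((M : ℝ) + 1) * 0)))
    (fun M => ?_) (fun M => ?_) ?_
  · filter_upwards [eventually_gt_atTop 0] with n hn
    have hn' : (0 : ℝ) < n := by exact_mod_cast hn
    have hs : 0 < √(n : ℝ) := Real.sqrt_pos.mpr hn'
    have hS : Measurable fun ω => (∑ i ∈ Finset.range n, Z i ω) / √n :=
      (Finset.measurable_fun_sum _ fun i _ => hZ i).div_const _
    have hSb : ∀ ω, |(∑ i ∈ Finset.range n, Z i ω) / √n| ≤ (∑ i ∈ Finset.range n, C) / √n := by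
      intro ω
      rw [abs_div, abs_of_pos hs]
      gcongr
      exact (Finset.abs_sum_le_sum_abs _ _).trans (Finset.sum_le_sum fun i _ => hC i ω)
    refine norm_integral_cexp_sub_exp_le hS hSb
      (div_nonneg (variance_nonneg _ _) hn'.le) fun x hx => ?_
    refine (norm_integral_stein_le hZ hC h0 hα hn (m M n) x).trans ?_
    have hx2 : x ^ 2 ≤ t ^ 2 := sq_le_sq.mpr hx
    have htl : 0 ≤ tail (m M n) := mul_nonneg (by norm_num) (tsum_nonneg fun d =>
      mul_nonneg (by positivity) (hα0 _))
    refine add_le_add (add_le_add ?_ ?_) ?_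
    · rw [show 2 * ((m M n : ℝ) / √n) + 1 / √n = (2 * m M n + 1) / √n by ring]
      gcongr
    · rw [show 2 * ((m M n : ℝ) + 1) * K₂ / √n = 2 * K₂ * (m M n / √n + 1 / √n) by ring]
      have : 0 ≤ 2 * K₂ * (m M n / √n + 1 / √n) + tail (m M n) := by positivity
      exact mul_le_mul_of_nonneg_right hx this
    · have h1 : √(n : ℝ) ≤ ((M : ℝ) + 1) * ((m M n + 1 : ℕ) : ℝ) := by
        have h2 : 1 / ((M : ℝ) + 1) * √n ≤ m M n := Nat.le_ceil _
        have h3 : (0 : ℝ) < (M : ℝ) + 1 := by positivity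
        rw [one_div, inv_mul_le_iff₀ h3] at h2
        push_cast
        nlinarith
      have := mul_le_mul_of_nonneg_right h1 (hα0 (m M n + 1))
      rw [mul_assoc] at this
      gcongr
  · have h1 := hm_div M
    have h2 := htail0.comp (hm_top M)
    have h3 := hmα.comp (hm_top M)
    exact ((((h1.const_mul 2).add hinv).const_mul _).add
      ((((h1.add hinv).const_mul _).add h2).const_mul _) |>.add
      ((h3.const_mul _).const_mul _)).const_mul _
  · have h1 : Tendsto (fun M : ℕ => 1 / ((M : ℝ) + 1)) atTop (𝓝 0) :=
      tendsto_one_div_add_atTop_nhds_zero_nat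
    have h2 := ((((h1.const_mul 2).add_const 0).const_mul (3 * C * t ^ 2 * K₁)).add
      ((((h1.add_const 0).const_mul (2 * K₂)).add_const 0).const_mul |t|)).const_mul |t|
    simpa using h2

end BoundedLimit

end TimeSeries

/-! ### The central limit theorem for strongly mixing sequences -/

namespace TimeSeries

open scoped Topology ENNReal

theorem abs_exp_neg_sub_exp_neg_le {x y : ℝ} (hx : 0 ≤ x) (hy : 0 ≤ y) :
    |Real.exp (-x) - Real.exp (-y)| ≤ |x - y| := by
  have key : ∀ u v : ℝ, 0 ≤ u → u ≤ v → |Real.exp (-u) - Real.exp (-v)| ≤ v - u := by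
    intro u v hu huv
    rw [abs_of_nonneg (sub_nonneg.mpr (Real.exp_le_exp.mpr (by linarith)))]
    have h1 : Real.exp (-v) = Real.exp (-u) * Real.exp (-(v - u)) := by
      rw [← Real.exp_add]; ring_nf
    have h2 := Real.add_one_le_exp (-(v - u))
    have h3 : Real.exp (-u) ≤ 1 := Real.exp_le_one_iff.mpr (by linarith)
    have h4 := Real.exp_pos (-u)
    rw [h1]
    nlinarith
  rcases le_total x y with h | h
  · rw [abs_sub_comm x, abs_of_nonneg (sub_nonneg.mpr h)]
    exact key x y hx h
  · rw [abs_sub_comm, abs_of_nonneg (sub_nonneg.mpr h)]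
    exact key y x hy h

theorem truncate_of_abs_le {K x : ℝ} (h : |x| ≤ K) : truncate K x = x := if_pos h

theorem abs_sub_truncate_le_abs (K x : ℝ) : |x - truncate K x| ≤ |x| := by
  unfold truncate; split_ifs <;> simp

section Truncation

variable {Ω : Type*} [MeasurableSpace Ω] {μ : Measure Ω}

theorem integral_abs_mul_le_sqrt {f g : Ω → ℝ} (hf : MemLp f 2 μ) (hg : MemLp g 2 μ) :
    ∫ ω, |f ω * g ω| ∂μ ≤ √(∫ ω, f ω ^ 2 ∂μ) * √(∫ ω, g ω ^ 2 ∂μ) := by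
  have h := integral_mul_norm_le_Lp_mul_Lq (μ := μ) (f := f) (g := g) (p := 2) (q := 2)
    Real.HolderConjugate.two_two (by simpa using hf) (by simpa using hg)
  simpa [abs_mul, Real.sqrt_eq_rpow] using h

theorem memLp_comp_of_abs_le {Y : Ω → ℝ} {p : ℝ≥0∞} (hY : MemLp Y p μ) {G : ℝ → ℝ}
    (hG : Measurable G) (hGx : ∀ x, |G x| ≤ |x|) : MemLp (fun ω => G (Y ω)) p μ :=
  hY.mono (hG.comp_aemeasurable hY.aemeasurable).aestronglyMeasurable (ae_of_all _ fun _ => hGx _)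

theorem tendsto_integral_sub_truncate {Y : Ω → ℝ} {δ : ℝ} (hδ : 0 < δ) (hY : Measurable Y)
    (hmom : MemLp Y (ENNReal.ofReal (2 + δ)) μ) :
    Tendsto (fun M : ℕ => ∫ ω, |Y ω - truncate M (Y ω)| ^ (2 + δ) ∂μ) atTop (𝓝 0) := by
  have h := tendsto_integral_of_dominated_convergence (μ := μ)
    (F := fun (M : ℕ) ω => |Y ω - truncate M (Y ω)| ^ (2 + δ)) (f := fun _ => (0 : ℝ))
    (fun ω => |Y ω| ^ (2 + δ)) (fun M => ?_) (integrable_abs_rpow (by linarith) hmom)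
    (fun M => ae_of_all _ fun ω => ?_) (ae_of_all _ fun ω => ?_)
  · simpa using h
  · have := measurable_truncate M
    exact (by fun_prop : Measurable fun ω => |Y ω - truncate M (Y ω)| ^
      (2 + δ)).aestronglyMeasurable
  · rw [Real.norm_eq_abs, abs_of_nonneg (by positivity)]
    exact Real.rpow_le_rpow (abs_nonneg _) (abs_sub_truncate_le_abs _ _) (by linarith)
  · refine tendsto_const_nhds.congr' ?_
    filter_upwards [eventually_ge_atTop ⌈|Y ω|⌉₊] with M hM
    rw [truncate_of_abs_le (Nat.ceil_le.mp hM), sub_self, abs_zero,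
      Real.zero_rpow (by linarith)]

end Truncation

section Limit

variable {Ω : Type*} [mΩ : MeasurableSpace Ω] {μ : Measure Ω} [IsProbabilityMeasure μ]
  {Z : ℕ → Ω → ℝ}

theorem alphaCoeff_comp_le {G : ℝ → ℝ} (hG : Measurable G) (n : ℕ) :
    alphaCoeff μ (fun i ω => G (Z i ω)) n ≤ alphaCoeff μ Z n :=
  alphaCoeff_add_le (r := 0) (fun m i h => hG.comp (by simpa using h 0 le_rfl)) n

theorem abs_covariance_comp_le (hZ : ∀ i, Measurable (Z i)) (hstat : StrictlyStationary μ Z)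
    {δ : ℝ} (hδ : 0 < δ) (hmom : MemLp (Z 0) (ENNReal.ofReal (2 + δ)) μ) {G : ℝ → ℝ}
    (hG : Measurable G) (hGx : ∀ x, |G x| ≤ |x|) (i d : ℕ) :
    |cov[fun ω => G (Z i ω), fun ω => G (Z (i + d) ω); μ]| ≤
      8 * (alphaCoeff μ Z d ^ (δ / (2 + δ)) *
        (∫ ω, |G (Z 0 ω)| ^ (2 + δ) ∂μ) ^ (2 / (2 + δ))) := by
  have hN : ∀ i, ∫ ω, |G (Z i ω)| ^ (2 + δ) ∂μ = ∫ ω, |G (Z 0 ω)| ^ (2 + δ) ∂μ := fun i =>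
    hstat.integral_comp_eq hZ i (G := fun x => |G x| ^ (2 + δ)) (by fun_prop)
  exact (alphaBound_alphaCoeff i d).abs_covariance_le_rpow (past_le hZ _) (future_le hZ _)
    (hG.comp (measurable_past le_rfl)) (hG.comp (measurable_future le_rfl)) hδ
    (memLp_comp_of_abs_le (hstat.memLp hZ hmom _) hG hGx)
    (memLp_comp_of_abs_le (hstat.memLp hZ hmom _) hG hGx) (hN _).le (hN _).le

/-- Meant for three choices of `G`: the identity, the truncation, and the part that truncation
removes. In the last case the moment on the right tends to zero as the level grows. -/
theorem variance_sum_comp_le (hZ : ∀ i, Measurable (Z i)) (hstat : StrictlyStationary μ Z)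
    {δ : ℝ} (hδ : 0 < δ) (hmom : MemLp (Z 0) (ENNReal.ofReal (2 + δ)) μ)
    (hmix : Summable fun n => alphaCoeff μ Z n ^ (δ / (2 + δ))) {G : ℝ → ℝ}
    (hG : Measurable G) (hGx : ∀ x, |G x| ≤ |x|) (I : Finset ℕ) :
    Var[fun ω => ∑ i ∈ I, G (Z i ω); μ] ≤ I.card * (16 * (∑' d, alphaCoeff μ Z d ^ (δ / (2 + δ))) *
      (∫ ω, |G (Z 0 ω)| ^ (2 + δ) ∂μ) ^ (2 / (2 + δ))) := by
  refine (variance_sum_le_card_mul_tsum (fun i => memLp_two_of_memLp hδ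
    (memLp_comp_of_abs_le (hstat.memLp hZ hmom _) hG hGx)) ((hmix.mul_right _).mul_left 8)
    (abs_covariance_comp_le hZ hstat hδ hmom hG hGx) I).trans (le_of_eq ?_)
  rw [tsum_mul_left, tsum_mul_right]
  ring

theorem summable_covariance (hZ : ∀ i, Measurable (Z i)) (hstat : StrictlyStationary μ Z)
    {δ : ℝ} (hδ : 0 < δ) (hmom : MemLp (Z 0) (ENNReal.ofReal (2 + δ)) μ)
    (hmix : Summable fun n => alphaCoeff μ Z n ^ (δ / (2 + δ))) :
    Summable fun d => cov[Z 0, Z d; μ] := by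
  refine Summable.of_norm_bounded ((hmix.mul_right
    ((∫ ω, |Z 0 ω| ^ (2 + δ) ∂μ) ^ (2 / (2 + δ)))).mul_left 8) fun d => ?_
  have := abs_covariance_comp_le hZ hstat hδ hmom measurable_id (fun _ => le_rfl) 0 d
  simpa using this

/-- The central limit theorem of Ibragimov for strictly stationary strongly mixing sequences, in
terms of characteristic functions. -/
theorem tendsto_integral_cexp_of_alphaMixing (hZ : ∀ i, Measurable (Z i))
    (hstat : StrictlyStationary μ Z) (h0 : ∫ ω, Z 0 ω ∂μ = 0) {δ : ℝ} (hδ : 0 < δ)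
    (hmom : MemLp (Z 0) (ENNReal.ofReal (2 + δ)) μ)
    (hmix : Summable fun n => alphaCoeff μ Z n ^ (δ / (2 + δ))) (t : ℝ) :
    Tendsto (fun n : ℕ =>
      ∫ ω, Complex.exp (Complex.I * (t * ((∑ i ∈ Finset.range n, Z i ω) / √n : ℝ))) ∂μ)
      atTop (𝓝 (Real.exp (-(t ^ 2 *
        (cov[Z 0, Z 0; μ] + 2 * ∑' d, cov[Z 0, Z (d + 1); μ]) / 2)) : ℂ)) := by
  set A := ∑' d, alphaCoeff μ Z d ^ (δ / (2 + δ)) with hA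
  have hA0 : 0 ≤ A := tsum_nonneg fun d => Real.rpow_nonneg (alphaCoeff_nonneg d) _
  have hZ2 : ∀ i, MemLp (Z i) 2 μ := fun i => memLp_two_of_memLp hδ (hstat.memLp hZ hmom i)
  have hZi : ∀ i, Integrable (Z i) μ := fun i => (hZ2 i).integrable (by norm_num)
  have hZ0 : ∀ i, ∫ ω, Z i ω ∂μ = 0 := fun i => (hstat.integral_eq hZ i).trans h0
  set σ2 := cov[Z 0, Z 0; μ] + 2 * ∑' d, cov[Z 0, Z (d + 1); μ] with hσ2
  set V : ℕ → ℝ := fun n => Var[fun ω => ∑ i ∈ Finset.range n, Z i ω; μ] / n with hV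
  have hVlim : Tendsto V atTop (𝓝 σ2) := tendsto_variance_sum_div hZ2
    (summable_covariance hZ hstat hδ hmom hmix) (hstat.covariance_eq hZ)
  set N : ℕ → ℝ := fun M => ∫ ω, |Z 0 ω - truncate M (Z 0 ω)| ^ (2 + δ) ∂μ with hN
  set κ : ℕ → ℝ := fun M => 16 * A * N M ^ (2 / (2 + δ)) with hκ
  set K : ℝ := 16 * A * (∫ ω, |Z 0 ω| ^ (2 + δ) ∂μ) ^ (2 / (2 + δ)) with hK
  have hκ0 : ∀ M, 0 ≤ κ M := fun M => by
    have : 0 ≤ N M := integral_nonneg fun ω => by positivity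
    positivity
  have hκlim : Tendsto κ atTop (𝓝 0) := by
    have h1 := (tendsto_integral_sub_truncate hδ (hZ 0) hmom).rpow_const (p := 2 / (2 + δ))
      (Or.inr (by positivity))
    rw [Real.zero_rpow (by positivity)] at h1
    simpa using h1.const_mul (16 * A)
  -- the centred truncated variables
  set c : ℕ → ℝ := fun M => ∫ ω, truncate M (Z 0 ω) ∂μ with hc
  set U : ℕ → ℕ → Ω → ℝ := fun M i ω => truncate M (Z i ω) - c M with hU
  have hUm : ∀ M i, Measurable (U M i) := fun M i =>
    ((measurable_truncate M).comp (hZ i)).sub_const _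
  have htb : ∀ (M : ℕ) i ω, |truncate M (Z i ω)| ≤ M := fun M i ω =>
    abs_truncate_le (Nat.cast_nonneg M) _
  have hti : ∀ (M : ℕ) i, Integrable (fun ω => truncate M (Z i ω)) μ := fun M i =>
    (memLp_of_abs_le (p := 1) ((measurable_truncate M).comp (hZ i)) (htb M i)).integrable le_rfl
  have hUb : ∀ M i ω, |U M i ω| ≤ M + M := fun M i ω =>
    (abs_sub _ _).trans (add_le_add (htb M i ω) (abs_integral_le_of_abs_le (htb M 0)))
  have hU0 : ∀ M i, ∫ ω, U M i ω ∂μ = 0 := by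
    intro M i
    simp only [hU]
    rw [integral_sub (hti M i) (integrable_const _),
      hstat.integral_comp_eq hZ i (measurable_truncate M)]
    simp [hc]
  have hUα : ∀ M, Summable (alphaCoeff μ (U M)) := by
    intro M
    have h1 : Summable (alphaCoeff μ Z) := summable_alphaCoeff
      ((div_le_one (by linarith)).mpr (by linarith)) hmix (by positivity)
    exact h1.of_nonneg_of_le alphaCoeff_nonneg fun n =>
      alphaCoeff_comp_le (G := fun x => truncate M x - c M)
        ((measurable_truncate M).sub_const _) n
  have hU2 : ∀ M i, MemLp (U M i) 2 μ := fun M i => memLp_of_abs_le (hUm M i) (hUb M i)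
  set S : ℕ → Ω → ℝ := fun n ω => ∑ i ∈ Finset.range n, Z i ω with hS
  set W : ℕ → ℕ → Ω → ℝ := fun M n ω => ∑ i ∈ Finset.range n, U M i ω with hW
  have hS2 : ∀ n, MemLp (S n) 2 μ := fun n => memLp_finsetSum _ fun i _ => hZ2 i
  have hW2 : ∀ M n, MemLp (W M n) 2 μ := fun M n => memLp_finsetSum _ fun i _ => hU2 M i
  have hSm : ∀ n, Measurable (S n) := fun n => Finset.measurable_fun_sum _ fun i _ => hZ i
  have hWm : ∀ M n, Measurable (W M n) := fun M n =>
    Finset.measurable_fun_sum _ fun i _ => hUm M i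
  have hS0 : ∀ n, ∫ ω, S n ω ∂μ = 0 := fun n => by
    simp only [hS]
    rw [integral_finsetSum _ fun i _ => hZi i]
    simp [hZ0]
  have hW0 : ∀ M n, ∫ ω, W M n ω ∂μ = 0 := fun M n => by
    simp only [hW]
    rw [integral_finsetSum _ fun i _ => (hU2 M i).integrable (by norm_num)]
    simp [hU0]
  have hSV : ∀ n, ∫ ω, S n ω ^ 2 ∂μ = Var[S n; μ] := fun n =>
    (variance_of_integral_eq_zero (hSm n).aemeasurable (hS0 n)).symm
  have hWV : ∀ M n, ∫ ω, W M n ω ^ 2 ∂μ = Var[W M n; μ] := fun M n =>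
    (variance_of_integral_eq_zero (hWm M n).aemeasurable (hW0 M n)).symm
  have hSle : ∀ n, ∫ ω, S n ω ^ 2 ∂μ ≤ n * K := fun n => by
    rw [hSV]
    simpa using variance_sum_comp_le hZ hstat hδ hmom hmix measurable_id (fun x => le_rfl)
      (Finset.range n)
  have hWle : ∀ M n, ∫ ω, W M n ω ^ 2 ∂μ ≤ n * K := fun M n => by
    rw [hWV]
    have h1 : W M n = fun ω => ∑ i ∈ Finset.range n, truncate M (Z i ω) - n * c M := by
      ext ω; simp [hW, hU]
    have h2 : Measurable fun ω => ∑ i ∈ Finset.range n, truncate M (Z i ω) :=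
      Finset.measurable_fun_sum _ fun i _ => (measurable_truncate M).comp (hZ i)
    rw [h1, variance_sub_const h2.aestronglyMeasurable]
    refine (variance_sum_comp_le hZ hstat hδ hmom hmix (measurable_truncate M)
      (abs_truncate_le_abs M) (Finset.range n)).trans ?_
    rw [Finset.card_range]
    have h3 : ∫ ω, |truncate M (Z 0 ω)| ^ (2 + δ) ∂μ ≤ ∫ ω, |Z 0 ω| ^ (2 + δ) ∂μ :=
      integral_mono_of_nonneg (ae_of_all _ fun ω => by positivity)
        (integrable_abs_rpow (by linarith) hmom) (ae_of_all _ fun ω =>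
          Real.rpow_le_rpow (abs_nonneg _) (abs_truncate_le_abs _ _) (by linarith))
    have h4 : 0 ≤ ∫ ω, |truncate M (Z 0 ω)| ^ (2 + δ) ∂μ :=
      integral_nonneg fun ω => by positivity
    simp only [hK]
    gcongr
  have hDle : ∀ M n, ∫ ω, (S n ω - W M n ω) ^ 2 ∂μ ≤ n * κ M := fun M n => by
    have h1 : (fun ω => S n ω - W M n ω) = fun ω =>
        ∑ i ∈ Finset.range n, (Z i ω - truncate M (Z i ω)) + n * c M := by
      ext ω; simp only [hS, hW, hU, Finset.sum_sub_distrib]; simp; ring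
    have h2 : Measurable fun ω => ∑ i ∈ Finset.range n, (Z i ω - truncate M (Z i ω)) :=
      Finset.measurable_fun_sum _ fun i _ => (hZ i).sub ((measurable_truncate M).comp (hZ i))
    have h3 : ∫ ω, (S n ω - W M n ω) ∂μ = 0 := by
      rw [integral_sub ((hS2 n).integrable (by norm_num)) ((hW2 M n).integrable (by norm_num)),
        hS0, hW0, sub_zero]
    have h4 : ∫ ω, (S n ω - W M n ω) ^ 2 ∂μ = Var[fun ω => S n ω - W M n ω; μ] :=
      (variance_of_integral_eq_zero ((hSm n).sub (hWm M n)).aemeasurable h3).symm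
    rw [h4, h1, variance_add_const h2.aestronglyMeasurable]
    simpa using variance_sum_comp_le hZ hstat hδ hmom hmix
      (measurable_id.sub (measurable_truncate M)) (abs_sub_truncate_le_abs M) (Finset.range n)
  -- Factor `S² - W² = (S - W)(S + W)` and apply Cauchy-Schwarz. The bound is uniform in `n`, so the
  -- truncated sums can be compared with the variance of the full sum directly, and no limit
  -- variance is needed for them.
  have hVdiff : ∀ M n, 0 < n → |V n - Var[W M n; μ] / n| ≤ √(κ M) * √(4 * K) := by
    intro M n hn
    have hn' : (0 : ℝ) < n := by exact_mod_cast hn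
    have h1 : |∫ ω, S n ω ^ 2 ∂μ - ∫ ω, W M n ω ^ 2 ∂μ| ≤ √(n * κ M) * √(n * (4 * K)) := by
      rw [← integral_sub (hS2 n).integrable_sq (hW2 M n).integrable_sq]
      have e : ∀ ω, S n ω ^ 2 - W M n ω ^ 2 = (S n ω - W M n ω) * (S n ω + W M n ω) :=
        fun ω => by ring
      simp only [e]
      refine abs_integral_le_integral_abs.trans ((integral_abs_mul_le_sqrt
        ((hS2 n).sub (hW2 M n)) ((hS2 n).add (hW2 M n))).trans ?_)
      refine mul_le_mul (Real.sqrt_le_sqrt (hDle M n)) (Real.sqrt_le_sqrt ?_)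
        (Real.sqrt_nonneg _) (Real.sqrt_nonneg _)
      calc ∫ ω, (S n + W M n) ω ^ 2 ∂μ ≤ ∫ ω, (2 * S n ω ^ 2 + 2 * W M n ω ^ 2) ∂μ := by
            refine integral_mono_of_nonneg (ae_of_all _ fun ω => by positivity)
              (((hS2 n).integrable_sq.const_mul 2).add ((hW2 M n).integrable_sq.const_mul 2))
              (ae_of_all _ fun ω => ?_)
            simp only [Pi.add_apply]
            nlinarith [sq_nonneg (S n ω - W M n ω)]
        _ = 2 * ∫ ω, S n ω ^ 2 ∂μ + 2 * ∫ ω, W M n ω ^ 2 ∂μ := by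
            rw [integral_add ((hS2 n).integrable_sq.const_mul 2)
              ((hW2 M n).integrable_sq.const_mul 2), integral_const_mul, integral_const_mul]
        _ ≤ n * (4 * K) := by linarith [hSle n, hWle M n]
    rw [hSV, hWV, Real.sqrt_mul hn'.le, Real.sqrt_mul hn'.le] at h1
    simp only [hV]
    rw [← sub_div, abs_div, abs_of_pos hn', div_le_iff₀ hn']
    refine h1.trans (le_of_eq ?_)
    nth_rewrite 3 [← Real.mul_self_sqrt hn'.le]
    ring
  have hφdiff : ∀ M n, 0 < n →
      ‖∫ ω, Complex.exp (Complex.I * (t * (S n ω / √n : ℝ))) ∂μ -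
        ∫ ω, Complex.exp (Complex.I * (t * (W M n ω / √n : ℝ))) ∂μ‖ ≤ |t| * √(κ M) := by
    intro M n hn
    have hn' : (0 : ℝ) < n := by exact_mod_cast hn
    have hs : 0 < √(n : ℝ) := Real.sqrt_pos.mpr hn'
    have hi : ∀ Y : Ω → ℝ, Measurable Y →
        Integrable (fun ω => Complex.exp (Complex.I * (t * (Y ω / √n : ℝ)))) μ := fun Y hY =>
      Integrable.of_bound (by fun_prop : Measurable _).aestronglyMeasurable 1
        (ae_of_all _ fun ω => (norm_cexp_I_mul_mul _ _).le)
    have hd2 : MemLp (fun ω => S n ω - W M n ω) 2 μ := (hS2 n).sub (hW2 M n)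
    have hdi : Integrable (fun ω => |S n ω - W M n ω|) μ := (hd2.integrable (by norm_num)).abs
    rw [← integral_sub (hi _ (hSm n)) (hi _ (hWm M n))]
    refine (norm_integral_le_of_norm_le (hdi.const_mul (|t| / √n)) (ae_of_all _ fun ω => ?_)).trans
      ?_
    · have e : Complex.exp (Complex.I * (t * (S n ω / √n : ℝ))) -
          Complex.exp (Complex.I * (t * (W M n ω / √n : ℝ))) =
          Complex.exp (Complex.I * (t * (W M n ω / √n : ℝ))) *
            (Complex.exp (Complex.I * (t / √n * (S n ω - W M n ω) : ℝ)) - 1) := by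
        rw [mul_sub, ← Complex.exp_add, mul_one]
        congr 2
        push_cast
        ring
      rw [e, norm_mul, norm_cexp_I_mul_mul, one_mul]
      refine Real.norm_exp_I_mul_ofReal_sub_one_le.trans (le_of_eq ?_)
      rw [Real.norm_eq_abs, abs_mul, abs_div, abs_of_pos hs]
    · rw [integral_const_mul]
      have h1 := (integral_abs_le_sqrt hd2).trans (Real.sqrt_le_sqrt (hDle M n))
      rw [Real.sqrt_mul hn'.le] at h1
      calc _ ≤ |t| / √n * (√n * √(κ M)) := by gcongr
        _ = |t| * √(κ M) := by field_simp
  have hB := fun M => tendsto_integral_cexp_sub_of_bounded (hUm M) (hUb M) (hU0 M) (hUα M) t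
  have hfinal : Tendsto (fun n : ℕ =>
      ∫ ω, Complex.exp (Complex.I * (t * (S n ω / √n : ℝ))) ∂μ -
        (Real.exp (-(t ^ 2 * V n / 2)) : ℂ)) atTop (𝓝 0) := by
    -- Three errors: truncation in the characteristic function, the bounded limit theorem at level
    -- `M`, and truncation in the variance. The middle one vanishes as `n → ∞`, the others as `M →
    -- ∞`.
    refine tendsto_zero_of_eventually_norm_le (fun M n => |t| * √(κ M) +
      ‖∫ ω, Complex.exp (Complex.I * (t * (W M n ω / √n : ℝ))) ∂μ -
        Real.exp (-(t ^ 2 * (Var[W M n; μ] / n) / 2))‖ +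
      t ^ 2 / 2 * (√(κ M) * √(4 * K)))
      (fun M => |t| * √(κ M) + 0 + t ^ 2 / 2 * (√(κ M) * √(4 * K))) (fun M => ?_) (fun M => ?_) ?_
    · filter_upwards [eventually_gt_atTop 0] with n hn
      have hn' : (0 : ℝ) < n := by exact_mod_cast hn
      have h1 : ‖(Real.exp (-(t ^ 2 * (Var[W M n; μ] / n) / 2)) : ℂ) -
          (Real.exp (-(t ^ 2 * V n / 2)) : ℂ)‖ ≤ t ^ 2 / 2 * (√(κ M) * √(4 * K)) := by
        rw [← Complex.ofReal_sub, Complex.norm_real, Real.norm_eq_abs]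
        have h2 := variance_nonneg (W M n) μ
        have h3 : 0 ≤ V n := div_nonneg (variance_nonneg _ _) hn'.le
        refine (abs_exp_neg_sub_exp_neg_le (by positivity) (by positivity)).trans ?_
        rw [← sub_div, ← mul_sub, abs_div, abs_mul, abs_of_nonneg (sq_nonneg t), abs_sub_comm,
          abs_two, mul_div_right_comm]
        exact mul_le_mul_of_nonneg_left (hVdiff M n hn) (by positivity)
      calc _ ≤ _ := norm_sub_le_norm_sub_add_norm_sub _
            (Real.exp (-(t ^ 2 * (Var[W M n; μ] / n) / 2)) : ℂ) _
        _ ≤ _ := add_le_add ((norm_sub_le_norm_sub_add_norm_sub _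
            (∫ ω, Complex.exp (Complex.I * (t * (W M n ω / √n : ℝ))) ∂μ) _).trans
            (add_le_add_left (hφdiff M n hn) _)) h1
    · exact ((tendsto_zero_iff_norm_tendsto_zero.mp (hB M)).const_add _).add_const _
    · have h1 : Tendsto (fun M => √(κ M)) atTop (𝓝 0) := by
        simpa using hκlim.sqrt
      simpa using ((h1.const_mul |t|).add_const 0).add
        ((h1.mul_const √(4 * K)).const_mul (t ^ 2 / 2))
  have hexp : Tendsto (fun n : ℕ => (Real.exp (-(t ^ 2 * V n / 2)) : ℂ)) atTop
      (𝓝 (Real.exp (-(t ^ 2 * σ2 / 2)) : ℂ)) := by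
    refine (Complex.continuous_ofReal.tendsto _).comp ((Real.continuous_exp.tendsto _).comp ?_)
    exact ((hVlim.const_mul (t ^ 2)).div_const 2).neg
  have := hfinal.add hexp
  simp only [sub_add_cancel, zero_add] at this
  exact this

end Limit

end TimeSeries

/-! ### Lag products -/

namespace TimeSeries

open scoped Topology ENNReal

section Lags

variable {Ω : Type*} [mΩ : MeasurableSpace Ω] {μ : Measure Ω} {X : ℕ → Ω → ℝ} {δ : ℝ}

/-- A strictly stationary sequence whose strong mixing coefficients decay at the rate that goes
with moments of order `2 + δ`. -/
structure StronglyMixing (μ : Measure Ω) (X : ℕ → Ω → ℝ) (δ : ℝ) : Prop where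
  measurable : ∀ i, Measurable (X i)
  stationary : StrictlyStationary μ X
  pos : 0 < δ
  summable : Summable fun n => alphaCoeff μ X n ^ (δ / (2 + δ))

theorem StronglyMixing.window [IsProbabilityMeasure μ] (h : StronglyMixing μ X δ)
    {F : (ℕ → ℝ) → ℝ} (hF : Measurable F) {r : ℕ}
    (hr : ∀ (m : MeasurableSpace Ω) (i : ℕ), (∀ j ≤ r, Measurable[m] (X (i + j))) →
      Measurable[m] fun ω => F fun j => X (i + j) ω) :
    StronglyMixing μ (fun i ω => F fun j => X (i + j) ω) δ where
  measurable i := hF.comp (measurable_pi_iff.mpr fun j => h.measurable _)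
  stationary := h.stationary.comp h.measurable hF
  pos := h.pos
  summable := summable_alphaCoeff_rpow_of_window hr
    (div_nonneg h.pos.le (by linarith [h.pos])) h.summable

theorem StronglyMixing.sub_const [IsProbabilityMeasure μ] (h : StronglyMixing μ X δ) (c : ℝ) :
    StronglyMixing μ (fun i ω => X i ω - c) δ :=
  h.window (F := fun x => x 0 - c) (by fun_prop) (r := 0) fun m i hi =>
    (hi 0 le_rfl).sub_const c

theorem measurable_lagProd (hX : ∀ i, Measurable (X i)) (k i : ℕ) :
    Measurable (lagProd μ X k i) := by
  have h1 := hX i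
  have h2 := hX (i + k)
  unfold lagProd
  fun_prop

theorem StronglyMixing.lagProd [IsProbabilityMeasure μ] (h : StronglyMixing μ X δ) (k : ℕ) :
    StronglyMixing μ (lagProd μ X k) δ :=
  h.window (F := fun x => (x 0 - ∫ ω', X 0 ω' ∂μ) * (x k - ∫ ω', X 0 ω' ∂μ)) (by fun_prop)
    (r := k) fun m i hi => ((hi 0 (Nat.zero_le _)).sub_const _).mul ((hi k le_rfl).sub_const _)

theorem memLp_lagProd [IsProbabilityMeasure μ] (h : StronglyMixing μ X δ)
    (hmom : MemLp (X 0) (ENNReal.ofReal (4 + 2 * δ)) μ) (k i : ℕ) :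
    MemLp (lagProd μ X k i) (ENNReal.ofReal (2 + δ)) μ := by
  have hδ := h.pos
  have : ENNReal.HolderTriple (ENNReal.ofReal (4 + 2 * δ)) (ENNReal.ofReal (4 + 2 * δ))
      (ENNReal.ofReal (2 + δ)) := by
    constructor
    rw [← ENNReal.ofReal_inv_of_pos (by linarith), ← ENNReal.ofReal_inv_of_pos (by linarith),
      ← ENNReal.ofReal_add (by positivity) (by positivity)]
    congr 1
    field_simp
    ring
  exact ((h.stationary.memLp h.measurable hmom (i + k)).sub (memLp_const _)).mul
    ((h.stationary.memLp h.measurable hmom i).sub (memLp_const _))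

theorem memLp_two_lagProd [IsProbabilityMeasure μ] (h : StronglyMixing μ X δ)
    (hmom : MemLp (X 0) (ENNReal.ofReal (4 + 2 * δ)) μ) (k i : ℕ) :
    MemLp (lagProd μ X k i) 2 μ :=
  memLp_two_of_memLp h.pos (memLp_lagProd h hmom k i)

theorem integral_lagProd [IsProbabilityMeasure μ] (h : StronglyMixing μ X δ) (k i : ℕ) :
    ∫ ω, lagProd μ X k i ω ∂μ = autocov μ X k := by
  rw [(h.lagProd k).stationary.integral_eq (h.lagProd k).measurable i]
  unfold autocov covariance TimeSeries.lagProd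
  rw [h.stationary.integral_eq h.measurable k, zero_add]

theorem summable_covariance_lagProd [IsProbabilityMeasure μ] (h : StronglyMixing μ X δ)
    (hmom : MemLp (X 0) (ENNReal.ofReal (4 + 2 * δ)) μ) (j k : ℕ) :
    Summable fun l => cov[lagProd μ X j 0, lagProd μ X k l; μ] := by
  have hδ := h.pos
  -- Davydov's inequality is stated with a common moment bound for both variables; the sum of the
  -- two moments serves.
  set N := ∫ ω, |lagProd μ X j 0 ω| ^ (2 + δ) ∂μ + ∫ ω, |lagProd μ X k 0 ω| ^ (2 + δ) ∂μ with hN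
  have hpos : ∀ k, 0 ≤ ∫ ω, |lagProd μ X k 0 ω| ^ (2 + δ) ∂μ :=
    fun k => integral_nonneg fun ω => by positivity
  -- The first lag product uses observations up to time `j`, so a gap exists only from there on.
  rw [← summable_nat_add_iff j]
  refine Summable.of_norm_bounded ((h.summable.mul_right (N ^ (2 / (2 + δ)))).mul_left 8)
    fun n => ?_
  refine (alphaBound_of_le (X := X) (k := j) (l := n + j) (n := n) (by omega)).abs_covariance_le_rpow
    (past_le h.measurable _) (future_le h.measurable _) ?_ ?_ hδ (memLp_lagProd h hmom _ _)
    (memLp_lagProd h hmom _ _) ?_ ?_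
  · exact ((measurable_past (Nat.zero_le _)).sub_const _).mul
      ((measurable_past (by omega)).sub_const _)
  · exact ((measurable_future le_rfl).sub_const _).mul
      ((measurable_future (by omega)).sub_const _)
  · linarith [hpos k]
  · rw [(h.lagProd k).stationary.integral_comp_eq (h.lagProd k).measurable (n + j)
      (G := fun x => |x| ^ (2 + δ)) (by fun_prop)]
    linarith [hpos j]

/-- Linear combinations of the centred lag products of orders `0, …, r`. -/
noncomputable def lagCombo (μ : Measure Ω) (X : ℕ → Ω → ℝ) {r : ℕ} (c : Fin (r + 1) → ℝ)
    (i : ℕ) (ω : Ω) : ℝ :=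
  ∑ j, c j * (lagProd μ X j i ω - autocov μ X j)

variable {r : ℕ} (c : Fin (r + 1) → ℝ)

theorem stronglyMixing_lagCombo [IsProbabilityMeasure μ] (h : StronglyMixing μ X δ) :
    StronglyMixing μ (lagCombo μ X c) δ := by
  refine h.window (F := fun x => ∑ j : Fin (r + 1), c j *
    ((x 0 - ∫ ω', X 0 ω' ∂μ) * (x j - ∫ ω', X 0 ω' ∂μ) - autocov μ X j)) (by fun_prop)
    (r := r) fun m i hi => ?_
  refine Finset.measurable_fun_sum _ fun j _ => Measurable.const_mul (Measurable.sub_const ?_ _) _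
  exact ((hi 0 (Nat.zero_le _)).sub_const _).mul ((hi j (by omega)).sub_const _)

theorem memLp_lagCombo [IsProbabilityMeasure μ] (h : StronglyMixing μ X δ)
    (hmom : MemLp (X 0) (ENNReal.ofReal (4 + 2 * δ)) μ) (i : ℕ) :
    MemLp (lagCombo μ X c i) (ENNReal.ofReal (2 + δ)) μ :=
  memLp_finsetSum _ fun j _ => ((memLp_lagProd h hmom j i).sub (memLp_const _)).const_mul _

theorem integral_lagCombo [IsProbabilityMeasure μ] (h : StronglyMixing μ X δ)
    (hmom : MemLp (X 0) (ENNReal.ofReal (4 + 2 * δ)) μ) (i : ℕ) :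
    ∫ ω, lagCombo μ X c i ω ∂μ = 0 := by
  have hi : ∀ j : Fin (r + 1), Integrable (lagProd μ X j i) μ :=
    fun j => (memLp_two_lagProd h hmom j i).integrable (by norm_num)
  have hc : ∀ j : Fin (r + 1),
      Integrable (fun ω => c j * (lagProd μ X j i ω - autocov μ X j)) μ :=
    fun j => ((hi j).sub (integrable_const _)).const_mul _
  unfold lagCombo
  rw [integral_finsetSum _ fun j _ => hc j]
  refine Finset.sum_eq_zero fun j _ => ?_
  rw [integral_const_mul, integral_sub (hi j) (integrable_const _), integral_lagProd h]
  simp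

theorem covariance_lagCombo [IsProbabilityMeasure μ] (h : StronglyMixing μ X δ)
    (hmom : MemLp (X 0) (ENNReal.ofReal (4 + 2 * δ)) μ) (i l : ℕ) :
    cov[lagCombo μ X c i, lagCombo μ X c l; μ] =
      ∑ j, ∑ k, c j * c k * cov[lagProd μ X j i, lagProd μ X k l; μ] := by
  have h2 : ∀ (j : Fin (r + 1)) i, MemLp (lagProd μ X j i) 2 μ := fun j i =>
    memLp_two_lagProd h hmom j i
  have h3 : ∀ (j : Fin (r + 1)) i,
      MemLp (fun ω => c j * (lagProd μ X j i ω - autocov μ X j)) 2 μ := fun j i =>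
    ((h2 j i).sub (memLp_const _)).const_mul _
  have e : ∀ i, lagCombo μ X c i =
      fun ω => ∑ j, c j * (lagProd μ X j i ω - autocov μ X j) := fun i => rfl
  rw [e i, e l, covariance_fun_sum_fun_sum (fun j => h3 j i) fun j => h3 j l]
  refine Finset.sum_congr rfl fun j _ => Finset.sum_congr rfl fun k _ => ?_
  rw [covariance_const_mul_left, covariance_const_mul_right,
    covariance_sub_const_left ((h2 j i).integrable (by norm_num)),
    covariance_sub_const_right ((h2 k l).integrable (by norm_num)), mul_assoc]

/-- This identifies the scalar limit variance in the Cramér-Wold argument. The two one-sided series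
of the matrix give the same quadratic form after exchanging `j` and `k`, hence the factor 2. -/
theorem dotProduct_longRunCov_mulVec [IsProbabilityMeasure μ] (h : StronglyMixing μ X δ)
    (hmom : MemLp (X 0) (ENNReal.ofReal (4 + 2 * δ)) μ) :
    c ⬝ᵥ (longRunCov μ X r).mulVec c =
      cov[lagCombo μ X c 0, lagCombo μ X c 0; μ] +
        2 * ∑' d, cov[lagCombo μ X c 0, lagCombo μ X c (d + 1); μ] := by
  have hs : ∀ j k : Fin (r + 1), Summable fun l : ℕ =>
      cov[lagProd μ X j 0, lagProd μ X k (l + 1); μ] := fun j k =>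
    (summable_nat_add_iff 1).mpr (summable_covariance_lagProd h hmom j k)
  have hs' : ∀ j k : Fin (r + 1), Summable fun l : ℕ =>
      cov[lagProd μ X j (l + 1), lagProd μ X k 0; μ] := fun j k =>
    (hs k j).congr fun l => covariance_comm _ _
  have h1 : ∑' d, cov[lagCombo μ X c 0, lagCombo μ X c (d + 1); μ] =
      ∑ j, ∑ k, c j * c k * ∑' l, cov[lagProd μ X j 0, lagProd μ X k (l + 1); μ] := by
    simp only [covariance_lagCombo c h hmom]
    rw [Summable.tsum_finsetSum fun j _ => summable_sum fun k _ => (hs j k).mul_left _]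
    refine Finset.sum_congr rfl fun j _ => ?_
    rw [Summable.tsum_finsetSum fun k _ => (hs j k).mul_left _]
    exact Finset.sum_congr rfl fun k _ => tsum_mul_left
  have h2 : ∑ j, ∑ k, c j * c k * ∑' l, cov[lagProd μ X j (l + 1), lagProd μ X k 0; μ] =
      ∑ j, ∑ k, c j * c k * ∑' l, cov[lagProd μ X j 0, lagProd μ X k (l + 1); μ] := by
    rw [Finset.sum_comm]
    refine Finset.sum_congr rfl fun j _ => Finset.sum_congr rfl fun k _ => ?_
    rw [mul_comm (c k)]
    congr 1
    exact tsum_congr fun l => covariance_comm _ _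
  rw [h1, covariance_lagCombo c h hmom, two_mul]
  nth_rewrite 2 [← h2]
  rw [← Finset.sum_add_distrib, ← Finset.sum_add_distrib]
  simp only [dotProduct, Matrix.mulVec, longRunCov, Matrix.of_apply, Finset.mul_sum]
  refine Finset.sum_congr rfl fun j _ => ?_
  rw [← Finset.sum_add_distrib, ← Finset.sum_add_distrib]
  refine Finset.sum_congr rfl fun k _ => ?_
  rw [(hs j k).tsum_add (hs' j k)]
  ring

/-- The quadratic form at `c` is the limit of the variances of partial sums of the combination,
divided by `n`, hence nonnegative. -/
theorem posSemidef_longRunCov [IsProbabilityMeasure μ] (h : StronglyMixing μ X δ)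
    (hmom : MemLp (X 0) (ENNReal.ofReal (4 + 2 * δ)) μ) : (longRunCov μ X r).PosSemidef := by
  refine Matrix.PosSemidef.of_dotProduct_mulVec_nonneg ?_ fun c => ?_
  · ext j k
    simp only [Matrix.conjTranspose_apply, longRunCov, Matrix.of_apply, star_trivial]
    rw [covariance_comm]
    congr 1
    refine tsum_congr fun l => ?_
    rw [add_comm, covariance_comm, covariance_comm (lagProd μ X k 0)]
  · rw [star_trivial, dotProduct_longRunCov_mulVec c h hmom]
    have hZ := stronglyMixing_lagCombo c h
    have hm := memLp_lagCombo c h hmom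
    refine ge_of_tendsto' (tendsto_variance_sum_div (fun i => memLp_two_of_memLp h.pos (hm i))
      (summable_covariance hZ.measurable hZ.stationary h.pos (hm 0) hZ.summable)
      (hZ.stationary.covariance_eq hZ.measurable)) fun n => ?_
    exact div_nonneg (variance_nonneg _ _) (Nat.cast_nonneg n)

/-- The normalized sum of the centred lag products of order `k`. -/
noncomputable def normalizedLagSum (μ : Measure Ω) (X : ℕ → Ω → ℝ) (k n : ℕ) (ω : Ω) : ℝ :=
  (∑ i ∈ Finset.range n, (lagProd μ X k i ω - autocov μ X k)) / √n

theorem measurable_normalizedLagSum (hX : ∀ i, Measurable (X i)) (k n : ℕ) :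
    Measurable (normalizedLagSum μ X k n) :=
  (Finset.measurable_fun_sum _ fun i _ => (measurable_lagProd hX k i).sub_const _).div_const _

theorem sum_mul_normalizedLagSum (n : ℕ) (ω : Ω) :
    ∑ j : Fin (r + 1), c j * normalizedLagSum μ X j n ω =
      (∑ i ∈ Finset.range n, lagCombo μ X c i ω) / √n := by
  unfold normalizedLagSum lagCombo
  rw [Finset.sum_comm, Finset.sum_div]
  refine Finset.sum_congr rfl fun j _ => ?_
  rw [← Finset.mul_sum, mul_div_assoc]

/-- The joint central limit theorem for linear images of the vector of lag products. -/
theorem tendstoInDistribution_normalizedLagSum [IsProbabilityMeasure μ]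
    (h : StronglyMixing μ X δ) (hmom : MemLp (X 0) (ENNReal.ofReal (4 + 2 * δ)) μ) {s : ℕ}
    (A : Matrix (Fin (r + 1)) (Fin s) ℝ) :
    TendstoInDistribution
      (fun (n : ℕ) (ω : Ω) => WithLp.toLp 2
        (A.transpose.mulVec fun j : Fin (r + 1) => normalizedLagSum μ X j n ω))
      atTop (id : EuclideanSpace ℝ (Fin s) → EuclideanSpace ℝ (Fin s)) (fun _ => μ)
      (multivariateGaussian 0 (A.transpose * longRunCov μ X r * A)) := by
  have hS : (A.transpose * longRunCov μ X r * A).PosSemidef := by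
    have := (posSemidef_longRunCov (r := r) h hmom).conjTranspose_mul_mul_same A
    rwa [Matrix.conjTranspose_eq_transpose_of_trivial] at this
  have hm : ∀ n, Measurable fun ω => WithLp.toLp 2
      (A.transpose.mulVec fun j : Fin (r + 1) => normalizedLagSum μ X j n ω) := by
    intro n
    refine (WithLp.measurable_toLp 2 _).comp (measurable_pi_iff.mpr fun k => ?_)
    simp only [Matrix.mulVec, dotProduct]
    exact Finset.measurable_fun_sum _ fun j _ =>
      (measurable_normalizedLagSum h.measurable j n).const_mul _
  refine ⟨fun n => (hm n).aemeasurable, aemeasurable_id, ?_⟩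
  refine ProbabilityMeasure.tendsto_iff_tendsto_charFun.2 fun t => ?_
  simp only [ProbabilityMeasure.coe_mk, Measure.map_id]
  -- Pairing `Aᵀ G` with `t` is pairing `G` with `A t`. So the joint characteristic function at `t`
  -- is the scalar one of `lagCombo` at `1`.
  set c : Fin (r + 1) → ℝ := A.mulVec t with hc
  have hZ := stronglyMixing_lagCombo c h
  have hclt := tendsto_integral_cexp_of_alphaMixing hZ.measurable hZ.stationary
    (integral_lagCombo c h hmom 0) h.pos (memLp_lagCombo c h hmom 0) hZ.summable 1
  rw [← dotProduct_longRunCov_mulVec c h hmom] at hclt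
  have hlim : charFun (multivariateGaussian 0 (A.transpose * longRunCov μ X r * A)) t =
      (Real.exp (-(1 ^ 2 * (c ⬝ᵥ (longRunCov μ X r).mulVec c) / 2)) : ℂ) := by
    rw [charFun_multivariateGaussian hS, ← Matrix.mulVec_mulVec, ← Matrix.mulVec_mulVec,
      Matrix.dotProduct_mulVec, Matrix.vecMul_transpose]
    simp [hc]
  rw [hlim]
  refine hclt.congr fun n => ?_
  rw [charFun_apply, integral_map (hm n).aemeasurable
    (by fun_prop : Continuous _).aestronglyMeasurable]
  refine integral_congr_ae (ae_of_all _ fun ω => ?_)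
  simp only
  rw [mul_comm Complex.I, Complex.ofReal_one, one_mul, ← sum_mul_normalizedLagSum]
  congr 3
  rw [PiLp.inner_apply]
  simp only [hc, Matrix.mulVec, dotProduct, Matrix.transpose_apply, RCLike.inner_apply,
    conj_trivial, Finset.sum_mul, Finset.mul_sum]
  rw [Finset.sum_comm]
  refine Finset.sum_congr rfl fun k _ => Finset.sum_congr rfl fun j _ => ?_
  ring

end Lags

end TimeSeries

/-! ### Sample autocovariances and sample autocorrelations -/

namespace TimeSeries

open scoped Topology ENNReal

theorem tendstoInMeasure_of_tendsto_integral_norm {Ω E : Type*} [MeasurableSpace Ω]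
    {μ : Measure Ω} [IsFiniteMeasure μ] [NormedAddCommGroup E] {f : ℕ → Ω → E} {g : Ω → E}
    (hi : ∀ n, Integrable (fun ω => ‖f n ω - g ω‖) μ)
    (h : Tendsto (fun n => ∫ ω, ‖f n ω - g ω‖ ∂μ) atTop (𝓝 0)) :
    TendstoInMeasure μ f atTop g := by
  rw [tendstoInMeasure_iff_measureReal_norm]
  intro ε hε
  refine squeeze_zero (fun n => measureReal_nonneg) (fun n => ?_) (by simpa using h.div_const ε)
  rw [le_div_iff₀ hε, mul_comm]
  exact mul_meas_ge_le_integral_of_nonneg (ae_of_all _ fun ω => norm_nonneg _) (hi n) ε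

theorem norm_toLp_le_sum_abs {s : ℕ} (v : Fin s → ℝ) : ‖WithLp.toLp 2 v‖ ≤ ∑ k, |v k| := by
  rw [EuclideanSpace.norm_eq]
  refine Real.sqrt_le_iff.mpr ⟨Finset.sum_nonneg fun k _ => abs_nonneg _, ?_⟩
  exact Finset.sum_sq_le_sq_sum_of_nonneg fun k _ => abs_nonneg _

theorem sum_sub_mean_mul_eq (x : ℕ → ℝ) (m : ℝ) (k : ℕ) {n : ℕ} (hn : 0 < n) :
    ∑ i ∈ Finset.range (n - k), (x i - (∑ i ∈ Finset.range n, x i) / n) *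
        (x (i + k) - (∑ i ∈ Finset.range n, x i) / n) =
      ∑ i ∈ Finset.range (n - k), (x i - m) * (x (i + k) - m) -
        (∑ i ∈ Finset.range n, (x i - m)) / n * (∑ i ∈ Finset.range (n - k), (x i - m) +
          ∑ i ∈ Finset.range (n - k), (x (i + k) - m)) +
        ((n - k : ℕ) : ℝ) * ((∑ i ∈ Finset.range n, (x i - m)) / n) ^ 2 := by
  have hn' : (n : ℝ) ≠ 0 := by exact_mod_cast hn.ne'
  have h1 : (∑ i ∈ Finset.range n, x i) / n = (∑ i ∈ Finset.range n, (x i - m)) / n + m := by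
    rw [Finset.sum_sub_distrib]
    simp only [Finset.sum_const, Finset.card_range, nsmul_eq_mul]
    field_simp
    ring
  rw [h1]
  set a := (∑ i ∈ Finset.range n, (x i - m)) / n
  have h2 : ∀ i, (x i - (a + m)) * (x (i + k) - (a + m)) =
      (x i - m) * (x (i + k) - m) - a * ((x i - m) + (x (i + k) - m)) + a ^ 2 := fun i => by ring
  simp only [h2]
  rw [Finset.sum_add_distrib, Finset.sum_sub_distrib, ← Finset.mul_sum,
    Finset.sum_add_distrib (f := fun i => x i - m)]
  simp

/-- The two normalizations differ by the last products, missing from the sample autocovariance (at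
most `k` of them), and by the terms from centring at the sample mean, which are quadratic in centred
sums. Those have second moments of order `n`, so after division by `n` everything is bounded in `L¹`
and `1/√n` remains. -/
theorem abs_sqrt_mul_sub_le (x : ℕ → ℝ) (m γ : ℝ) (k : ℕ) {n : ℕ} (hn : 0 < n) :
    |√n * ((∑ i ∈ Finset.range (n - k), (x i - (∑ i ∈ Finset.range n, x i) / n) *
        (x (i + k) - (∑ i ∈ Finset.range n, x i) / n)) / n - γ) -
      (∑ i ∈ Finset.range n, ((x i - m) * (x (i + k) - m) - γ)) / √n| ≤
    (∑ i ∈ Finset.Ico (n - k) n, |(x i - m) * (x (i + k) - m)| +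
      (2 * (∑ i ∈ Finset.range n, (x i - m)) ^ 2 +
        (∑ i ∈ Finset.range (n - k), (x i - m)) ^ 2 +
        (∑ i ∈ Finset.range (n - k), (x (i + k) - m)) ^ 2) / n) / √n := by
  have hn' : (0 : ℝ) < n := by exact_mod_cast hn
  have hs : 0 < √(n : ℝ) := Real.sqrt_pos.mpr hn'
  rw [sum_sub_mean_mul_eq x m k hn]
  set S := ∑ i ∈ Finset.range n, (x i - m)
  set P := ∑ i ∈ Finset.range (n - k), (x i - m)
  set P' := ∑ i ∈ Finset.range (n - k), (x (i + k) - m)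
  have hsplit : ∑ i ∈ Finset.range n, ((x i - m) * (x (i + k) - m) - γ) =
      ∑ i ∈ Finset.range (n - k), (x i - m) * (x (i + k) - m) +
        ∑ i ∈ Finset.Ico (n - k) n, (x i - m) * (x (i + k) - m) - n * γ := by
    rw [Finset.sum_range_add_sum_Ico _ (Nat.sub_le n k), Finset.sum_sub_distrib]
    simp
  rw [hsplit]
  set w := ∑ i ∈ Finset.range (n - k), (x i - m) * (x (i + k) - m)
  set w' := ∑ i ∈ Finset.Ico (n - k) n, (x i - m) * (x (i + k) - m)
  set N : ℝ := ((n - k : ℕ) : ℝ)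
  have hN : N ≤ n := Nat.cast_le.mpr (Nat.sub_le n k)
  have hN0 : 0 ≤ N := Nat.cast_nonneg _
  have e : √n * ((w - S / n * (P + P') + N * (S / n) ^ 2) / n - γ) - (w + w' - n * γ) / √n =
      (-w' + (N * (S / n) ^ 2 - S / n * (P + P'))) / √n := by
    have h1 : √(n : ℝ) = n / √n := by rw [eq_div_iff hs.ne', Real.mul_self_sqrt hn'.le]
    nth_rewrite 1 [h1]
    field_simp
    ring
  rw [e, abs_div, abs_of_pos hs]
  gcongr
  refine (abs_add_le _ _).trans (add_le_add ?_ ?_)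
  · rw [abs_neg]
    exact Finset.abs_sum_le_sum_abs _ _
  · have h1 : N * (S / n) ^ 2 ≤ S ^ 2 / n := by
      calc N * (S / n) ^ 2 ≤ n * (S / n) ^ 2 := by gcongr
        _ = S ^ 2 / n := by field_simp
    have h2 : 0 ≤ N * (S / n) ^ 2 := by positivity
    -- From `|S (P + P')| ≤ (S² + (P + P')²)/2` and `(P + P')² ≤ 2 P² + 2 P'²`.
    have h3 : |S / n * (P + P')| ≤ (S ^ 2 + P ^ 2 + P' ^ 2) / n := by
      rw [div_mul_eq_mul_div, abs_div, abs_of_pos hn']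
      gcongr
      rw [abs_le]
      constructor
      · nlinarith [sq_nonneg (S + (P + P')), sq_nonneg (P - P'), sq_nonneg S]
      · nlinarith [sq_nonneg (S - (P + P')), sq_nonneg (P - P'), sq_nonneg S]
    calc |N * (S / n) ^ 2 - S / n * (P + P')| ≤ |N * (S / n) ^ 2| + |S / n * (P + P')| :=
          abs_sub _ _
      _ ≤ S ^ 2 / n + (S ^ 2 + P ^ 2 + P' ^ 2) / n := by
          rw [abs_of_nonneg h2]; exact add_le_add h1 h3
      _ = _ := by ring

/-- The sample autocovariance of order `k` of the first `n` observations. -/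
noncomputable def sampleAutocov {Ω : Type*} (X : ℕ → Ω → ℝ) (k n : ℕ) (ω : Ω) : ℝ :=
  (∑ i ∈ Finset.range (n - k),
    (X i ω - sampleMean X n ω) * (X (i + k) ω - sampleMean X n ω)) / n

theorem sampleVar_eq_sampleAutocov {Ω : Type*} (X : ℕ → Ω → ℝ) (n : ℕ) :
    sampleVar X n = sampleAutocov X 0 n := by
  ext ω
  simp [sampleVar, sampleAutocov, sq]

section Remainder

variable {Ω : Type*} [mΩ : MeasurableSpace Ω] {μ : Measure Ω} {X : ℕ → Ω → ℝ} {δ : ℝ}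

theorem measurable_sampleAutocov (hX : ∀ i, Measurable (X i)) (k n : ℕ) :
    Measurable (sampleAutocov X k n) := by
  have h1 : Measurable (sampleMean X n) :=
    (Finset.measurable_fun_sum _ fun i _ => hX i).div_const _
  exact (Finset.measurable_fun_sum _ fun i _ =>
    ((hX i).sub h1).mul ((hX (i + k)).sub h1)).div_const _

theorem integrable_sampleAutocov [IsFiniteMeasure μ] (hX : ∀ i, MemLp (X i) 2 μ) (k n : ℕ) :
    Integrable (sampleAutocov X k n) μ := by
  have h1 : MemLp (sampleMean X n) 2 μ := by
    have h : MemLp (fun ω => ∑ i ∈ Finset.range n, X i ω) 2 μ :=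
      memLp_finsetSum _ fun i _ => hX i
    have e : sampleMean X n = fun ω => (∑ i ∈ Finset.range n, X i ω) * (n : ℝ)⁻¹ := by
      ext ω; rw [sampleMean, div_eq_mul_inv]
    rw [e]
    exact h.mul_const _
  exact (integrable_finsetSum _ fun i _ =>
    ((hX i).sub h1).integrable_mul ((hX (i + k)).sub h1)).div_const _

/-- The difference between the centred and scaled sample autocovariance and its linearization. -/
noncomputable def autocovRemainder (μ : Measure Ω) (X : ℕ → Ω → ℝ) (k n : ℕ) (ω : Ω) : ℝ :=
  √n * (sampleAutocov X k n ω - autocov μ X k) - normalizedLagSum μ X k n ω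

variable [IsProbabilityMeasure μ]

theorem StronglyMixing.memLp_two (h : StronglyMixing μ X δ)
    (hmom : MemLp (X 0) (ENNReal.ofReal (4 + 2 * δ)) μ) (i : ℕ) : MemLp (X i) 2 μ := by
  refine (h.stationary.memLp h.measurable hmom i).mono_exponent ?_
  rw [show (2 : ℝ≥0∞) = ENNReal.ofReal 2 by simp]
  exact ENNReal.ofReal_le_ofReal (by linarith [h.pos])

theorem integrable_normalizedLagSum (h : StronglyMixing μ X δ)
    (hmom : MemLp (X 0) (ENNReal.ofReal (4 + 2 * δ)) μ) (k n : ℕ) :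
    Integrable (normalizedLagSum μ X k n) μ :=
  (integrable_finsetSum _ fun i _ => ((memLp_two_lagProd h hmom k i).integrable
    (by norm_num)).sub (integrable_const _)).div_const _

theorem integrable_autocovRemainder (h : StronglyMixing μ X δ)
    (hmom : MemLp (X 0) (ENNReal.ofReal (4 + 2 * δ)) μ) (k n : ℕ) :
    Integrable (autocovRemainder μ X k n) μ :=
  (((integrable_sampleAutocov (h.memLp_two hmom) k n).sub (integrable_const _)).const_mul _).sub
    (integrable_normalizedLagSum h hmom k n)

/-- The variances of the sums of a strongly mixing sequence grow at most linearly. -/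
theorem StronglyMixing.exists_integral_sum_sq_le (h : StronglyMixing μ X δ)
    (hmom : MemLp (X 0) (ENNReal.ofReal (2 + δ)) μ) (h0 : ∫ ω, X 0 ω ∂μ = 0) :
    ∃ K, 0 ≤ K ∧ ∀ I : Finset ℕ, ∫ ω, (∑ i ∈ I, X i ω) ^ 2 ∂μ ≤ I.card * K := by
  refine ⟨16 * (∑' d, alphaCoeff μ X d ^ (δ / (2 + δ))) *
    (∫ ω, |X 0 ω| ^ (2 + δ) ∂μ) ^ (2 / (2 + δ)), ?_, fun I => ?_⟩
  · have h1 : 0 ≤ ∑' d, alphaCoeff μ X d ^ (δ / (2 + δ)) :=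
      tsum_nonneg fun d => Real.rpow_nonneg (alphaCoeff_nonneg d) _
    have h2 : 0 ≤ ∫ ω, |X 0 ω| ^ (2 + δ) ∂μ := integral_nonneg fun ω => by positivity
    positivity
  · have hi : ∀ i, Integrable (X i) μ := fun i =>
      (memLp_two_of_memLp h.pos (h.stationary.memLp h.measurable hmom i)).integrable (by norm_num)
    have h1 : ∫ ω, ∑ i ∈ I, X i ω ∂μ = 0 := by
      rw [integral_finsetSum _ fun i _ => hi i]
      exact Finset.sum_eq_zero fun i _ => (h.stationary.integral_eq h.measurable i).trans h0
    rw [← variance_of_integral_eq_zero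
      (Finset.measurable_fun_sum _ fun i _ => h.measurable i).aemeasurable h1]
    exact variance_sum_comp_le h.measurable h.stationary h.pos hmom h.summable measurable_id
      (fun _ => le_rfl) I

theorem exists_integral_abs_autocovRemainder_le (h : StronglyMixing μ X δ)
    (hmom : MemLp (X 0) (ENNReal.ofReal (4 + 2 * δ)) μ) (k : ℕ) :
    ∃ C, ∀ n : ℕ, 0 < n → ∫ ω, |autocovRemainder μ X k n ω| ∂μ ≤ C / √n := by
  set m := ∫ ω, X 0 ω ∂μ with hm
  have hY := h.sub_const m
  have hX1 : Integrable (X 0) μ := (h.memLp_two hmom 0).integrable (by norm_num)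
  have hYmom : MemLp (fun ω => X 0 ω - m) (ENNReal.ofReal (2 + δ)) μ :=
    (hmom.mono_exponent (ENNReal.ofReal_le_ofReal (by linarith [h.pos]))).sub (memLp_const _)
  have hY0 : ∫ ω, (X 0 ω - m) ∂μ = 0 := by
    rw [integral_sub hX1 (integrable_const _)]
    simp [hm]
  obtain ⟨K, hK0, hK⟩ := hY.exists_integral_sum_sq_le hYmom hY0
  have hY2 : ∀ i, MemLp (fun ω => X i ω - m) 2 μ := fun i =>
    (h.memLp_two hmom i).sub (memLp_const _)
  have hsq : ∀ I : Finset ℕ, Integrable (fun ω => (∑ i ∈ I, (X i ω - m)) ^ 2) μ := fun I =>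
    (memLp_finsetSum _ fun i _ => hY2 i).integrable_sq
  have hWi : ∀ i, Integrable (fun ω => |lagProd μ X k i ω|) μ := fun i =>
    ((memLp_two_lagProd h hmom k i).integrable (by norm_num)).abs
  have hWint : ∀ i, ∫ ω, |lagProd μ X k i ω| ∂μ = ∫ ω, |lagProd μ X k 0 ω| ∂μ := fun i =>
    (h.lagProd k).stationary.integral_comp_eq (h.lagProd k).measurable i (G := fun x => |x|)
      (by fun_prop)
  refine ⟨k * ∫ ω, |lagProd μ X k 0 ω| ∂μ + 4 * K, fun n hn => ?_⟩
  have hn' : (0 : ℝ) < n := by exact_mod_cast hn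
  have hshift : ∀ ω, ∑ i ∈ Finset.range (n - k), (X (i + k) ω - m) =
      ∑ i ∈ Finset.Ico k n, (X i ω - m) := by
    intro ω
    rw [Finset.sum_Ico_eq_sum_range]
    simp only [add_comm]
  have hcard : ((Finset.Ico k n).card : ℝ) ≤ n := by
    rw [Nat.card_Ico]; exact_mod_cast Nat.sub_le n k
  have hcard' : ((Finset.range (n - k)).card : ℝ) ≤ n := by
    rw [Finset.card_range]; exact_mod_cast Nat.sub_le n k
  have hcard'' : ((Finset.Ico (n - k) n).card : ℝ) ≤ k := by
    rw [Nat.card_Ico]; exact_mod_cast (by omega)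
  set B : Ω → ℝ := fun ω => (∑ i ∈ Finset.Ico (n - k) n, |lagProd μ X k i ω| +
      (2 * (∑ i ∈ Finset.range n, (X i ω - m)) ^ 2 +
        (∑ i ∈ Finset.range (n - k), (X i ω - m)) ^ 2 +
        (∑ i ∈ Finset.Ico k n, (X i ω - m)) ^ 2) / n) / √n with hB
  have hB1 : Integrable (fun ω => ∑ i ∈ Finset.Ico (n - k) n, |lagProd μ X k i ω|) μ :=
    integrable_finsetSum _ fun i _ => hWi i
  have hB2 : Integrable (fun ω => 2 * (∑ i ∈ Finset.range n, (X i ω - m)) ^ 2 +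
      (∑ i ∈ Finset.range (n - k), (X i ω - m)) ^ 2) μ := ((hsq _).const_mul 2).add (hsq _)
  have hB3 : Integrable (fun ω => 2 * (∑ i ∈ Finset.range n, (X i ω - m)) ^ 2 +
      (∑ i ∈ Finset.range (n - k), (X i ω - m)) ^ 2 +
      (∑ i ∈ Finset.Ico k n, (X i ω - m)) ^ 2) μ := hB2.add (hsq _)
  have hBi : Integrable B μ := (hB1.add (hB3.div_const _)).div_const _
  have hle : ∀ ω, |autocovRemainder μ X k n ω| ≤ B ω := by
    intro ω
    have := abs_sqrt_mul_sub_le (fun i => X i ω) m (autocov μ X k) k hn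
    rw [hshift] at this
    exact this
  calc ∫ ω, |autocovRemainder μ X k n ω| ∂μ ≤ ∫ ω, B ω ∂μ :=
        integral_mono_of_nonneg (ae_of_all _ fun ω => abs_nonneg _) hBi (ae_of_all _ hle)
    _ = (∑ i ∈ Finset.Ico (n - k) n, ∫ ω, |lagProd μ X k i ω| ∂μ +
      (2 * ∫ ω, (∑ i ∈ Finset.range n, (X i ω - m)) ^ 2 ∂μ +
        ∫ ω, (∑ i ∈ Finset.range (n - k), (X i ω - m)) ^ 2 ∂μ +
        ∫ ω, (∑ i ∈ Finset.Ico k n, (X i ω - m)) ^ 2 ∂μ) / n) / √n := by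
        rw [hB, integral_div, integral_add hB1 (hB3.div_const _), integral_div,
          integral_add hB2 (hsq _), integral_add ((hsq _).const_mul 2) (hsq _),
          integral_const_mul, integral_finsetSum _ fun i _ => hWi i]
    _ ≤ (k * ∫ ω, |lagProd μ X k 0 ω| ∂μ + (2 * (n * K) + n * K + n * K) / n) / √n := by
        simp only [hWint, Finset.sum_const, nsmul_eq_mul]
        have h1 := hK (Finset.range n)
        have h2 := (hK (Finset.range (n - k))).trans (mul_le_mul_of_nonneg_right hcard' hK0)
        have h3 := (hK (Finset.Ico k n)).trans (mul_le_mul_of_nonneg_right hcard hK0)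
        rw [Finset.card_range] at h1
        have h4 : 0 ≤ ∫ ω, |lagProd μ X k 0 ω| ∂μ := integral_nonneg fun ω => abs_nonneg _
        gcongr
    _ = _ := by congr 1; field_simp; ring

theorem tendsto_div_sqrt_atTop (C : ℝ) : Tendsto (fun n : ℕ => C / √(n : ℝ)) atTop (𝓝 0) :=
  (Real.tendsto_sqrt_atTop.comp tendsto_natCast_atTop_atTop).const_div_atTop C

theorem tendsto_integral_abs_autocovRemainder (h : StronglyMixing μ X δ)
    (hmom : MemLp (X 0) (ENNReal.ofReal (4 + 2 * δ)) μ) (k : ℕ) :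
    Tendsto (fun n => ∫ ω, |autocovRemainder μ X k n ω| ∂μ) atTop (𝓝 0) := by
  obtain ⟨C, hC⟩ := exists_integral_abs_autocovRemainder_le h hmom k
  refine squeeze_zero' (Eventually.of_forall fun n => integral_nonneg fun ω => abs_nonneg _) ?_
    (tendsto_div_sqrt_atTop C)
  filter_upwards [eventually_gt_atTop 0] with n hn using hC n hn

/-- The sample autocovariances are consistent. -/
theorem tendstoInMeasure_sampleAutocov (h : StronglyMixing μ X δ)
    (hmom : MemLp (X 0) (ENNReal.ofReal (4 + 2 * δ)) μ) (k : ℕ) :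
    TendstoInMeasure μ (sampleAutocov X k) atTop fun _ => autocov μ X k := by
  have hi : ∀ n, Integrable (fun ω => ‖sampleAutocov X k n ω - autocov μ X k‖) μ := fun n =>
    ((integrable_sampleAutocov (h.memLp_two hmom) k n).sub (integrable_const _)).norm
  refine tendstoInMeasure_of_tendsto_integral_norm hi ?_
  have hZ := (h.lagProd k).sub_const (autocov μ X k)
  have hZ2 : ∀ i, MemLp (fun ω => lagProd μ X k i ω - autocov μ X k) 2 μ := fun i =>
    (memLp_two_lagProd h hmom k i).sub (memLp_const _)
  obtain ⟨K, hK0, hK⟩ := hZ.exists_integral_sum_sq_le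
    ((memLp_lagProd h hmom k 0).sub (memLp_const _)) (by
      rw [integral_sub ((memLp_two_lagProd h hmom k 0).integrable (by norm_num))
        (integrable_const _), integral_lagProd h]
      simp)
  obtain ⟨C, hC⟩ := exists_integral_abs_autocovRemainder_le h hmom k
  have hG : ∀ n : ℕ, 0 < n → ∫ ω, |normalizedLagSum μ X k n ω| ∂μ ≤ √K := by
    intro n hn
    have hn' : (0 : ℝ) < n := by exact_mod_cast hn
    have h1 : MemLp (fun ω => ∑ i ∈ Finset.range n, (lagProd μ X k i ω - autocov μ X k)) 2 μ :=
      memLp_finsetSum _ fun i _ => hZ2 i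
    have h2 : MemLp (normalizedLagSum μ X k n) 2 μ := by
      have e : normalizedLagSum μ X k n = fun ω =>
          (∑ i ∈ Finset.range n, (lagProd μ X k i ω - autocov μ X k)) * (√(n : ℝ))⁻¹ := by
        ext ω; rw [normalizedLagSum, div_eq_mul_inv]
      rw [e]
      exact h1.mul_const _
    refine (integral_abs_le_sqrt h2).trans (Real.sqrt_le_sqrt ?_)
    have h3 := hK (Finset.range n)
    rw [Finset.card_range] at h3
    simp only [normalizedLagSum, div_pow, Real.sq_sqrt hn'.le]
    rwa [integral_div, div_le_iff₀ hn', mul_comm K]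
  have hlim := (tendsto_div_sqrt_atTop (√K)).add
    ((tendsto_div_sqrt_atTop C).mul (tendsto_div_sqrt_atTop 1))
  rw [mul_zero, add_zero] at hlim
  refine squeeze_zero' (Eventually.of_forall fun n => integral_nonneg fun ω => norm_nonneg _) ?_
    hlim
  filter_upwards [eventually_gt_atTop 0] with n hn
  have hn' : (0 : ℝ) < n := by exact_mod_cast hn
  have hs : 0 < √(n : ℝ) := Real.sqrt_pos.mpr hn'
  have hGi := (integrable_normalizedLagSum h hmom k n).abs
  have hEi := (integrable_autocovRemainder h hmom k n).abs
  calc ∫ ω, ‖sampleAutocov X k n ω - autocov μ X k‖ ∂μ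
      ≤ ∫ ω, (|normalizedLagSum μ X k n ω| + |autocovRemainder μ X k n ω|) / √n ∂μ := by
        refine integral_mono_of_nonneg (ae_of_all _ fun ω => norm_nonneg _)
          ((hGi.add hEi).div_const _) (ae_of_all _ fun ω => ?_)
        simp only
        rw [le_div_iff₀ hs, Real.norm_eq_abs]
        calc |sampleAutocov X k n ω - autocov μ X k| * √n
            = |√n * (sampleAutocov X k n ω - autocov μ X k)| := by
              rw [abs_mul, abs_of_pos hs, mul_comm]
          _ = |normalizedLagSum μ X k n ω + autocovRemainder μ X k n ω| := by
              unfold autocovRemainder; congr 1; ring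
          _ ≤ _ := abs_add_le _ _
    _ = (∫ ω, |normalizedLagSum μ X k n ω| ∂μ + ∫ ω, |autocovRemainder μ X k n ω| ∂μ) / √n := by
        rw [integral_div, integral_add hGi hEi]
    _ ≤ (√K + C / √n) / √n := by
        have := hG n hn
        have := hC n hn
        gcongr
    _ = √K / √n + C / √n * (1 / √n) := by ring

/-- The joint central limit theorem for linear images of the vector of sample autocovariances. -/
theorem tendstoInDistribution_sampleAutocov (h : StronglyMixing μ X δ)
    (hmom : MemLp (X 0) (ENNReal.ofReal (4 + 2 * δ)) μ) {r s : ℕ}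
    (A : Matrix (Fin (r + 1)) (Fin s) ℝ) :
    TendstoInDistribution
      (fun (n : ℕ) (ω : Ω) => WithLp.toLp 2
        (A.transpose.mulVec fun j : Fin (r + 1) =>
          √n * (sampleAutocov X j n ω - autocov μ X j)))
      atTop (id : EuclideanSpace ℝ (Fin s) → EuclideanSpace ℝ (Fin s)) (fun _ => μ)
      (multivariateGaussian 0 (A.transpose * longRunCov μ X r * A)) := by
  have hm : ∀ n : ℕ, Measurable fun ω => WithLp.toLp 2
      (A.transpose.mulVec fun j : Fin (r + 1) =>
        √n * (sampleAutocov X j n ω - autocov μ X j)) := by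
    intro n
    refine (WithLp.measurable_toLp 2 _).comp (measurable_pi_iff.mpr fun k => ?_)
    simp only [Matrix.mulVec, dotProduct]
    exact Finset.measurable_fun_sum _ fun j _ =>
      (((measurable_sampleAutocov h.measurable j n).sub_const _).const_mul _).const_mul _
  refine tendstoInDistribution_of_tendstoInMeasure_sub _ _
    (tendstoInDistribution_normalizedLagSum h hmom A) ?_ fun n => (hm n).aemeasurable
  set D : ℕ → Ω → EuclideanSpace ℝ (Fin s) := fun n ω => WithLp.toLp 2
    (A.transpose.mulVec fun j : Fin (r + 1) => autocovRemainder μ X j n ω) with hD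
  have hDm : ∀ n, Measurable (D n) := by
    intro n
    refine (WithLp.measurable_toLp 2 _).comp (measurable_pi_iff.mpr fun k => ?_)
    simp only [Matrix.mulVec, dotProduct]
    exact Finset.measurable_fun_sum _ fun j _ =>
      ((((measurable_sampleAutocov h.measurable j n).sub_const _).const_mul _).sub
        (measurable_normalizedLagSum h.measurable j n)).const_mul _
  have hei : ∀ (j : Fin (r + 1)) n, Integrable (fun ω => |autocovRemainder μ X j n ω|) μ :=
    fun j n => (integrable_autocovRemainder h hmom j n).abs
  have hsi : ∀ n, Integrable (fun ω => ∑ k, ∑ j, |A j k| * |autocovRemainder μ X j n ω|) μ :=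
    fun n => integrable_finsetSum _ fun k _ => integrable_finsetSum _ fun j _ =>
      (hei j n).const_mul _
  have hle : ∀ n ω, ‖D n ω‖ ≤ ∑ k, ∑ j, |A j k| * |autocovRemainder μ X j n ω| := by
    intro n ω
    refine (norm_toLp_le_sum_abs _).trans (Finset.sum_le_sum fun k _ => ?_)
    simp only [Matrix.mulVec, dotProduct, Matrix.transpose_apply]
    refine (Finset.abs_sum_le_sum_abs _ _).trans (Finset.sum_le_sum fun j _ => ?_)
    rw [abs_mul]
  have hDi : ∀ n, Integrable (fun ω => ‖D n ω‖) μ := fun n =>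
    (hsi n).mono' (hDm n).norm.aestronglyMeasurable (ae_of_all _ fun ω => by
      simpa using hle n ω)
  have hDlim : TendstoInMeasure μ D atTop fun _ => (0 : EuclideanSpace ℝ (Fin s)) := by
    refine tendstoInMeasure_of_tendsto_integral_norm (by simpa using hDi) ?_
    have hlim : Tendsto (fun n => ∑ k, ∑ j, |A j k| * ∫ ω, |autocovRemainder μ X j n ω| ∂μ) atTop
        (𝓝 (∑ _k : Fin s, ∑ j : Fin (r + 1), |A j _k| * 0)) :=
      tendsto_finsetSum _ fun k _ => tendsto_finsetSum _ fun j _ =>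
        (tendsto_integral_abs_autocovRemainder h hmom j).const_mul _
    simp only [mul_zero, Finset.sum_const_zero] at hlim
    refine squeeze_zero (fun n => integral_nonneg fun ω => norm_nonneg _) (fun n => ?_) hlim
    simp only [sub_zero]
    refine (integral_mono (hDi n) (hsi n) (hle n)).trans (le_of_eq ?_)
    rw [integral_finsetSum _ fun k _ => integrable_finsetSum _ fun j _ => (hei j n).const_mul _]
    refine Finset.sum_congr rfl fun k _ => ?_
    rw [integral_finsetSum _ fun j _ => (hei j n).const_mul _]
    exact Finset.sum_congr rfl fun j _ => integral_const_mul _ _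
  refine TendstoInMeasure.congr_left (fun n => ae_of_all _ fun ω => ?_) hDlim
  simp only [hD, Pi.sub_apply]
  rw [← WithLp.toLp_sub, ← Matrix.mulVec_sub]
  rfl

theorem tendstoInMeasure_div_sampleVar (h : StronglyMixing μ X δ)
    (hmom : MemLp (X 0) (ENNReal.ofReal (4 + 2 * δ)) μ) (h0 : autocov μ X 0 ≠ 0) :
    TendstoInMeasure μ (fun n ω => autocov μ X 0 / sampleVar X n ω) atTop fun _ => (1 : ℝ) := by
  have hm : ∀ n, Measurable (sampleAutocov X 0 n) := measurable_sampleAutocov h.measurable 0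
  -- Along almost surely convergent subsequences the quotient converges, since its denominator has a
  -- nonzero limit; the value `0` of a division by zero is harmless.
  have hq := (exists_seq_tendstoInMeasure_atTop_iff fun n =>
    (hm n).aestronglyMeasurable).mp (tendstoInMeasure_sampleAutocov h hmom 0)
  simp only [sampleVar_eq_sampleAutocov]
  refine (exists_seq_tendstoInMeasure_atTop_iff fun n =>
    (measurable_const.div (hm n)).aestronglyMeasurable).mpr fun ns hns => ?_
  obtain ⟨ns', hns', hae⟩ := hq ns hns
  refine ⟨ns', hns', ?_⟩
  filter_upwards [hae] with ω hω
  have hdiv := (tendsto_const_nhds (x := autocov μ X 0)).div hω h0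
  rw [div_self h0] at hdiv
  exact hdiv

/-- The central limit theorem for the sample autocorrelations. -/
theorem tendstoInDistribution_sampleAutocorr (h : StronglyMixing μ X δ)
    (hmom : MemLp (X 0) (ENNReal.ofReal (4 + 2 * δ)) μ) (hvar : 0 < Var[X 0; μ]) (r : ℕ) :
    TendstoInDistribution
      (fun (n : ℕ) (ω : Ω) => WithLp.toLp 2 fun k : Fin r =>
        √(n : ℝ) * (sampleAutocorr X (k + 1) n ω - autocorr μ X (k + 1)))
      atTop (id : EuclideanSpace ℝ (Fin r) → EuclideanSpace ℝ (Fin r)) (fun _ => μ)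
      (multivariateGaussian 0
        ((ratioJacobian fun k : Fin (r + 1) => autocov μ X k).transpose * longRunCov μ X r *
          ratioJacobian fun k : Fin (r + 1) => autocov μ X k)) := by
  set A := ratioJacobian fun k : Fin (r + 1) => autocov μ X k with hA
  have hγ : autocov μ X 0 = Var[X 0; μ] := covariance_self (h.measurable 0).aemeasurable
  have hγ0 : autocov μ X 0 ≠ 0 := by rw [hγ]; exact hvar.ne'
  have hqm : ∀ n, Measurable (sampleVar X n) := fun n => by
    rw [sampleVar_eq_sampleAutocov]; exact measurable_sampleAutocov h.measurable 0 n
  set V : ℕ → Ω → EuclideanSpace ℝ (Fin r) := fun n ω => WithLp.toLp 2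
    (A.transpose.mulVec fun j : Fin (r + 1) => √n * (sampleAutocov X j n ω - autocov μ X j)) with hV
  have hslutsky := (tendstoInDistribution_sampleAutocov h hmom
    A).continuous_comp_prodMk_of_tendstoInMeasure_const
    (g := fun z : EuclideanSpace ℝ (Fin r) × ℝ => z.2 • z.1) (by fun_prop)
    (tendstoInMeasure_div_sampleVar h hmom hγ0)
    fun n => (measurable_const.div (hqm n)).aemeasurable
  simp only [id, one_smul] at hslutsky
  have hTm : ∀ n : ℕ, Measurable fun ω => WithLp.toLp 2 fun k : Fin r =>
      √(n : ℝ) * (sampleAutocorr X (k + 1) n ω - autocorr μ X (k + 1)) := by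
    intro n
    refine (WithLp.measurable_toLp 2 _).comp (measurable_pi_iff.mpr fun k => ?_)
    exact (((measurable_sampleAutocov h.measurable (k + 1) n).div (hqm n)).sub_const _).const_mul _
  refine tendstoInDistribution_of_tendstoInMeasure_sub _ _ hslutsky ?_
    fun n => (hTm n).aemeasurable
  rw [tendstoInMeasure_iff_measureReal_norm]
  intro ε hε
  -- The two sequences can differ only where the sample variance is zero. There it is at distance
  -- `|γ₀|` from `γ₀`, an event whose probability tends to zero by consistency.
  have hq := (tendstoInMeasure_iff_measureReal_norm.mp
    (tendstoInMeasure_sampleAutocov h hmom 0)) |autocov μ X 0| (abs_pos.mpr hγ0)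
  refine squeeze_zero (fun n => measureReal_nonneg) (fun n => measureReal_mono fun ω hω => ?_) hq
  have hq0 : sampleAutocov X 0 n ω = 0 := by
    by_contra hne
    -- The exact linearization of the ratio: `γ̂_k/γ̂₀ - γ_k/γ₀ = (γ₀/γ̂₀) ((γ̂_k - γ_k)/γ₀ - γ_k
    -- (γ̂₀ - γ₀)/γ₀²)`, and the last bracket is the component of `Aᵀ (γ̂ - γ)`.
    have hzero : WithLp.toLp 2 (fun k : Fin r =>
        √(n : ℝ) * (sampleAutocorr X (k + 1) n ω - autocorr μ X (k + 1))) =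
        (autocov μ X 0 / sampleVar X n ω) • V n ω := by
      ext k
      simp only [hV, PiLp.smul_apply, smul_eq_mul, Matrix.mulVec, dotProduct,
        Matrix.transpose_apply, Fin.sum_univ_succ, hA, ratioJacobian, Matrix.of_apply,
        Fin.cases_zero, Fin.cases_succ, Fin.val_zero, Fin.val_succ, ite_mul, zero_mul,
        Finset.sum_ite_eq', Finset.mem_univ, if_true]
      have e1 : sampleAutocorr X (k + 1) n ω =
          sampleAutocov X (k + 1) n ω / sampleAutocov X 0 n ω := by
        rw [← sampleVar_eq_sampleAutocov]; rfl
      have e2 : autocorr μ X (k + 1) = autocov μ X (k + 1) / autocov μ X 0 := by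
        rw [hγ]; rfl
      rw [e1, e2, sampleVar_eq_sampleAutocov]
      field_simp
      ring
    have hω' : ε ≤ ‖WithLp.toLp 2 (fun k : Fin r =>
        √(n : ℝ) * (sampleAutocorr X (k + 1) n ω - autocorr μ X (k + 1))) -
        (autocov μ X 0 / sampleVar X n ω) • V n ω - 0‖ := hω
    rw [hzero, sub_self, sub_zero, norm_zero] at hω'
    linarith
  show |autocov μ X 0| ≤ ‖sampleAutocov X 0 n ω - autocov μ X 0‖
  rw [hq0, zero_sub, norm_neg, Real.norm_eq_abs]

end Remainder

end TimeSeries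

theorem mainTheorem7 {Ω : Type*} [MeasurableSpace Ω] (μ : Measure Ω) [IsProbabilityMeasure μ]
    (X : ℕ → Ω → ℝ) (hmeas : ∀ i, Measurable (X i))
    (hstat : TimeSeries.StrictlyStationary μ X)
    (hvar : 0 < Var[X 0; μ])
    (δ : ℝ) (hδ : 0 < δ)
    (hmom : MemLp (X 0) (ENNReal.ofReal (4 + 2 * δ)) μ)
    (hmix : Summable fun n : ℕ => TimeSeries.alphaCoeff μ X n ^ (δ / (2 + δ)))
    (r : ℕ) :
    (∀ j k : Fin (r + 1), Summable fun l : ℕ =>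
      cov[TimeSeries.lagProd μ X j 0, TimeSeries.lagProd μ X k (l + 1); μ]) ∧
    (TimeSeries.longRunCov μ X r).PosSemidef ∧
    TendstoInDistribution
      (fun (n : ℕ) (ω : Ω) => WithLp.toLp 2 fun k : Fin r =>
        √(n : ℝ) * (TimeSeries.sampleAutocorr X (k + 1) n ω - TimeSeries.autocorr μ X (k + 1)))
      atTop (id : EuclideanSpace ℝ (Fin r) → EuclideanSpace ℝ (Fin r)) (fun _ => μ)
      (multivariateGaussian 0
        ((TimeSeries.ratioJacobian fun k : Fin (r + 1) => TimeSeries.autocov μ X k).transpose *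
          TimeSeries.longRunCov μ X r *
          TimeSeries.ratioJacobian fun k : Fin (r + 1) => TimeSeries.autocov μ X k)) := by
  have h : TimeSeries.StronglyMixing μ X δ := ⟨hmeas, hstat, hδ, hmix⟩
  exact ⟨fun j k => (summable_nat_add_iff 1).mpr (TimeSeries.summable_covariance_lagProd h hmom j k),
    TimeSeries.posSemidef_longRunCov h hmom,
    TimeSeries.tendstoInDistribution_sampleAutocorr h hmom hvar r⟩
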